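/- Let $\mathbb B=\{0,1\}$. A weighted language is a function $\tilde p:\mathbb B^*\to\mathbb R_{\ge 0}$. For $\hat x\in\mathbb B^*$ let $Z(\hat x)=\sum_{x\in\mathbb B^*,\ \hat x\preceq x}\tilde p(x)$ be the total weight of the strings with prefix $\hat x$; $\tilde p$ is normalizable if $0<Z(\varepsilon)<\infty$. If moreover $Z(\hat x)>0$, put $p(b\mid\hat x)=Z(\hat x b)/Z(\hat x)$ for $b\in\mathbb B$ and $p(\$\mid\hat x)=\tilde p(\hat x)/Z(\hat x)$, where $\$$ stands for the end of the string. $\tilde p$ is efficiently computable if a Turing machine maps every $x$ to $\tilde p(x)$, written as a fraction of natural numbers in binary, in time polynomial in $|x|$. A Turing machine $M$ efficiently locally normalizes $\tilde p$ with compact parameters $(\theta_n)_{n\in\mathbb N}$, $\theta_n\in\mathbb B^*$, if $\tilde p$ is normalizable and there is a polynomial $P$ such that for every $n$: $|\theta_n|\le P(n)$; on input $\theta_n$ the machine $M$ outputs within $P(n)$ steps the description of a Turing machine $q_n$; and, for all $\hat x\in\mathbb B^*$ with $|\hat x|\le n$ and all $x\in\{0,1,\$\}$, the machine $q_n$ halts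 on input $\hat x x$ within $P(n)$ steps and, if $Z(\hat x)>0$ and $p(x\mid\hat x)$ is rational, outputs exactly $p(x\mid\hat x)$ as a fraction. (Nothing is required of the output where $p(x\mid\hat x)$ is irrational.) Consider Boolean formulas built from variables $A_1,A_2,\dots$ with $\neg,\wedge,\vee$, and let $\mathrm{enc}$ be the prefix-free encoding of formulas by bit strings in Polish notation: $\mathrm{enc}(A_{i+1})=00\,1^i0$, $\mathrm{enc}(\neg\phi)=01\,\mathrm{enc}(\phi)$, $\mathrm{enc}(\phi\wedge\psi)=10\,\mathrm{enc}(\phi)\,\mathrm{enc}(\psi)$, $\mathrm{enc}(\phi\vee\psi)=11\,\mathrm{enc}(\phi)\,\mathrm{enc}(\psi)$. Say that $a\in\mathbb B^j$ satisfies $\phi$ if the set of variables mentioned in $\phi$ is exactly $\{A_1,\dots,A_j\}$ and $\phi$ is true when $A_i=a_i$ for all $i$. Define $\tilde p(x)=(1/3)^{|x|+1}$ if $x=\mathrm{enc}(\phi)\,a$ for a formula $\phi$ and a string $a$ that satisfies $\phi$, and $\tilde p(x)=0$ otherwise. **Theorem.** The weighted language $\tilde p$ is efficiently computable and normalizable.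 If $\mathrm{NP}\not\subseteq\mathrm{P/poly}$, then there are no Turing machine $M$ and parameters $(\theta_n)_{n\in\mathbb N}$ such that $M$ efficiently locally normalizes $\tilde p$ with compact parameters $(\theta_n)_{n\in\mathbb N}$. Here a language $L\subseteq\mathbb B^*$ is in P/poly if there are a Turing machine $M$, strings $\theta_n\in\mathbb B^*$ and a polynomial $P$ such that for every $n$, $|\theta_n|\le P(n)$ and $M$ on input $\theta_n$ outputs within $P(n)$ steps the description of a Turing machine that decides membership in $L$ of every string of length $n$ within $P(n)$ steps. -/

import Mathlib

open scoped NNReal ENNReal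

namespace SeqModel

/-! ### Turing machines with a finite description

A single-tape Turing machine is a finite list of quadruples, run with Mathlib's `Turing.TM0`
semantics (two-way infinite tape; each step moves the head or writes a symbol).  States and tape
symbols are numbered; `0` is the start state and `0` is the blank.  A machine only knows the
finitely many states and symbols occurring in its list. -/

/-- In state `state`, reading `read`: perform `act` and go to state `next`. -/
structure Quadruple where
  state : ℕ
  read : ℕ
  act : Turing.TM0.Stmt ℕ
  next : ℕ

/-- A Turing machine, given by its (finite) table of instructions. -/
abbrev TM : Type := List Quadruple

/-- The transition function of a machine: the first applicable quadruple is used, and the machine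
halts when there is none. -/
def TM.toMachine (M : TM) : Turing.TM0.Machine ℕ ℕ := fun q a =>
  (M.find? fun r => r.state == q && r.read == a).map fun r => (r.next, r.act)

/-- `M.Outputs w v t`: started on the tape `w` (head on the first symbol, everything else blank)
the machine `M` halts after at most `t` steps, leaving the tape with exactly `v` (head on the first
symbol of `v`, everything else blank). -/
def TM.Outputs (M : TM) (w v : List ℕ) (t : ℕ) : Prop :=
  ∃ c : Turing.TM0.Cfg ℕ ℕ,
    Nonempty (StateTransition.EvalsToInTime (Turing.TM0.step M.toMachine)
      (Turing.TM0.init w) (some c) t) ∧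
    Turing.TM0.step M.toMachine c = none ∧ c.Tape = Turing.Tape.mk₁ v

/-- `M.HaltsIn w t`: started on the tape `w`, the machine `M` halts after at most `t` steps. -/
def TM.HaltsIn (M : TM) (w : List ℕ) (t : ℕ) : Prop :=
  ∃ c : Turing.TM0.Cfg ℕ ℕ,
    Nonempty (StateTransition.EvalsToInTime (Turing.TM0.step M.toMachine)
      (Turing.TM0.init w) (some c) t) ∧
    Turing.TM0.step M.toMachine c = none

/-- The tape symbol `1` stands for the bit `0`, and the tape symbol `2` for the bit `1`. -/
def bitSym (b : Bool) : ℕ := cond b 2 1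

/-- An additional tape symbol, used as separator and as the end-of-string symbol `$`. -/
def sepSym : ℕ := 3

/-- A bit string as a word on the tape. -/
def word (x : List Bool) : List ℕ := x.map bitSym

/-- A fraction `a / b` as a word on the tape: both numbers in binary, least significant bit first,
with a separator between them. -/
def fracWord (a b : ℕ) : List ℕ := word a.bits ++ sepSym :: word b.bits

/-- On input `w`, within `t` steps, `M` outputs a fraction whose value is the number `r`. -/
def TM.OutputsValue (M : TM) (w : List ℕ) (r : ℝ) (t : ℕ) : Prop :=
  ∃ a b : ℕ, b ≠ 0 ∧ (a : ℝ) / (b : ℝ) = r ∧ M.Outputs w (fracWord a b) t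

/-! ### Describing machines by bit strings -/

/-- Unary code of a number: `n` ones followed by a zero. -/
def unary (n : ℕ) : List Bool := List.replicate n true ++ [false]

/-- Code of an elementary action. -/
def actCode : Turing.TM0.Stmt ℕ → List Bool
  | .move .left => [false, false]
  | .move .right => [false, true]
  | .write a => true :: unary a

/-- Code of an instruction. -/
def Quadruple.code (r : Quadruple) : List Bool :=
  unary r.state ++ unary r.read ++ actCode r.act ++ unary r.next

/-- The description of a machine as a bit string: each instruction is preceded by a one, and the
list is terminated by a zero. -/
def TM.code : TM → List Bool
  | [] => [false]
  | r :: M => true :: (r.code ++ TM.code M)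

theorem unary_append_inj {m n : ℕ} {u v : List Bool} (h : unary m ++ u = unary n ++ v) :
    m = n ∧ u = v := by
  induction m generalizing n with
  | zero => cases n <;> simp_all [unary, List.replicate_succ]
  | succ m ih =>
    cases n with
    | zero => simp [unary, List.replicate_succ] at h
    | succ n =>
      have := @ih n (by simpa [unary, List.replicate_succ] using h)
      exact ⟨by rw [this.1], this.2⟩

theorem actCode_append_inj {s t : Turing.TM0.Stmt ℕ} {u v : List Bool}
    (h : actCode s ++ u = actCode t ++ v) : s = t ∧ u = v := by
  rcases s with (_ | _) | a <;> rcases t with (_ | _) | b <;> simp_all [actCode]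
  exact unary_append_inj h

/-- A description determines the machine. -/
theorem TM.code_injective : Function.Injective TM.code := by
  intro M
  induction M with
  | nil => intro N h; cases N <;> simp_all [TM.code]
  | cons r M ih =>
    intro N h
    cases N with
    | nil => simp [TM.code] at h
    | cons s N =>
      simp only [TM.code, Quadruple.code, List.cons.injEq, true_and, List.append_assoc] at h
      obtain ⟨h1, h⟩ := unary_append_inj h
      obtain ⟨h2, h⟩ := unary_append_inj h
      obtain ⟨h3, h⟩ := actCode_append_inj h
      obtain ⟨h4, h⟩ := unary_append_inj h
      rw [ih h]
      cases r; cases s; simp_all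

/-- `M.Builds θ M' t`: on input `θ`, the machine `M` outputs, within `t` steps, the description of
the machine `M'`. -/
def TM.Builds (M : TM) (θ : List Bool) (M' : TM) (t : ℕ) : Prop :=
  M.Outputs (word θ) (word M'.code) t

/-! ### The classes NP and P/poly -/

/-- `M` answers the question `P` on input `w` within `t` steps. -/
def TM.Answers (M : TM) (w : List ℕ) (P : Prop) (t : ℕ) : Prop :=
  (P → M.Outputs w (word [true]) t) ∧ (¬ P → M.Outputs w (word [false]) t)

/-- The class NP: `x ∈ L` iff there is a polynomially long certificate `c` for which the relation
`R x c` holds, where `R` is decidable in time polynomial in the lengths of `x` and `c`. -/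
def NP : Set (Language Bool) :=
  {L | ∃ (R : List Bool → List Bool → Prop) (M : TM) (T P : Polynomial ℕ),
    (∀ x c, M.Answers (word x ++ sepSym :: word c) (R x c) (T.eval (x.length + c.length))) ∧
    ∀ x, x ∈ L ↔ ∃ c : List Bool, c.length ≤ P.eval x.length ∧ R x c}

/-- The class P/poly: from advice strings `θ n` of polynomial length, one machine `M` builds in
polynomial time machines `M'` that decide in polynomial time the inputs of length `n`. -/
def PPoly : Set (Language Bool) :=
  {L | ∃ (M : TM) (θ : ℕ → List Bool) (P : Polynomial ℕ), ∀ n : ℕ,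
    (θ n).length ≤ P.eval n ∧
    ∃ M' : TM, M.Builds (θ n) M' (P.eval n) ∧
      ∀ x : List Bool, x.length = n → M'.Answers (word x) (x ∈ L) (P.eval n)}

/-! ### Weighted languages over the alphabet `{0,1}` -/

/-- A weighted language assigns a nonnegative real weight to every bit string. -/
abbrev WeightedLanguage : Type := List Bool → ℝ≥0

namespace WeightedLanguage

/-- `Z u`: the total weight of all strings that have `u` as a prefix. -/
noncomputable def prefixWeight (p : WeightedLanguage) (u : List Bool) : ℝ≥0∞ :=
  ∑' x : {x : List Bool // u <+: x}, (p x.1 : ℝ≥0∞)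

/-- The global normalizing constant is positive and finite. -/
def Normalizable (p : WeightedLanguage) : Prop :=
  0 < ∑' x : List Bool, (p x : ℝ≥0∞) ∧ ∑' x : List Bool, (p x : ℝ≥0∞) < ∞

/-- The local conditional probability that the prefix `u` is followed by the bit `b` (`some b`), or
that the string ends after `u` (`none`).  It is meaningful if `p` is normalizable and
`p.prefixWeight u` is positive. -/
noncomputable def localProb (p : WeightedLanguage) (u : List Bool) : Option Bool → ℝ
  | some b => (p.prefixWeight (u ++ [b]) / p.prefixWeight u).toReal
  | none => ((p u : ℝ≥0∞) / p.prefixWeight u).toReal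

/-- A Turing machine computes the weight of every string in time polynomial in its length. -/
def EfficientlyComputable (p : WeightedLanguage) : Prop :=
  ∃ (M : TM) (T : Polynomial ℕ), ∀ x : List Bool,
    M.OutputsValue (word x) (p x) (T.eval x.length)

/-- The input of a local model: a prefix followed by a bit or by the end-of-string symbol. -/
def queryWord (u : List Bool) : Option Bool → List ℕ
  | some b => word (u ++ [b])
  | none => word u ++ [sepSym]

/-- `M` efficiently locally normalizes `p` with compact parameters `θ`: the parameters `θ n` have
polynomial length, `M` builds from them in polynomial time a machine `q`, and `q` runs in polynomial
time on all inputs made of a prefix `u` of length at most `n` and a next symbol, mapping them to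
the conditional probability of this symbol given `u`, whenever `u` has positive prefix weight.
As `q` outputs fractions, its output is prescribed only if this probability is rational. -/
def EfficientlyLocallyNormalizedBy (p : WeightedLanguage) (M : TM) (θ : ℕ → List Bool) : Prop :=
  p.Normalizable ∧
  ∃ P : Polynomial ℕ, ∀ n : ℕ,
    (θ n).length ≤ P.eval n ∧
    ∃ q : TM, M.Builds (θ n) q (P.eval n) ∧
      ∀ (u : List Bool) (s : Option Bool), u.length ≤ n →
        q.HaltsIn (queryWord u s) (P.eval n) ∧
        (0 < p.prefixWeight u → p.localProb u s ∈ Set.range ((↑) : ℚ → ℝ) →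
          q.OutputsValue (queryWord u s) (p.localProb u s) (P.eval n))

end WeightedLanguage

/-! ### Boolean formulas and the weighted language of satisfied formulas -/

/-- Boolean formulas; `var i` is the variable `A_{i+1}`. -/
inductive Formula : Type
  | var (i : ℕ)
  | neg (φ : Formula)
  | and (φ ψ : Formula)
  | or (φ ψ : Formula)

namespace Formula

/-- The variables mentioned in a formula. -/
def vars : Formula → Finset ℕ
  | var i => {i}
  | neg φ => φ.vars
  | and φ ψ => φ.vars ∪ ψ.vars
  | or φ ψ => φ.vars ∪ ψ.vars

/-- The truth value of a formula. -/
def eval (a : ℕ → Bool) : Formula → Bool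
  | var i => a i
  | neg φ => !(φ.eval a)
  | and φ ψ => φ.eval a && ψ.eval a
  | or φ ψ => φ.eval a || ψ.eval a

/-- The encoding of formulas: Polish notation, the index of a variable being written in unary. -/
def enc : Formula → List Bool
  | var i => [false, false] ++ unary i
  | neg φ => [false, true] ++ φ.enc
  | and φ ψ => [true, false] ++ (φ.enc ++ ψ.enc)
  | or φ ψ => [true, true] ++ (φ.enc ++ ψ.enc)

/-- The encoding is injective and prefix-free. -/
theorem enc_append_inj (φ ψ : Formula) (u v : List Bool) (h : φ.enc ++ u = ψ.enc ++ v) :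
    φ = ψ ∧ u = v := by
  induction φ generalizing ψ u v with
  | var i =>
    cases ψ <;> simp [enc] at h
    simpa using unary_append_inj h
  | neg φ ih =>
    cases ψ <;> simp [enc] at h
    simpa using ih _ _ _ h
  | and φ₁ φ₂ ih₁ ih₂ =>
    cases ψ <;> simp [enc] at h
    obtain ⟨rfl, h2⟩ := ih₁ _ _ _ h
    simpa using ih₂ _ _ _ h2
  | or φ₁ φ₂ ih₁ ih₂ =>
    cases ψ <;> simp [enc] at h
    obtain ⟨rfl, h2⟩ := ih₁ _ _ _ h
    simpa using ih₂ _ _ _ h2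

/-- `a` satisfies `φ`: the variables mentioned in `φ` are exactly `A_1, …, A_j`, the string `a` has
length `j`, and `φ` is true under the assignment `A_1 = a_1, …, A_j = a_j`. -/
def SatisfiedBy (φ : Formula) (a : List Bool) : Prop :=
  φ.vars = Finset.range a.length ∧ φ.eval (fun i => a.getD i false) = true

end Formula

/-- The strings `enc(φ) a` where `a` satisfies `φ`. -/
def satStrings : Language Bool :=
  {x | ∃ (φ : Formula) (a : List Bool), φ.SatisfiedBy a ∧ x = φ.enc ++ a}

open Classical in
/-- The weighted language that gives weight `(1/3)^(|x|+1)` to every string `x = enc(φ) a` where `a`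
satisfies `φ`, and weight `0` to all other strings. -/
noncomputable def satWeight : WeightedLanguage := fun x =>
  if x ∈ satStrings then (1 / 3 : ℝ≥0) ^ (x.length + 1) else 0

end SeqModel

/-! Normalizability holds because there are only `2 ^ n` strings of length `n`, each of weight at
most `(1/3) ^ (n + 1)`. For efficient computability, Polish notation is prefix-free, so a string
splits in at most one way into a formula and a remainder; a linear parse, an evaluation under the
remainder and, if this succeeds, the computation of `3 ^ (|x| + 1)` in binary take polynomial time.

The negative part rests on `prefixWeight_enc_append`. All assignments satisfying `φ` have the same
length, namely the number of variables of `φ`, so after the prefix `enc φ` the language is the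
uniform distribution on the satisfying assignments. The probability of the bit `0` after `enc φ` is
therefore a quotient of two counts. It is rational, and it is nonzero exactly when some satisfying
assignment has `A_1` false.

It is prescribed only if `φ` is satisfiable. Hence one asks about `A_1 ∨ ψ`, where `ψ` does not
constrain `A_1` (`Formula.query`). Setting `A_1` true satisfies it (`Formula.query_satisfiedBy`),
and the bit `0` has positive probability iff `ψ` is satisfiable (`Formula.satsFrom_query`). One
exact local probability thus decides satisfiability.

For a language in NP, the Cook–Levin tableau of the verifier provides `ψ`
(`Tableau.exists_accepting_iff`, `Tableau.expressible_accepting`). Its bulk depends only on the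
length `n` of the input; the input enters through literals placed in front. So a machine for the
length `n` writes the literals, then a hard-wired tail, runs the given local model on the result and
tests whether the fraction is zero (`SatProg.decider_outputs`). Its description has polynomial
length and serves as the advice (`mem_PPoly_of`), so NP would be contained in P/poly.

To have concrete machines, programs on several stacks are translated to tape programs, the stacks
being tracks of the tape (`Cmd.Run.toProg`), and these to instruction tables (`Prog.Run.steps`);
both the running time and the length of the resulting description are controlled. -/

namespace SeqModel

/-! ### Runs of machines and tables of instructions -/

/-- The machine `M` goes from `c` to `c'` in exactly `n` steps. -/
def TM.Steps (M : TM) (c : Turing.TM0.Cfg ℕ ℕ) (n : ℕ) (c' : Turing.TM0.Cfg ℕ ℕ) : Prop :=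
  (flip bind (Turing.TM0.step M.toMachine))^[n] (some c) = some c'

theorem TM.Steps.refl (M : TM) (c : Turing.TM0.Cfg ℕ ℕ) : M.Steps c 0 c := rfl

theorem TM.Steps.trans {M : TM} {c c' c'' : Turing.TM0.Cfg ℕ ℕ} {n n' : ℕ}
    (h : M.Steps c n c') (h' : M.Steps c' n' c'') : M.Steps c (n + n') c'' := by
  unfold TM.Steps at *
  rw [Nat.add_comm, Function.iterate_add_apply, h, h']

theorem TM.Steps.one {M : TM} {c c' : Turing.TM0.Cfg ℕ ℕ}
    (h : Turing.TM0.step M.toMachine c = some c') : M.Steps c 1 c' := by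
  simp [TM.Steps, flip, h]

theorem TM.Steps.succ_inv {M : TM} {c c' : Turing.TM0.Cfg ℕ ℕ} {n : ℕ} (h : M.Steps c (n + 1) c') :
    ∃ d, Turing.TM0.step M.toMachine c = some d ∧ M.Steps d n c' := by
  unfold TM.Steps at *
  rw [Function.iterate_succ_apply] at h
  cases e : Turing.TM0.step M.toMachine c with
  | none =>
    have : ∀ k, (flip bind (Turing.TM0.step M.toMachine))^[k] none = none := by
      intro k
      induction k with
      | zero => rfl
      | succ k ih => rw [Function.iterate_succ_apply]; exact ih
    simp [flip, e] at h
    exact absurd (h.symm.trans (this n)) (by simp)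
  | some d => exact ⟨d, rfl, by simpa [flip, e] using h⟩

theorem TM.outputs_iff {M : TM} {w v : List ℕ} {t : ℕ} :
    M.Outputs w v t ↔ ∃ n ≤ t, ∃ q, M.Steps (Turing.TM0.init w) n ⟨q, Turing.Tape.mk₁ v⟩ ∧
      M.toMachine q (Turing.Tape.mk₁ v).head = none := by
  constructor
  · rintro ⟨⟨q, T⟩, ⟨⟨⟨n, hn⟩, hle⟩⟩, hs, rfl⟩
    refine ⟨n, hle, q, hn, ?_⟩
    simpa [Turing.TM0.step] using hs
  · rintro ⟨n, hle, q, hn, hs⟩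
    refine ⟨⟨q, _⟩, ⟨⟨⟨n, hn⟩, hle⟩⟩, ?_, rfl⟩
    simp [Turing.TM0.step, hs]

theorem TM.Outputs.mono {M : TM} {w v : List ℕ} {t t' : ℕ} (h : M.Outputs w v t) (ht : t ≤ t') :
    M.Outputs w v t' := by
  rw [TM.outputs_iff] at *
  obtain ⟨n, hn, h⟩ := h
  exact ⟨n, hn.trans ht, h⟩

theorem TM.toMachine_append (A B : TM) (s a : ℕ) :
    (A ++ B : TM).toMachine s a = (A.toMachine s a).or (B.toMachine s a) := by
  simp [TM.toMachine, List.find?_append, Option.map_or]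

theorem TM.toMachine_eq_none {A : TM} {s a : ℕ} (h : ∀ r ∈ A, r.state ≠ s) :
    A.toMachine s a = none := by
  simp [TM.toMachine]
  intro r hr h1
  exact absurd h1 (h r hr)

/-- The instructions of a single state: reading `a < m`, go to state `(g a).1`, doing `(g a).2`. -/
def instrs (m s : ℕ) (g : ℕ → ℕ × Turing.TM0.Stmt ℕ) : TM :=
  (List.range m).map fun a => ⟨s, a, (g a).2, (g a).1⟩

theorem instrs_toMachine {m s a : ℕ} {g : ℕ → ℕ × Turing.TM0.Stmt ℕ} (ha : a < m) :
    (instrs m s g).toMachine s a = some (g a) := by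
  induction m with
  | zero => omega
  | succ m ih =>
    have e : instrs (m + 1) s g = instrs m s g ++ [⟨s, m, (g m).2, (g m).1⟩] := by
      simp [instrs, List.range_succ]
    rw [e, TM.toMachine_append]
    rcases Nat.lt_succ_iff_lt_or_eq.1 ha with h | rfl
    · rw [ih h]; rfl
    · have : (instrs a s g).toMachine s a = none := by
        simp only [TM.toMachine, instrs, Option.map_eq_none_iff, List.find?_eq_none, List.mem_map,
          List.mem_range]
        rintro r ⟨b, hb, rfl⟩
        simp; omega
      rw [this]
      simp [TM.toMachine]

theorem mem_instrs_state {m s : ℕ} {g : ℕ → ℕ × Turing.TM0.Stmt ℕ} {r : Quadruple}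
    (h : r ∈ instrs m s g) : r.state = s := by
  simp only [instrs, List.mem_map] at h
  obtain ⟨_, _, rfl⟩ := h
  rfl

/-- The instructions of the states `e, …, e + B - 1`, all acting alike. -/
def instrsFrom (m e B : ℕ) (g : ℕ → ℕ × Turing.TM0.Stmt ℕ) : TM :=
  (List.range B).flatMap fun s => instrs m (e + s) g

theorem mem_instrsFrom_state {m e B : ℕ} {g : ℕ → ℕ × Turing.TM0.Stmt ℕ} {r : Quadruple}
    (h : r ∈ instrsFrom m e B g) : e ≤ r.state ∧ r.state < e + B := by
  simp only [instrsFrom, List.mem_flatMap, List.mem_range] at h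
  obtain ⟨s, hs, hr⟩ := h
  rw [mem_instrs_state hr]
  omega

theorem instrsFrom_toMachine {m e B s a : ℕ} {g : ℕ → ℕ × Turing.TM0.Stmt ℕ} (hs : s < B)
    (ha : a < m) : (instrsFrom m e B g).toMachine (e + s) a = some (g a) := by
  induction B with
  | zero => omega
  | succ B ih =>
    have e1 : instrsFrom m e (B + 1) g = instrsFrom m e B g ++ instrs m (e + B) g := by
      simp [instrsFrom, List.range_succ]
    rw [e1, TM.toMachine_append]
    rcases Nat.lt_succ_iff_lt_or_eq.1 hs with h | rfl
    · rw [ih h]; rfl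
    · rw [TM.toMachine_eq_none, instrs_toMachine ha]; · rfl
      intro r hr
      have := mem_instrsFrom_state hr
      omega

/-- A number exceeding all states of a machine. -/
def TM.stateBound (q : TM) : ℕ := (q.map fun r => r.state + r.next).sum + 1

theorem TM.lt_stateBound {q : TM} {r : Quadruple} (h : r ∈ q) :
    r.state < q.stateBound ∧ r.next < q.stateBound := by
  have := List.single_le_sum (l := q.map fun r => r.state + r.next) (by simp) (r.state + r.next)
    (List.mem_map_of_mem h)
  unfold TM.stateBound
  omega

/-- The machine with all states shifted by `e`. -/
def TM.shift (e : ℕ) (q : TM) : TM :=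
  q.map fun r => ⟨e + r.state, r.read, r.act, e + r.next⟩

theorem TM.shift_toMachine (e : ℕ) (q : TM) (s a : ℕ) :
    (TM.shift e q).toMachine (e + s) a = (q.toMachine s a).map fun r => (e + r.1, r.2) := by
  induction q with
  | nil => rfl
  | cons r q ih =>
    have e1 : TM.shift e (r :: q) = [⟨e + r.state, r.read, r.act, e + r.next⟩] ++ TM.shift e q := rfl
    have e2 : (r :: q : TM) = [r] ++ q := rfl
    rw [e1, e2, TM.toMachine_append, TM.toMachine_append, ih]
    by_cases h : r.state = s ∧ r.read = a
    · obtain ⟨rfl, rfl⟩ := h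
      simp [TM.toMachine]
    · have : ∀ x, TM.toMachine [r] s a ≠ some x := by
        intro x; simp [TM.toMachine, h]
      have h1 : TM.toMachine [r] s a = none := by
        rcases h' : TM.toMachine [r] s a with _ | x
        · rfl
        · exact absurd h' (this x)
      rw [h1]
      have h2 : TM.toMachine [⟨e + r.state, r.read, r.act, e + r.next⟩] (e + s) a = none := by
        simp [TM.toMachine, h]
      rw [h2]; rfl

theorem TM.toMachine_mem {q : TM} {s a : ℕ} {x : ℕ × Turing.TM0.Stmt ℕ}
    (h : q.toMachine s a = some x) : ∃ r ∈ q, r.state = s ∧ r.read = a ∧ r.next = x.1 ∧ r.act = x.2 := by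
  simp only [TM.toMachine, Option.map_eq_some_iff] at h
  obtain ⟨r, hr, rfl⟩ := h
  have := List.find?_some hr
  simp at this
  exact ⟨r, List.mem_of_find?_eq_some hr, this.1, this.2, rfl, rfl⟩

/-! ### Structured tape programs -/

/-- Structured programs acting on a tape. -/
inductive Prog : Type
  /-- perform the action determined by the scanned symbol -/
  | act (g : ℕ → Turing.TM0.Stmt ℕ)
  | seq (p q : Prog)
  | ite (S : ℕ → Bool) (p q : Prog)
  | loop (S : ℕ → Bool) (p : Prog)
  /-- run a Turing machine until it halts -/
  | call (q : TM)

/-- A tape (indexed by the integers) together with a head position. -/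
abbrev HeadTape : Type := (ℤ → ℕ) × ℤ

/-- The effect of an elementary action. -/
def HeadTape.apply (c : HeadTape) : Turing.TM0.Stmt ℕ → HeadTape
  | .move .left => (c.1, c.2 - 1)
  | .move .right => (c.1, c.2 + 1)
  | .write a => (Function.update c.1 c.2 a, c.2)

/-- The scanned symbol. -/
def HeadTape.head (c : HeadTape) : ℕ := c.1 c.2

/-- `c` represents Mathlib's tape `T`. -/
def HeadTape.Rep (c : HeadTape) (T : Turing.Tape ℕ) : Prop := ∀ j, T.nth j = c.1 (c.2 + j)

theorem HeadTape.Rep.head {c : HeadTape} {T : Turing.Tape ℕ} (h : c.Rep T) : T.head = c.head := by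
  simpa [HeadTape.head] using h 0

theorem HeadTape.Rep.move {c : HeadTape} {T : Turing.Tape ℕ} (h : c.Rep T) (d : Turing.Dir) :
    (c.apply (.move d)).Rep (T.move d) := by
  intro j
  cases d
  · rw [Turing.Tape.move_left_nth, h]
    exact congrArg c.1 (show c.2 + (j - 1) = c.2 - 1 + j by ring)
  · rw [Turing.Tape.move_right_nth, h]
    exact congrArg c.1 (show c.2 + (j + 1) = c.2 + 1 + j by ring)

theorem HeadTape.Rep.write {c : HeadTape} {T : Turing.Tape ℕ} (h : c.Rep T) (a : ℕ) :
    (c.apply (.write a)).Rep (T.write a) := by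
  intro j
  rw [Turing.Tape.write_nth, h]
  by_cases hj : j = 0
  · simp [hj, HeadTape.apply]
  · simp [hj, HeadTape.apply, Function.update_of_ne]

/-- A tape is determined by its cells, although it is stored as quotients of lists modulo trailing
blanks. This turns a statement about cells into the exact equality of tapes that `TM.Outputs`
demands. -/
theorem HeadTape.Rep.unique {c : HeadTape} {T T' : Turing.Tape ℕ} (h : c.Rep T) (h' : c.Rep T') :
    T = T' := by
  have H : ∀ j, T.nth j = T'.nth j := fun j => (h j).trans (h' j).symm
  obtain ⟨a, L, R⟩ := T
  obtain ⟨a', L', R'⟩ := T'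
  have h0 : a = a' := H 0
  have hR : R = R' := Turing.ListBlank.ext fun i => H (i + 1 : ℕ)
  have hL : L = L' := Turing.ListBlank.ext fun i => H (-(i + 1 : ℕ))
  rw [h0, hR, hL]

/-- Big-step semantics of tape programs over the alphabet `{0, …, m - 1}`; the last argument bounds
the number of steps. -/
inductive Prog.Run (m : ℕ) : Prog → HeadTape → HeadTape → ℕ → Prop
  | act {g : ℕ → Turing.TM0.Stmt ℕ} {c : HeadTape} :
      c.head < m → Run m (.act g) c (c.apply (g c.head)) 1
  | seq {p q : Prog} {c d e : HeadTape} {t t' : ℕ} :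
      Run m p c d t → Run m q d e t' → Run m (.seq p q) c e (t + t')
  | ite_true {S : ℕ → Bool} {p q : Prog} {c d : HeadTape} {t : ℕ} :
      c.head < m → S c.head = true → Run m p c d t → Run m (.ite S p q) c d (t + 1)
  | ite_false {S : ℕ → Bool} {p q : Prog} {c d : HeadTape} {t : ℕ} :
      c.head < m → S c.head = false → Run m q c d t → Run m (.ite S p q) c d (t + 1)
  | loop_false {S : ℕ → Bool} {p : Prog} {c : HeadTape} :
      c.head < m → S c.head = false → Run m (.loop S p) c c 1
  | loop_true {S : ℕ → Bool} {p : Prog} {c d e : HeadTape} {t t' : ℕ} :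
      c.head < m → S c.head = true → Run m p c d t → Run m (.loop S p) d e t' →
      Run m (.loop S p) c e (t + t' + 1)
  -- The called machine may use any symbols on the way; only the symbol scanned when it halts has to
  -- be below `m`, so that an instruction for leaving the call exists. That instruction accounts for
  -- the additional step.
  | call {q : TM} {c d : HeadTape} {T T' : Turing.Tape ℕ} {n s : ℕ} :
      c.Rep T → d.Rep T' → q.Steps ⟨0, T⟩ n ⟨s, T'⟩ → q.toMachine s T'.head = none → d.head < m →
      Run m (.call q) c d (n + 1)
  | mono {p : Prog} {c d : HeadTape} {t t' : ℕ} : Run m p c d t → t ≤ t' → Run m p c d t'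

/-- The number of states used by the compiled program. -/
def Prog.size : Prog → ℕ
  | .act _ => 1
  | .seq p q => p.size + q.size
  | .ite _ p q => 1 + p.size + q.size
  | .loop _ p => 1 + p.size
  | .call q => q.stateBound

/-- Compilation: the entry state is `e`, the states `e, …, e + size - 1` are used, and the state on
termination is `x`. -/
def Prog.compile (m : ℕ) : Prog → ℕ → ℕ → TM
  | .act g, e, x => instrs m e fun a => (x, g a)
  | .seq p q, e, x => p.compile m e (e + p.size) ++ q.compile m (e + p.size) x
  | .ite S p q, e, x =>
      -- A machine has to act in every step; writing back the scanned symbol is the neutral action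
      -- for a pure change of state.
      instrs m e (fun a => (bif S a then e + 1 else e + 1 + p.size, .write a)) ++
        (p.compile m (e + 1) x ++ q.compile m (e + 1 + p.size) x)
  | .loop S p, e, x =>
      instrs m e (fun a => (bif S a then e + 1 else x, .write a)) ++ p.compile m (e + 1) e
  -- The first applicable quadruple is used, so the appended instructions take effect only where `q`
  -- has none, that is, where `q` would halt.
  | .call q, e, x => TM.shift e q ++ instrsFrom m e q.stateBound fun a => (x, .write a)

theorem Prog.mem_compile_state {m : ℕ} {p : Prog} {e x : ℕ} {r : Quadruple}
    (h : r ∈ p.compile m e x) : e ≤ r.state ∧ r.state < e + p.size := by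
  induction p generalizing e x with
  | act g => have := mem_instrs_state h; simp only [Prog.size]; omega
  | seq p q ihp ihq =>
    simp only [Prog.compile, List.mem_append] at h
    simp only [Prog.size]
    rcases h with h | h
    · have := ihp h; omega
    · have := ihq h; omega
  | ite S p q ihp ihq =>
    simp only [Prog.compile, List.mem_append] at h
    simp only [Prog.size]
    rcases h with h | h | h
    · have := mem_instrs_state h; omega
    · have := ihp h; omega
    · have := ihq h; omega
  | loop S p ihp =>
    simp only [Prog.compile, List.mem_append] at h
    simp only [Prog.size]
    rcases h with h | h
    · have := mem_instrs_state h; omega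
    · have := ihp h; omega
  | call q =>
    simp only [Prog.compile, List.mem_append] at h
    simp only [Prog.size]
    rcases h with h | h
    · simp only [TM.shift, List.mem_map] at h
      obtain ⟨r, hr, rfl⟩ := h
      have := TM.lt_stateBound hr
      simp; omega
    · exact mem_instrsFrom_state h

/-- The effect of an elementary action on Mathlib's tapes. -/
def tapeApply (T : Turing.Tape ℕ) : Turing.TM0.Stmt ℕ → Turing.Tape ℕ
  | .move d => T.move d
  | .write b => T.write b

theorem HeadTape.Rep.apply {c : HeadTape} {T : Turing.Tape ℕ} (h : c.Rep T)
    (a : Turing.TM0.Stmt ℕ) : (c.apply a).Rep (tapeApply T a) := by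
  cases a with
  | move d => exact h.move d
  | write a => exact h.write a

theorem TM.step_eq {M : TM} {s s' : ℕ} {T : Turing.Tape ℕ} {a : Turing.TM0.Stmt ℕ}
    (h : M.toMachine s T.head = some (s', a)) :
    Turing.TM0.step M.toMachine ⟨s, T⟩ = some ⟨s', tapeApply T a⟩ := by
  simp only [Turing.TM0.step, h]
  cases a <;> rfl

theorem TM.step_eq_some {M : TM} {s : ℕ} {T : Turing.Tape ℕ} {d : Turing.TM0.Cfg ℕ ℕ}
    (h : Turing.TM0.step M.toMachine ⟨s, T⟩ = some d) :
    ∃ a, M.toMachine s T.head = some (d.q, a) ∧ d.Tape = tapeApply T a := by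
  obtain ⟨⟨s', a⟩, h1, h2⟩ := Option.map_eq_some_iff.1 h
  subst h2
  exact ⟨a, h1, by cases a <;> rfl⟩

/-- `M` contains the instructions `A`, and no others for the states in `[e, e + k)`. -/
def TM.Implements (M A : TM) (e k : ℕ) : Prop :=
  ∀ s a, e ≤ s → s < e + k → M.toMachine s a = A.toMachine s a

theorem TM.Implements.left {M A B : TM} {e k k' : ℕ} (h : M.Implements (A ++ B) e k)
    (hk : k' ≤ k) (hB : ∀ r ∈ B, e + k' ≤ r.state) : M.Implements A e k' := by
  intro s a h1 h2
  rw [h s a h1 (by omega), TM.toMachine_append,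
    TM.toMachine_eq_none (A := B) fun r hr => by have := hB r hr; omega]
  simp

theorem TM.Implements.right {M A B : TM} {e k e' k' : ℕ} (h : M.Implements (A ++ B) e k)
    (h1 : e ≤ e') (h2 : e' + k' ≤ e + k) (hA : ∀ r ∈ A, r.state < e') : M.Implements B e' k' := by
  intro s a h3 h4
  rw [h s a (by omega) (by omega), TM.toMachine_append,
    TM.toMachine_eq_none (A := A) fun r hr => by have := hA r hr; omega]
  simp

theorem TM.Implements.steps_write {M : TM} {m e x a k : ℕ} {A : TM} {g : ℕ → ℕ}
    {T : Turing.Tape ℕ} (h : M.Implements (instrs m e (fun a => (g a, .write a)) ++ A) e k)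
    (hk : 0 < k) (hT : T.head = a) (ha : a < m) (hx : g a = x) : M.Steps ⟨e, T⟩ 1 ⟨x, T⟩ := by
  apply TM.Steps.one
  have := h e a le_rfl (by omega)
  rw [TM.toMachine_append, instrs_toMachine ha, Option.some_or] at this
  rw [← hT] at this
  rw [TM.step_eq this, hT, hx]
  congr 2
  rw [← hT]
  exact Turing.Tape.write_self T

/-- The shifted table comes first and thus takes precedence over `B`, and no step of `q` leads to a
state beyond its bound, so the simulation never leaves the block of states reserved for `q`. -/
theorem TM.Steps.of_shift {M q : TM} {e n s s' : ℕ} {T T' : Turing.Tape ℕ} {B : TM} {k : ℕ}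
    (h : M.Implements (TM.shift e q ++ B) e k) (hk : k = q.stateBound) (hs : s < k)
    (hq : q.Steps ⟨s, T⟩ n ⟨s', T'⟩) : s' < k ∧ M.Steps ⟨e + s, T⟩ n ⟨e + s', T'⟩ := by
  induction n generalizing s T with
  | zero =>
    simp [TM.Steps] at hq
    obtain ⟨rfl, rfl⟩ := hq
    exact ⟨hs, TM.Steps.refl _ _⟩
  | succ n ih =>
    obtain ⟨⟨s1, T1⟩, h1, h2⟩ := hq.succ_inv
    obtain ⟨a, h3, h4⟩ := TM.step_eq_some h1
    simp only at h3 h4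
    obtain ⟨r, hr, _, _, hr2, _⟩ := TM.toMachine_mem h3
    have hlt := (TM.lt_stateBound hr).2
    rw [hr2] at hlt
    have h5 := h (e + s) T.head (by omega) (by omega)
    rw [TM.toMachine_append, TM.shift_toMachine, h3] at h5
    have h6 : M.Steps ⟨e + s, T⟩ 1 ⟨e + s1, T1⟩ := by
      apply TM.Steps.one
      rw [TM.step_eq (by exact h5), h4]
    obtain ⟨h7, h8⟩ := ih (by rw [hk]; exact hlt) h2
    exact ⟨h7, by rw [Nat.add_comm n 1]; exact h6.trans h8⟩

/-- Correctness of compilation, by induction on the run. It is stated for every machine `M`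
containing the compiled block, so that the induction hypotheses for subprograms apply inside one and
the same machine; the body of a loop has the entry of the loop as its exit. -/
theorem Prog.Run.steps {m : ℕ} {p : Prog} {c d : HeadTape} {t : ℕ} (h : p.Run m c d t) :
    ∀ {M : TM} {e x : ℕ} {T : Turing.Tape ℕ}, M.Implements (p.compile m e x) e p.size → c.Rep T →
      ∃ T' n, d.Rep T' ∧ n ≤ t ∧ M.Steps ⟨e, T⟩ n ⟨x, T'⟩ := by
  induction h with
  | @act g c hc =>
    intro M e x T hM hT
    have h1 := hM e c.head le_rfl (by simp [Prog.size])
    rw [Prog.compile, instrs_toMachine hc, ← hT.head] at h1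
    have h2 := TM.Steps.one (TM.step_eq h1)
    rw [hT.head] at h2
    exact ⟨_, 1, hT.apply _, le_rfl, h2⟩
  | @seq p q c d c' t t' _ _ ih1 ih2 =>
    intro M e x T hM hT
    simp only [Prog.compile, Prog.size] at hM
    obtain ⟨T1, n1, h1, hn1, hs1⟩ := ih1 (hM.left (by omega)
      fun r hr => (Prog.mem_compile_state hr).1) hT
    obtain ⟨T2, n2, h2, hn2, hs2⟩ := ih2 (hM.right (by omega) (by omega)
      fun r hr => (Prog.mem_compile_state hr).2) h1
    exact ⟨T2, n1 + n2, h2, by omega, hs1.trans hs2⟩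
  | @ite_true S p q c d t hc hS _ ih =>
    intro M e x T hM hT
    simp only [Prog.compile, Prog.size] at hM
    have h0 := hM.steps_write (by omega) hT.head hc rfl
    simp only [hS, cond_true] at h0
    have hM1 := hM.right (e' := e + 1) (k' := p.size + q.size) (by omega) (by omega)
      fun r hr => by rw [mem_instrs_state hr]; omega
    obtain ⟨T1, n1, h1, hn1, hs1⟩ := ih (hM1.left (by omega)
      fun r hr => (Prog.mem_compile_state hr).1) hT
    exact ⟨T1, 1 + n1, h1, by omega, h0.trans hs1⟩
  | @ite_false S p q c d t hc hS _ ih =>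
    intro M e x T hM hT
    simp only [Prog.compile, Prog.size] at hM
    have h0 := hM.steps_write (by omega) hT.head hc rfl
    simp only [hS, cond_false] at h0
    have hM1 := hM.right (e' := e + 1) (k' := p.size + q.size) (by omega) (by omega)
      fun r hr => by rw [mem_instrs_state hr]; omega
    obtain ⟨T1, n1, h1, hn1, hs1⟩ := ih (hM1.right (by omega) (by omega)
      fun r hr => (Prog.mem_compile_state hr).2) hT
    exact ⟨T1, 1 + n1, h1, by omega, h0.trans hs1⟩
  | @loop_false S p c hc hS =>
    intro M e x T hM hT
    simp only [Prog.compile, Prog.size] at hM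
    have h0 := hM.steps_write (by omega) hT.head hc rfl
    simp only [hS, cond_false] at h0
    exact ⟨T, 1, hT, le_rfl, h0⟩
  | @loop_true S p c d c' t t' hc hS _ _ ih1 ih2 =>
    intro M e x T hM hT
    have hM' := hM
    simp only [Prog.compile, Prog.size] at hM
    have h0 := hM.steps_write (by omega) hT.head hc rfl
    simp only [hS, cond_true] at h0
    obtain ⟨T1, n1, h1, hn1, hs1⟩ := ih1 (hM.right (by omega) (by omega)
      fun r hr => by rw [mem_instrs_state hr]; omega) hT
    obtain ⟨T2, n2, h2, hn2, hs2⟩ := ih2 hM' h1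
    exact ⟨T2, 1 + n1 + n2, h2, by omega, (h0.trans hs1).trans hs2⟩
  | @call q c d T0 T' n s hT0 hT' hq hnone hd =>
    intro M e x T hM hT
    obtain rfl := hT.unique hT0
    simp only [Prog.compile, Prog.size] at hM
    obtain ⟨h1, h2⟩ := TM.Steps.of_shift hM rfl (by simp [TM.stateBound]) hq
    refine ⟨T', n + 1, hT', le_rfl, h2.trans (TM.Steps.one ?_)⟩
    have h3 := hM (e + s) T'.head (by omega) (by omega)
    rw [TM.toMachine_append, TM.shift_toMachine, hnone,
      instrsFrom_toMachine h1 (by rw [hT'.head]; exact hd)] at h3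
    rw [TM.step_eq (by exact h3), tapeApply, Turing.Tape.write_self]
  | mono _ hle ih =>
    intro M e x T hM hT
    obtain ⟨T1, n, h1, h2, h3⟩ := ih hM hT
    exact ⟨T1, n, h1, h2.trans hle, h3⟩

/-- The word `w` on an otherwise blank tape, head on the first symbol. -/
def wordTape (w : List ℕ) : HeadTape := (fun j => if 0 ≤ j then w.getD j.toNat 0 else 0, 0)

theorem wordTape_rep (w : List ℕ) : (wordTape w).Rep (Turing.Tape.mk₁ w) := by
  intro j
  rcases j with n | n
  · have : (Turing.Tape.mk₁ w).nth (n : ℕ) = w.getI n := by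
      rw [Turing.Tape.mk₁, Turing.Tape.mk₂, Turing.Tape.mk'_nth_nat, Turing.ListBlank.nth_mk]
    simp only [Int.ofNat_eq_natCast, wordTape, this]
    simp only [zero_add, Int.natCast_nonneg, if_true, Int.toNat_natCast]
    rfl
  · have : (Turing.Tape.mk₁ w).nth (Int.negSucc n) = 0 := by
      cases w <;> rfl
    rw [this]
    simp [wordTape]

/-- The machine obtained from a program. -/
def Prog.toTM (m : ℕ) (p : Prog) : TM := p.compile m 0 p.size

/-- The exit state `p.size` lies beyond all states of the compiled table, so the machine halts on
reaching it. -/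
theorem Prog.Run.outputs {m : ℕ} {p : Prog} {w v : List ℕ} {t : ℕ}
    (h : p.Run m (wordTape w) (wordTape v) t) : (p.toTM m).Outputs w v t := by
  obtain ⟨T', n, h1, h2, h3⟩ := h.steps (M := p.toTM m) (e := 0) (x := p.size)
    (fun _ _ _ _ => rfl) (wordTape_rep w)
  obtain rfl := h1.unique (wordTape_rep v)
  refine TM.outputs_iff.2 ⟨n, h2, p.size, h3, TM.toMachine_eq_none fun r hr => ?_⟩
  have := (Prog.mem_compile_state hr).2
  omega

/-! ### Stack programs -/

/-- Structured programs acting on `K` stacks over the alphabet `Fin s`. -/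
inductive Cmd (K s : ℕ) : Type
  | skip
  | push (k : Fin K) (a : Fin s)
  /-- remove the top symbol of a stack, if there is one, and branch on it -/
  | pop (k : Fin K) (f : Option (Fin s) → Cmd K s)
  | seq (c d : Cmd K s)
  /-- repeat as long as a stack is nonempty -/
  | loop (k : Fin K) (c : Cmd K s)

/-- The contents of the stacks, top first. -/
abbrev Stacks (K s : ℕ) : Type := Fin K → List (Fin s)

/-- Big-step semantics of stack programs; the last argument bounds the number of operations. -/
inductive Cmd.Run {K s : ℕ} : Cmd K s → Stacks K s → Stacks K s → ℕ → Prop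
  | skip {S : Stacks K s} : Run .skip S S 1
  | push {k : Fin K} {a : Fin s} {S : Stacks K s} :
      Run (.push k a) S (Function.update S k (a :: S k)) 1
  | pop_nil {k : Fin K} {f : Option (Fin s) → Cmd K s} {S S' : Stacks K s} {t : ℕ} :
      S k = [] → Run (f none) S S' t → Run (.pop k f) S S' (t + 1)
  | pop_cons {k : Fin K} {f : Option (Fin s) → Cmd K s} {S S' : Stacks K s} {t : ℕ} {a : Fin s}
      {l : List (Fin s)} : S k = a :: l → Run (f (some a)) (Function.update S k l) S' t →
      Run (.pop k f) S S' (t + 1)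
  | seq {c d : Cmd K s} {S S' S'' : Stacks K s} {t t' : ℕ} :
      Run c S S' t → Run d S' S'' t' → Run (.seq c d) S S'' (t + t')
  | loop_nil {k : Fin K} {c : Cmd K s} {S : Stacks K s} : S k = [] → Run (.loop k c) S S 1
  | loop_cons {k : Fin K} {c : Cmd K s} {S S' S'' : Stacks K s} {t t' : ℕ} :
      S k ≠ [] → Run c S S' t → Run (.loop k c) S' S'' t' → Run (.loop k c) S S'' (t + t' + 1)
  | mono {c : Cmd K s} {S S' : Stacks K s} {t t' : ℕ} : Run c S S' t → t ≤ t' → Run c S S' t'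

/-! ### Simulating stacks on tracks of the tape -/

section Tracks

variable {K s : ℕ}

/-- The tape symbol for a column of track digits. -/
def colSym (d : Fin K → Fin (s + 1)) : ℕ := finFunctionFinEquiv d

/-- The column of track digits of a tape symbol. -/
def symCol (K s : ℕ) (c : ℕ) : Fin K → Fin (s + 1) :=
  if h : c < (s + 1) ^ K then finFunctionFinEquiv.symm ⟨c, h⟩ else 0

theorem colSym_lt (d : Fin K → Fin (s + 1)) : colSym d < (s + 1) ^ K := (finFunctionFinEquiv d).2

theorem symCol_colSym (d : Fin K → Fin (s + 1)) : symCol K s (colSym d) = d := by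
  have h : (finFunctionFinEquiv d : ℕ) < (s + 1) ^ K := (finFunctionFinEquiv d).2
  rw [symCol, colSym, dif_pos h, Fin.eta, Equiv.symm_apply_apply]

theorem colSym_zero : colSym (0 : Fin K → Fin (s + 1)) = 0 := by
  simp [colSym]

theorem symCol_zero : symCol K s 0 = 0 := by
  have := symCol_colSym (0 : Fin K → Fin (s + 1))
  rwa [colSym_zero] at this

/-- The digit of a tape symbol on track `k`. -/
def track (s : ℕ) (k : Fin K) (c : ℕ) : ℕ := (symCol K s c k : ℕ)

/-- Change the digit on track `k` of a tape symbol. -/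
def setTrack (k : Fin K) (v : Fin (s + 1)) (c : ℕ) : ℕ :=
  colSym (Function.update (symCol K s c) k v)

/-- The digit of an optional stack symbol. -/
def digit : Option (Fin s) → Fin (s + 1)
  | none => 0
  | some a => a.succ

/-- The tape holding given stacks; the bottom of every stack is at position `0`. -/
def Stacks.tape (S : Stacks K s) : ℤ → ℕ := fun j =>
  if 0 ≤ j then colSym fun k => digit ((S k).reverse[j.toNat]?) else 0

theorem Stacks.tape_nat (S : Stacks K s) (n : ℕ) :
    S.tape n = colSym fun k => digit ((S k).reverse[n]?) := by
  simp [Stacks.tape]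

theorem Stacks.tape_neg (S : Stacks K s) : S.tape (-1) = 0 := by simp [Stacks.tape]

theorem Stacks.tape_lt (S : Stacks K s) (j : ℤ) : S.tape j < (s + 1) ^ K := by
  unfold Stacks.tape
  split_ifs
  · exact colSym_lt _
  · positivity

theorem Stacks.head_lt (S : Stacks K s) (j : ℤ) :
    HeadTape.head (S.tape, j) < (s + 1) ^ K := S.tape_lt j

theorem Stacks.track_tape (S : Stacks K s) (k : Fin K) (n : ℕ) :
    track s k (S.tape n) = digit ((S k).reverse[n]?) := by
  rw [Stacks.tape_nat, track, symCol_colSym]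

theorem Stacks.track_ne_zero {S : Stacks K s} {k : Fin K} {n : ℕ} :
    (track s k (S.tape n) != 0) = decide (n < (S k).length) := by
  rw [Stacks.track_tape]
  rcases Nat.lt_or_ge n (S k).length with h | h
  · rw [List.getElem?_eq_getElem (by simpa using h)]
    simp [h, digit]
  · rw [List.getElem?_eq_none (by simpa using h)]
    simp [h, digit]

/-- The digit `0` means that a stack does not reach a cell, so cells below the top of any stack are
nonblank. This is what allows the head to find its way back to position `0`. -/
theorem Stacks.tape_ne_zero {S : Stacks K s} {k : Fin K} {n : ℕ} (h : n < (S k).length) :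
    S.tape n ≠ 0 := by
  intro h0
  have := Stacks.track_ne_zero (S := S) (k := k) (n := n)
  rw [h0, decide_eq_true h] at this
  simp [track, symCol_zero] at this

theorem Stacks.tape_push (S : Stacks K s) (k : Fin K) (a : Fin s) :
    Stacks.tape (Function.update S k (a :: S k)) =
      Function.update S.tape ((S k).length : ℤ) (setTrack k a.succ (S.tape (S k).length)) := by
  funext j
  rcases lt_or_ge j 0 with hj | hj
  · rw [Function.update_of_ne (by omega)]
    simp [Stacks.tape, not_le.2 hj]
  lift j to ℕ using hj
  by_cases h : j = (S k).length
  · subst h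
    rw [Function.update_self, Stacks.tape_nat, setTrack, Stacks.tape_nat, symCol_colSym]
    congr 1
    funext k'
    by_cases hk : k' = k
    · subst hk; simp [digit]
    · simp [hk]
  · rw [Function.update_of_ne (by exact_mod_cast h), Stacks.tape_nat, Stacks.tape_nat]
    congr 1
    funext k'
    by_cases hk : k' = k
    · subst hk
      simp only [Function.update_self, List.reverse_cons]
      rcases Nat.lt_or_ge j (S k').length with h1 | h1
      · rw [List.getElem?_append_left (by simpa using h1)]
      · rw [List.getElem?_eq_none (by simp; omega), List.getElem?_eq_none (by simp; omega)]
    · simp [hk]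

theorem Stacks.tape_pop (S : Stacks K s) (k : Fin K) (a : Fin s) (l : List (Fin s))
    (h : S k = a :: l) :
    Stacks.tape (Function.update S k l) =
      Function.update S.tape (l.length : ℤ) (setTrack k (0 : Fin (s + 1)) (S.tape l.length)) := by
  funext j
  rcases lt_or_ge j 0 with hj | hj
  · rw [Function.update_of_ne (by omega)]
    simp [Stacks.tape, not_le.2 hj]
  lift j to ℕ using hj
  by_cases h' : j = l.length
  · subst h'
    rw [Function.update_self, Stacks.tape_nat, setTrack, Stacks.tape_nat, symCol_colSym]
    congr 1
    funext k'
    by_cases hk : k' = k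
    · subst hk; simp [digit]
    · simp [hk]
  · rw [Function.update_of_ne (by exact_mod_cast h'), Stacks.tape_nat, Stacks.tape_nat]
    congr 1
    funext k'
    by_cases hk : k' = k
    · subst hk
      simp only [Function.update_self, h, List.reverse_cons]
      rcases Nat.lt_or_ge j l.length with h1 | h1
      · rw [List.getElem?_append_left (by simpa using h1)]
      · rw [List.getElem?_eq_none (by simp; omega), List.getElem?_eq_none (by simp; omega)]
    · simp [hk]

/-- The stacks with a single nonempty stack `0`. -/
def Stacks.single (w : List (Fin s)) : Stacks (K + 1) s := fun k => if k = 0 then w else []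

/-- Track `0` is the least significant digit of a tape symbol. A tape on which only stack `0` is
nonempty is therefore an ordinary word, with symbols raised by one; the reversal is due to the
bottom of the stack being at position `0`. -/
theorem Stacks.tape_single (w : List (Fin s)) :
    ((Stacks.single w.reverse : Stacks (K + 1) s).tape, (0 : ℤ)) =
      wordTape (List.map (fun a : Fin s => (a : ℕ) + 1) w) := by
  unfold wordTape
  congr 1
  funext j
  unfold Stacks.tape
  split_ifs with hj
  · have : (fun k => digit ((Stacks.single w.reverse k : List (Fin s)).reverse[j.toNat]?)) =
        (Pi.single 0 (digit (w[j.toNat]?)) : Fin (K + 1) → Fin (s + 1)) := by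
      funext k
      by_cases hk : k = 0
      · subst hk; simp [Stacks.single]
      · simp [Stacks.single, hk, digit]
    rw [this, colSym, finFunctionFinEquiv_single]
    rcases h : w[j.toNat]? with _ | a <;> simp [List.getD, h, digit]
  · rfl

end Tracks

/-! ### Moving between the bottom and the top of a track -/

namespace Prog

variable {K s : ℕ}

/-- Do nothing. -/
def skip : Prog := .act .write

/-- Move right to the first empty cell of track `k`. -/
def walk (s : ℕ) (k : Fin K) : Prog :=
  .loop (fun c => track s k c != 0) (.act fun _ => .move .right)

/-- Return to position `0`. -/
def home : Prog :=
  .seq (.act fun _ => .move .left)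
    (.seq (.loop (fun c => c != 0) (.act fun _ => .move .left)) (.act fun _ => .move .right))

/-- Branch on a number determined by the scanned symbol. -/
def switch (key : ℕ → ℕ) (f : ℕ → Prog) : ℕ → Prog
  | 0 => f 0
  | n + 1 => .ite (fun c => key c == n + 1) (f (n + 1)) (switch key f n)

theorem run_skip {m : ℕ} {c : HeadTape} (h : c.head < m) : Run m skip c c 1 := by
  have := Run.act (g := .write) h
  rwa [show c.apply (.write c.head) = c by simp [HeadTape.apply, HeadTape.head]] at this

theorem run_switch {m : ℕ} {c d : HeadTape} {t n : ℕ} {key : ℕ → ℕ} {f : ℕ → Prog}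
    (h : c.head < m) (hk : key c.head ≤ n) (hf : Run m (f (key c.head)) c d t) :
    Run m (switch key f n) c d (t + n) := by
  induction n with
  | zero => rwa [Nat.le_zero.1 hk] at hf
  | succ n ih =>
    by_cases he : key c.head = n + 1
    · rw [he] at hf
      exact (Run.ite_true h (by simp [he]) hf).mono (by omega)
    · exact (Run.ite_false h (by simp [he]) (ih (by omega))).mono (by omega)

theorem run_walk (S : Stacks K s) (k : Fin K) :
    Run ((s + 1) ^ K) (walk s k) (S.tape, 0) (S.tape, (S k).length) (2 * (S k).length + 1) := by
  suffices H : ∀ i n : ℕ, i + n = (S k).length →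
      Run ((s + 1) ^ K) (walk s k) (S.tape, i) (S.tape, (S k).length) (2 * n + 1) by
    exact_mod_cast H 0 (S k).length (by omega)
  intro i n
  induction n generalizing i with
  | zero =>
    intro h
    rw [show (i : ℤ) = (S k).length by omega]
    refine Run.loop_false (S.head_lt _) ?_
    simp only [HeadTape.head, Stacks.track_ne_zero, lt_self_iff_false, decide_false]
  | succ n ih =>
    intro h
    refine (Run.loop_true (d := (S.tape, ((i + 1 : ℕ) : ℤ))) (S.head_lt _) ?_ ?_
      (ih (i + 1) (by omega))).mono (t := 1 + (2 * n + 1) + 1) (by omega)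
    · simp only [HeadTape.head, Stacks.track_ne_zero, decide_eq_true_eq]; omega
    · have := Run.act (m := (s + 1) ^ K) (g := fun _ => .move .right) (c := (S.tape, (i : ℤ)))
        (S.head_lt _)
      simpa [HeadTape.apply] using this

/-- The cell at `-1` is the first blank met to the left. The head moves once before testing, since
the cell where it starts may itself be blank. -/
theorem run_home (S : Stacks K s) (i : ℕ) (h : ∀ j < i, S.tape j ≠ 0) :
    Run ((s + 1) ^ K) home (S.tape, i) (S.tape, 0) (2 * i + 3) := by
  have move : ∀ (d : Turing.Dir) (j : ℤ), Run ((s + 1) ^ K) (.act fun _ => .move d) (S.tape, j)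
      (HeadTape.apply (S.tape, j) (.move d)) 1 := fun d j => Run.act (S.head_lt _)
  have H : Run ((s + 1) ^ K) (.loop (fun c => c != 0) (.act fun _ => .move .left))
      (S.tape, (i : ℤ) - 1) (S.tape, -1) (2 * i + 1) := by
    induction i with
    | zero =>
      refine Run.loop_false (S.head_lt _) ?_
      simp [HeadTape.head, Stacks.tape_neg]
    | succ i ih =>
      have e : ((i + 1 : ℕ) : ℤ) - 1 = i := by push_cast; ring
      rw [e]
      refine (Run.loop_true (S.head_lt _) ?_ (move .left i)
        (ih fun j hj => h j (by omega))).mono (by omega)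
      simpa [HeadTape.head] using h i (by omega)
  exact (Run.seq (move .left i) (Run.seq H (move .right (-1)))).mono (by omega)

end Prog

/-- Compilation of stack programs to tape programs. -/
def Cmd.toProg {K s : ℕ} : Cmd K s → Prog
  | .skip => .skip
  | .push k a => .seq (.walk s k) (.seq (.act fun c => .write (setTrack k a.succ c)) .home)
  | .pop k f =>
      .ite (fun c => track s k c != 0)
        (.seq (.walk s k) (.seq (.act fun _ => .move .left)
          (.switch (track s k) (fun v => .seq (.act fun c => .write (setTrack k (0 : Fin (s + 1)) c))
            -- The pop branch is entered only if the stack is nonempty, so the digit found lies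
            -- between `1` and `s`; the alternative is never run.
            (.seq .home (if h : 0 < v ∧ v ≤ s then (f (some ⟨v - 1, by omega⟩)).toProg else .skip)))
            s)))
        (f none).toProg
  | .seq c d => .seq c.toProg d.toProg
  | .loop k c => .loop (fun c => track s k c != 0) c.toProg

/-- An operation adds at most one symbol, so initial height plus number of operations bounds all
heights by `H` throughout. Each operation costs at most a walk to the top, a branching over `s`
digits and a walk home, which is linear in `H` and `s`. -/
theorem Cmd.Run.toProg {K s : ℕ} {c : Cmd K s} {S S' : Stacks K s} {t : ℕ} (h : c.Run S S' t) :
    (∀ k, (S' k).length ≤ (S k).length + t) ∧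
    ∀ H, (∀ k, (S k).length + t ≤ H) →
      c.toProg.Run ((s + 1) ^ K) (S.tape, 0) (S'.tape, 0) (t * (4 * H + s + 10)) := by
  induction h with
  | @skip S =>
    refine ⟨fun k => by omega, fun H _ => (Prog.run_skip (S.head_lt _)).mono (by omega)⟩
  | @push k a S =>
    refine ⟨fun k' => ?_, fun H hH => ?_⟩
    · by_cases hk : k' = k
      · subst hk; simp
      · simp [hk]
    · have h1 := Prog.Run.act (m := (s + 1) ^ K) (g := fun c => .write (setTrack k a.succ c))
        (c := (S.tape, ((S k).length : ℤ))) (S.head_lt _)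
      simp only [HeadTape.apply, HeadTape.head, ← Stacks.tape_push] at h1
      refine ((Prog.run_walk S k).seq (h1.seq (Prog.run_home _ _ fun j hj => ?_))).mono ?_
      · exact Stacks.tape_ne_zero (k := k) (by simp; omega)
      · have := hH k
        omega
  | @pop_nil k f S S' t hk _ ih =>
    refine ⟨fun k' => by have := ih.1 k'; omega, fun H hH => ?_⟩
    have h1 := ih.2 H fun k' => by have := hH k'; omega
    refine (Prog.Run.ite_false (S.head_lt _) ?_ h1).mono ?_
    · have := Stacks.track_ne_zero (S := S) (k := k) (n := 0)
      simpa [HeadTape.head, hk] using this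
    · rw [Nat.add_mul t 1]; omega
  | @pop_cons k f S S' t a l hk _ ih =>
    refine ⟨fun k' => ?_, fun H hH => ?_⟩
    · have := ih.1 k'
      by_cases hk' : k' = k
      · subst hk'; simp [hk] at *; omega
      · simp [hk'] at *; omega
    · have h1 := ih.2 H fun k' => by
        have := hH k'
        by_cases hk' : k' = k
        · subst hk'; simp [hk] at *; omega
        · simp [hk'] at *; omega
      have hl : (S k).length = l.length + 1 := by simp [hk]
      have htr : track s k (S.tape l.length) = (a : ℕ) + 1 := by
        rw [Stacks.track_tape, hk]
        simp [digit]
      have hw := Prog.run_walk S k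
      have hm : Prog.Run ((s + 1) ^ K) (.act fun _ => .move .left) (S.tape, ((S k).length : ℤ))
          (S.tape, (l.length : ℤ)) 1 := by
        have := Prog.Run.act (m := (s + 1) ^ K) (g := fun _ => .move .left)
          (c := (S.tape, ((S k).length : ℤ))) (S.head_lt _)
        simpa [HeadTape.apply, hl] using this
      have hwr := Prog.Run.act (m := (s + 1) ^ K)
        (g := fun c => .write (setTrack k (0 : Fin (s + 1)) c))
        (c := (S.tape, (l.length : ℤ))) (S.head_lt _)
      simp only [HeadTape.apply, HeadTape.head, ← Stacks.tape_pop S k a l hk] at hwr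
      have hh := Prog.run_home (Function.update S k l) l.length fun j hj =>
        Stacks.tape_ne_zero (k := k) (by simp; omega)
      refine (Prog.Run.ite_true (S.head_lt _) ?_ (hw.seq (hm.seq (Prog.run_switch
        (t := 1 + (2 * l.length + 3 + t * (4 * H + s + 10)))
        (S.head_lt _) (n := s) ?_ ?_)))).mono ?_
      · have := Stacks.track_ne_zero (S := S) (k := k) (n := 0)
        simpa [HeadTape.head, hk] using this
      · simp only [HeadTape.head, htr]; omega
      · simp only [HeadTape.head, htr]
        refine hwr.seq (hh.seq ?_)
        rw [dif_pos ⟨by omega, by omega⟩]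
        exact h1
      · have := hH k
        rw [Nat.add_mul t 1]
        omega
  | @seq c d S S' S'' t t' _ _ ih1 ih2 =>
    refine ⟨fun k => by have := ih1.1 k; have := ih2.1 k; omega, fun H hH => ?_⟩
    refine ((ih1.2 H fun k => ?_).seq (ih2.2 H fun k => ?_)).mono (by rw [Nat.add_mul])
    · have := hH k; omega
    · have := hH k; have := ih1.1 k; omega
  | @loop_nil k c S hk =>
    refine ⟨fun k => by omega, fun H _ => (Prog.Run.loop_false (S.head_lt _) ?_).mono (by omega)⟩
    have := Stacks.track_ne_zero (S := S) (k := k) (n := 0)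
    simpa [HeadTape.head, hk] using this
  | @loop_cons k c S S' S'' t t' hk _ _ ih1 ih2 =>
    refine ⟨fun k => by have := ih1.1 k; have := ih2.1 k; omega, fun H hH => ?_⟩
    refine (Prog.Run.loop_true (S.head_lt _) ?_ (ih1.2 H fun k => ?_) (ih2.2 H fun k => ?_)).mono ?_
    · have := Stacks.track_ne_zero (S := S) (k := k) (n := 0)
      have h1 := List.length_pos_iff.2 hk
      simpa [HeadTape.head, h1] using this
    · have := hH k; omega
    · have := hH k; have := ih1.1 k; omega
    · rw [Nat.add_mul, Nat.add_mul]; omega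
  | mono _ hle ih =>
    refine ⟨fun k => by have := ih.1 k; omega, fun H hH => ?_⟩
    exact (ih.2 H fun k => by have := hH k; omega).mono (Nat.mul_le_mul_right _ hle)

/-! ### Symbolic execution of stack programs -/

namespace Cmd

variable {K s : ℕ} {k : Fin K} {a : Fin s} {c d e : Cmd K s} {f : Option (Fin s) → Cmd K s}
  {S S' S'' : Stacks K s} {t t' : ℕ}

/-- The rule `mono` can end any derivation, so case analysis on a run does not invert the other
rules directly; here it is absorbed into the bounds. Loops are excluded, being treated by induction
instead. -/
theorem Run.inv (h : Run c S S' t) :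
    match c with
    | .skip => S' = S ∧ 1 ≤ t
    | .push k a => S' = Function.update S k (a :: S k) ∧ 1 ≤ t
    | .pop k f => ∃ t', t' + 1 ≤ t ∧ match S k with
      | [] => Run (f none) S S' t'
      | a :: l => Run (f (some a)) (Function.update S k l) S' t'
    | .seq c d => ∃ S1 t1 t2, t1 + t2 ≤ t ∧ Run c S S1 t1 ∧ Run d S1 S' t2
    | .loop _ _ => True := by
  induction h with
  | skip => exact ⟨rfl, le_rfl⟩
  | push => exact ⟨rfl, le_rfl⟩
  | @pop_nil k f S S' t hk h _ => exact ⟨t, le_rfl, by rw [hk]; exact h⟩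
  | @pop_cons k f S S' t a l hk h _ => exact ⟨t, le_rfl, by rw [hk]; exact h⟩
  | seq h1 h2 => exact ⟨_, _, _, le_rfl, h1, h2⟩
  | loop_nil => trivial
  | loop_cons => trivial
  | @mono c S S' t t' _ hle ih =>
    cases c with
    | skip => exact ⟨ih.1, ih.2.trans hle⟩
    | push => exact ⟨ih.1, ih.2.trans hle⟩
    | pop => obtain ⟨t1, h1, h2⟩ := ih; exact ⟨t1, h1.trans hle, h2⟩
    | seq => obtain ⟨S1, t1, t2, h1, h2⟩ := ih; exact ⟨S1, t1, t2, h1.trans hle, h2⟩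
    | loop => trivial

/-- Each of the following equivalences uses up one unit of the time budget, so that rewriting with
them executes loop-free code symbolically. -/
theorem run_skip : Run skip S S' (t + 1) ↔ S' = S :=
  ⟨fun h => h.inv.1, fun h => h ▸ Run.skip.mono (by omega)⟩

theorem run_push : Run (push k a) S S' (t + 1) ↔ S' = Function.update S k (a :: S k) :=
  ⟨fun h => h.inv.1, fun h => h ▸ Run.push.mono (by omega)⟩

theorem run_pop : Run (pop k f) S S' (t + 1) ↔ match S k with
    | [] => Run (f none) S S' t
    | a :: l => Run (f (some a)) (Function.update S k l) S' t := by
  constructor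
  · intro h
    obtain ⟨t', ht, h⟩ := h.inv
    rcases hk : S k with _ | ⟨a, l⟩ <;> rw [hk] at h <;> exact h.mono (by omega)
  · intro h
    rcases hk : S k with _ | ⟨a, l⟩ <;> rw [hk] at h
    · exact Run.pop_nil hk h
    · exact Run.pop_cons hk h

theorem run_skip_seq : Run (seq skip d) S S' (t + 1) ↔ Run d S S' t := by
  constructor
  · intro h
    obtain ⟨S1, t1, t2, h1, h2, h3⟩ := h.inv
    obtain ⟨rfl, h4⟩ := h2.inv
    exact h3.mono (by omega)
  · intro h
    exact (Run.skip.seq h).mono (by omega)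

theorem run_push_seq : Run (seq (push k a) d) S S' (t + 1) ↔
    Run d (Function.update S k (a :: S k)) S' t := by
  constructor
  · intro h
    obtain ⟨S1, t1, t2, h1, h2, h3⟩ := h.inv
    obtain ⟨rfl, h4⟩ := h2.inv
    exact h3.mono (by omega)
  · intro h
    exact (Run.push.seq h).mono (by omega)

theorem run_pop_seq : Run (seq (pop k f) d) S S' (t + 1) ↔ match S k with
    | [] => Run (seq (f none) d) S S' t
    | a :: l => Run (seq (f (some a)) d) (Function.update S k l) S' t := by
  constructor
  · intro h
    obtain ⟨S1, t1, t2, h1, h2, h3⟩ := h.inv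
    obtain ⟨t', ht, h⟩ := h2.inv
    rcases hk : S k with _ | ⟨a, l⟩ <;> rw [hk] at h <;> exact (h.seq h3).mono (by omega)
  · intro h
    rcases hk : S k with _ | ⟨a, l⟩ <;> rw [hk] at h <;>
      obtain ⟨S1, t1, t2, h1, h2, h3⟩ := h.inv
    · exact ((Run.pop_nil hk h2).seq h3).mono (by omega)
    · exact ((Run.pop_cons hk h2).seq h3).mono (by omega)

/-- Empty a stack. -/
def clear (k : Fin K) : Cmd K s := .loop k (.pop k fun _ => .skip)

theorem run_clear (k : Fin K) (S : Stacks K s) :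
    Run (clear k) S (Function.update S k []) (3 * (S k).length + 1) := by
  generalize h : S k = l
  induction l generalizing S with
  | nil => rw [← h, Function.update_eq_self]; exact (Run.loop_nil h).mono (by simp)
  | cons a l ih =>
    have := ih (Function.update S k l) (by simp)
    rw [Function.update_idem] at this
    exact (Run.loop_cons (by simp [h]) (Run.pop_cons h Run.skip) this).mono (by simp; omega)

/-- Transfer the contents of the stack `j` to the stack `k`, reversing their order. -/
def transfer (j k : Fin K) : Cmd K s :=
  .loop j (.pop j fun o => match o with
    | some a => .push k a
    | none => .skip)

theorem run_transfer {j k : Fin K} (hjk : j ≠ k) (S : Stacks K s) :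
    Run (transfer j k) S (Function.update (Function.update S k ((S j).reverse ++ S k)) j [])
      (3 * (S j).length + 1) := by
  generalize h : S j = l
  induction l generalizing S with
  | nil =>
    rw [show Function.update (Function.update S k (([] : List (Fin s)).reverse ++ S k)) j [] = S by
      rw [List.reverse_nil, List.nil_append, Function.update_eq_self, ← h,
        Function.update_eq_self]]
    exact (Run.loop_nil h).mono (by simp)
  | cons a l ih =>
    have := ih (Function.update (Function.update S j l) k (a :: S k)) (by simp [hjk])
    refine (Run.loop_cons (by simp [h]) (Run.pop_cons h (Run.push (k := k) (a := a))) ?_).mono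
      (t := 2 + (3 * l.length + 1) + 1) (by simp; omega)
    change Run (transfer j k) _ _ _
    convert this using 1 <;>
    · funext i
      by_cases h1 : i = j
      · subst h1; simp [hjk]
      · by_cases h2 : i = k
        · subst h2; simp [h1]
        · simp [h1, h2]

end Cmd

/-! ### States of the eight stacks used by all programs below -/

/-- Eight stacks over five symbols. -/
def stacks8 (a b c d e f g h : List (Fin 5)) : Stacks 8 5 := ![a, b, c, d, e, f, g, h]

section stacks8

variable (a b c d e f g h l : List (Fin 5))

theorem stacks8_0 : stacks8 a b c d e f g h 0 = a := rfl
theorem stacks8_1 : stacks8 a b c d e f g h 1 = b := rfl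
theorem stacks8_2 : stacks8 a b c d e f g h 2 = c := rfl
theorem stacks8_3 : stacks8 a b c d e f g h 3 = d := rfl
theorem stacks8_4 : stacks8 a b c d e f g h 4 = e := rfl
theorem stacks8_5 : stacks8 a b c d e f g h 5 = f := rfl
theorem stacks8_6 : stacks8 a b c d e f g h 6 = g := rfl
theorem stacks8_7 : stacks8 a b c d e f g h 7 = h := rfl

theorem stacks8_update0 : Function.update (stacks8 a b c d e f g h) 0 l =
    stacks8 l b c d e f g h := by funext i; fin_cases i <;> rfl
theorem stacks8_update1 : Function.update (stacks8 a b c d e f g h) 1 l =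
    stacks8 a l c d e f g h := by funext i; fin_cases i <;> rfl
theorem stacks8_update2 : Function.update (stacks8 a b c d e f g h) 2 l =
    stacks8 a b l d e f g h := by funext i; fin_cases i <;> rfl
theorem stacks8_update3 : Function.update (stacks8 a b c d e f g h) 3 l =
    stacks8 a b c l e f g h := by funext i; fin_cases i <;> rfl
theorem stacks8_update4 : Function.update (stacks8 a b c d e f g h) 4 l =
    stacks8 a b c d l f g h := by funext i; fin_cases i <;> rfl
theorem stacks8_update5 : Function.update (stacks8 a b c d e f g h) 5 l =
    stacks8 a b c d e l g h := by funext i; fin_cases i <;> rfl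
theorem stacks8_update6 : Function.update (stacks8 a b c d e f g h) 6 l =
    stacks8 a b c d e f l h := by funext i; fin_cases i <;> rfl
theorem stacks8_update7 : Function.update (stacks8 a b c d e f g h) 7 l =
    stacks8 a b c d e f g l := by funext i; fin_cases i <;> rfl

attribute [simp] stacks8_0 stacks8_1 stacks8_2 stacks8_3 stacks8_4 stacks8_5 stacks8_6 stacks8_7
  stacks8_update0 stacks8_update1 stacks8_update2 stacks8_update3 stacks8_update4 stacks8_update5
  stacks8_update6 stacks8_update7

theorem stacks8_single : (Stacks.single l : Stacks (7 + 1) 5) = stacks8 l [] [] [] [] [] [] [] := by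
  funext i; fin_cases i <;> rfl

end stacks8

attribute [simp] Cmd.run_skip Cmd.run_push Cmd.run_pop Cmd.run_skip_seq
  Cmd.run_push_seq Cmd.run_pop_seq

/-! ### The program computing `satWeight`

Stack 0 is for input and output, 1 holds the string under inspection, 2 a counter, 3 the tokens of
the formula, 4 is auxiliary, 5 holds the values of subformulas, 6 is nonempty after a failure, and
the height of 7 is the length of the input. -/

namespace SatProg

open Cmd

infixr:60 " ;; " => Cmd.seq

/-- The stack symbol of a bit. -/
def bsym (b : Bool) : Fin 5 := cond b 1 0

/-- Record a failure and stop parsing. -/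
def fail : Cmd 8 5 := push 6 0 ;; clear 2

/-- Read the unary index of a variable. -/
def unaryBody : Cmd 8 5 := pop 4 fun _ => pop 1 fun o => match o with
  | some 0 => push 3 0
  | some 1 => push 3 1 ;; push 4 0
  | _ => fail

/-- Read a token; the height of stack 2 is the number of formulas still to be read. -/
def parseBody : Cmd 8 5 := pop 2 fun _ => pop 1 fun o => match o with
  | some 0 => pop 1 fun o => match o with
    | some 0 => push 3 2 ;; push 4 0 ;; loop 4 unaryBody
    | some 1 => push 3 1 ;; push 2 0
    | _ => fail
  | some 1 => pop 1 fun o => match o with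
    | some 0 => push 3 3 ;; push 2 0 ;; push 2 0
    | some 1 => push 3 4 ;; push 2 0 ;; push 2 0
    | _ => fail
  | _ => fail

/-- The tokens of a formula, last token first. -/
def tokens : Formula → List (Fin 5)
  -- The symbol `1` is both a unary digit and the token of a negation; the enclosing symbols `0` and
  -- `2` of a variable keep the two apart.
  | .var i => 0 :: (List.replicate i 1 ++ [2])
  | .neg φ => tokens φ ++ [1]
  | .and φ ψ => tokens ψ ++ (tokens φ ++ [3])
  | .or φ ψ => tokens ψ ++ (tokens φ ++ [4])

/-- The tokens of several formulas, on top of `R`. -/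
def tokensOn : List Formula → List (Fin 5) → List (Fin 5)
  | [], R => R
  | φ :: φs, R => tokensOn φs (tokens φ ++ R)

theorem length_tokens (φ : Formula) : (tokens φ).length ≤ φ.enc.length := by
  induction φ <;> simp [tokens, Formula.enc, unary] at * <;> omega

theorem unary_split (x : List Bool) :
    (∃ i u, x = unary i ++ u) ∨ x = List.replicate x.length true := by
  induction x with
  | nil => right; rfl
  | cons b x ih =>
    cases b with
    | false => left; exact ⟨0, x, by simp [unary]⟩
    | true =>
      rcases ih with ⟨i, u, rfl⟩ | h
      · left; exact ⟨i + 1, u, by simp [unary, List.replicate_succ]⟩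
      · right; rw [h]; simp [List.replicate_succ]

variable {N C : List (Fin 5)}

theorem run_fail (X R E V F : List (Fin 5)) :
    Run fail (stacks8 [] X C R E V F N) (stacks8 [] X [] R E V (0 :: F) N)
      (3 * C.length + 2) := by
  have := run_clear 2 (stacks8 [] X C R E V (0 :: F) N)
  simp at this
  simpa [fail] using this

theorem run_unary (i : ℕ) (u : List Bool) (R : List (Fin 5)) :
    Run (loop 4 unaryBody) (stacks8 [] ((unary i ++ u).map bsym) C R [0] [] [] N)
      (stacks8 [] (u.map bsym) C (0 :: (List.replicate i 1 ++ R)) [] [] [] N) (5 * i + 5) := by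
  induction i generalizing R with
  | zero =>
    refine (Run.loop_cons (t := 3) (by simp) ?_ (Run.loop_nil (by simp))).mono (by omega)
    simp [unaryBody, unary, bsym]
  | succ i ih =>
    rw [show List.replicate (i + 1) 1 ++ R = List.replicate i 1 ++ 1 :: R by
      rw [List.replicate_succ', List.append_assoc]; rfl]
    refine (Run.loop_cons (t := 4) (by simp) ?_ (ih (1 :: R))).mono (by omega)
    simp [unaryBody, unary, bsym, List.replicate_succ]

theorem run_unary_fail (i : ℕ) (R : List (Fin 5)) :
    Run (loop 4 unaryBody) (stacks8 [] ((List.replicate i true).map bsym) C R [0] [] [] N)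
      (stacks8 [] [] [] (List.replicate i 1 ++ R) [] [] [0] N) (5 * i + 3 * C.length + 6) := by
  induction i generalizing R with
  | zero =>
    refine (Run.loop_cons (t := 3 * C.length + 4) (by simp) ?_ (Run.loop_nil (by simp))).mono
      (by omega)
    simpa [unaryBody] using run_fail (N := N) (C := C) [] R [] [] []
  | succ i ih =>
    rw [show List.replicate (i + 1) 1 ++ R = List.replicate i 1 ++ 1 :: R by
      rw [List.replicate_succ', List.append_assoc]; rfl]
    refine (Run.loop_cons (t := 4) (by simp) ?_ (ih (1 :: R))).mono (by omega)
    simp [unaryBody, bsym, List.replicate_succ]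

/-- The concatenation of the codes of several formulas. -/
def encs (φs : List Formula) : List Bool := φs.flatMap Formula.enc

theorem encs_nil : encs [] = [] := rfl

theorem encs_cons (φ : Formula) (φs : List Formula) : encs (φ :: φs) = φ.enc ++ encs φs := rfl

/-- The formulas can be read off the beginning of a string. -/
def Parses (c : ℕ) (x : List Bool) : Prop :=
  ∃ (φs : List Formula) (u : List Bool), φs.length = c ∧ x = encs φs ++ u

/-- The first two bits determine the outermost symbol of the first formula: a negation leaves the
number of formulas to be read unchanged, a binary connective raises it by one. In this form a
failure of the parser is propagated backwards. -/
theorem Parses.of_cons {c : ℕ} {x : List Bool} (h : Parses (c + 1) x) :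
    (∃ i u, x = [false, false] ++ unary i ++ u) ∨
    (∃ x', x = false :: true :: x' ∧ Parses (c + 1) x') ∨
    (∃ b x', x = true :: b :: x' ∧ Parses (c + 2) x') := by
  obtain ⟨_ | ⟨φ, φs⟩, u, hφ, rfl⟩ := h
  · simp at hφ
  simp only [List.length_cons, Nat.add_right_cancel_iff] at hφ
  cases φ with
  | var i => left; exact ⟨i, encs φs ++ u, by simp [encs_cons, Formula.enc]⟩
  | neg φ => right; left; exact ⟨_, rfl, φ :: φs, u, by simp [hφ],
      by simp [encs, List.flatMap]⟩
  | and φ ψ =>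
    right; right; exact ⟨_, _, rfl, φ :: ψ :: φs, u, by simp [hφ],
      by simp [encs, List.flatMap]⟩
  | or φ ψ =>
    right; right; exact ⟨_, _, rfl, φ :: ψ :: φs, u, by simp [hφ],
      by simp [encs, List.flatMap]⟩

/-- Polish notation needs no stack for parsing, only the number `c` of formulas still expected. The
induction is on the length of the string. In the case of failure the lengths of the remains are
bounded, since they have to be cleared. -/
theorem run_parse (n c : ℕ) (x : List Bool) (R : List (Fin 5)) (hn : x.length ≤ n) :
    (∃ (φs : List Formula) (u : List Bool), φs.length = c ∧ x = encs φs ++ u ∧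
      Run (loop 2 parseBody) (stacks8 [] (x.map bsym) (List.replicate c 0) R [] [] [] N)
        (stacks8 [] (u.map bsym) [] (tokensOn φs R) [] [] [] N) (20 * (x.length + c) + 1)) ∨
    (¬ Parses c x ∧ ∃ X' R' : List (Fin 5), X'.length ≤ x.length ∧
      R'.length ≤ R.length + x.length ∧
      Run (loop 2 parseBody) (stacks8 [] (x.map bsym) (List.replicate c 0) R [] [] [] N)
        (stacks8 [] X' [] R' [] [] [0] N) (20 * (x.length + c) + 1)) := by
  induction n using Nat.strong_induction_on generalizing c x R with
  | _ n ih =>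
  rcases c with _ | c
  · left
    exact ⟨[], x, rfl, by simp [encs_nil], (Run.loop_nil (by simp)).mono (by omega)⟩
  have hfail : ∀ (X : List (Fin 5)) (t : ℕ), t ≤ 20 * (x.length + (c + 1)) → X.length ≤ x.length →
      ¬ Parses (c + 1) x → Run parseBody
        (stacks8 [] (x.map bsym) (List.replicate (c + 1) 0) R [] [] [] N)
        (stacks8 [] X [] R [] [] [0] N) (t - 1) → 0 < t →
      (¬ Parses (c + 1) x ∧ ∃ X' R' : List (Fin 5), X'.length ≤ x.length ∧
      R'.length ≤ R.length + x.length ∧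
      Run (loop 2 parseBody) (stacks8 [] (x.map bsym) (List.replicate (c + 1) 0) R [] [] [] N)
        (stacks8 [] X' [] R' [] [] [0] N) (20 * (x.length + (c + 1)) + 1)) := fun X t ht hX hp hr h0 =>
    ⟨hp, X, R, hX, by omega, (Run.loop_cons (by simp) hr (Run.loop_nil (by simp))).mono
      (by omega)⟩
  have hf := fun X => run_fail (N := N) (C := List.replicate c 0) X R [] [] []
  simp only [List.length_replicate] at hf
  rcases x with _ | ⟨b, x⟩
  · refine Or.inr <| hfail [] (3 * c + 5) (by simp; omega) (by simp) ?_ ?_ (by omega)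
    · intro h; rcases h.of_cons with ⟨i, u, h⟩ | ⟨x, h, _⟩ | ⟨b, x, h, _⟩ <;> simp at h
    · simpa [parseBody, List.replicate_succ] using hf []
  rcases x with _ | ⟨b', x⟩
  · refine Or.inr <| hfail [] (3 * c + 6) (by simp; omega) (by simp) ?_ ?_ (by omega)
    · intro h; rcases h.of_cons with ⟨i, u, h⟩ | ⟨x, h, _⟩ | ⟨b, x, h, _⟩ <;> simp at h
    · cases b <;> simpa [parseBody, List.replicate_succ, bsym] using hf []
  simp only [List.length_cons] at hn
  cases b with
  | false =>
    cases b' with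
    | false =>
      rcases unary_split x with ⟨i, u, rfl⟩ | hx
      · have hr : Run parseBody (stacks8 [] ((false :: false :: (unary i ++ u)).map bsym)
            (List.replicate (c + 1) 0) R [] [] [] N)
            (stacks8 [] (u.map bsym) (List.replicate c 0) (tokens (.var i) ++ R) [] [] [] N)
            (5 * i + 5 + 2 + 3) := by
          have := run_unary (N := N) (C := List.replicate c 0) i u (2 :: R)
          simpa [parseBody, List.replicate_succ, bsym, tokens] using this
        have hl : (unary i ++ u).length = i + 1 + u.length := by simp [unary]; omega
        rw [hl] at hn
        rcases ih u.length (by omega) c u (tokens (.var i) ++ R) le_rfl with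
          ⟨φs, v, h1, h2, h3⟩ | ⟨h1, X', R', h2, h3, h4⟩
        · refine Or.inl ⟨.var i :: φs, v, by simp [h1], by simp [encs_cons, Formula.enc, h2], ?_⟩
          exact (Run.loop_cons (by simp) hr h3).mono (by simp only [List.length_cons, hl]; omega)
        · refine Or.inr ⟨?_, X', R', by simp only [List.length_cons, hl]; omega, ?_,
            (Run.loop_cons (by simp) hr h4).mono (by simp only [List.length_cons, hl]; omega)⟩
          · rintro ⟨_ | ⟨φ, φs⟩, v, h5, h6⟩
            · simp at h5
            · refine h1 ⟨φs, v, by simpa using h5, ?_⟩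
              -- Prefix-freeness: any other way of parsing starts with the same variable and so
              -- would parse `u`.
              have := Formula.enc_append_inj (.var i) φ u (encs φs ++ v)
                (by simpa [encs_cons, Formula.enc] using h6)
              exact this.2
          · have := length_tokens (.var i)
            simp [tokens] at h3
            simp only [List.length_cons, hl]; omega
      · generalize x.length = k at hx
        subst hx
        have hr : Run parseBody (stacks8 [] ((false :: false :: List.replicate k true).map bsym)
            (List.replicate (c + 1) 0) R [] [] [] N)
            (stacks8 [] [] [] (List.replicate k 1 ++ 2 :: R) [] [] [0] N)
            (5 * k + 3 * c + 6 + 2 + 3) := by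
          have := run_unary_fail (N := N) (C := List.replicate c 0) k (2 :: R)
          simpa [parseBody, List.replicate_succ, bsym] using this
        refine Or.inr ⟨?_, [], _, by simp, ?_, (Run.loop_cons (by simp) hr
          (Run.loop_nil (by simp))).mono (by simp; omega)⟩
        · intro h
          rcases h.of_cons with ⟨i, u, h⟩ | ⟨x, h, _⟩ | ⟨b, x, h, _⟩
          · have h1 : false ∈ List.replicate k true := by
              simp only [List.cons_append, List.nil_append, List.cons.injEq, true_and] at h
              rw [h]; simp [unary]
            simp at h1
          · simp at h
          · simp at h
        · simp; omega
    | true =>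
      have hr : Run parseBody (stacks8 [] ((false :: true :: x).map bsym)
          (List.replicate (c + 1) 0) R [] [] [] N)
          (stacks8 [] (x.map bsym) (List.replicate (c + 1) 0) (1 :: R) [] [] [] N) 6 := by
        simp [parseBody, List.replicate_succ, bsym]
      rcases ih x.length (by omega) (c + 1) x (1 :: R) le_rfl with
          ⟨φs, v, h1, h2, h3⟩ | ⟨h1, X', R', h2, h3, h4⟩
      · obtain _ | ⟨φ, φs⟩ := φs
        · simp at h1
        refine Or.inl ⟨.neg φ :: φs, v, by simpa using h1, by simp [encs_cons, Formula.enc, h2], ?_⟩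
        have h5 : tokensOn (.neg φ :: φs) R = tokensOn (φ :: φs) (1 :: R) := by
          simp [tokensOn, tokens]
        rw [h5]
        exact (Run.loop_cons (by simp) hr h3).mono (by simp only [List.length_cons]; omega)
      · refine Or.inr ⟨?_, X', R', by simp only [List.length_cons]; omega,
          by simp only [List.length_cons] at h3 ⊢; omega,
          (Run.loop_cons (by simp) hr h4).mono (by simp only [List.length_cons]; omega)⟩
        intro h
        rcases h.of_cons with ⟨i, u, h⟩ | ⟨x, h, h'⟩ | ⟨b, x, h, _⟩ <;> simp at h
        subst h; exact h1 h'
  | true =>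
    have hr : Run parseBody (stacks8 [] ((true :: b' :: x).map bsym)
        (List.replicate (c + 1) 0) R [] [] [] N)
        (stacks8 [] (x.map bsym) (List.replicate (c + 2) 0) (cond b' 4 3 :: R) [] [] [] N) 6 := by
      cases b' <;> simp [parseBody, List.replicate_succ, bsym]
    rcases ih x.length (by omega) (c + 2) x (cond b' 4 3 :: R) le_rfl with
        ⟨φs, v, h1, h2, h3⟩ | ⟨h1, X', R', h2, h3, h4⟩
    · obtain _ | ⟨φ, _ | ⟨ψ, φs⟩⟩ := φs
      · simp at h1
      · simp at h1
      refine Or.inl ⟨cond b' (.or φ ψ) (.and φ ψ) :: φs, v, by simpa using h1, ?_, ?_⟩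
      · cases b' <;> simp [encs_cons, Formula.enc, h2]
      have h5 : tokensOn (cond b' (.or φ ψ) (.and φ ψ) :: φs) R =
          tokensOn (φ :: ψ :: φs) (cond b' 4 3 :: R) := by
        cases b' <;> simp [tokensOn, tokens]
      rw [h5]
      exact (Run.loop_cons (by simp) hr h3).mono (by simp only [List.length_cons]; omega)
    · refine Or.inr ⟨?_, X', R', by simp only [List.length_cons]; omega,
        by simp only [List.length_cons] at h3 ⊢; omega,
        (Run.loop_cons (by simp) hr h4).mono (by simp only [List.length_cons]; omega)⟩
      intro h
      rcases h.of_cons with ⟨i, u, h⟩ | ⟨x, h, h'⟩ | ⟨b, x, h, h'⟩ <;> simp at h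
      obtain ⟨rfl, rfl⟩ := h
      exact h1 h'

end SatProg

/-! ### Evaluating a formula under an assignment -/

namespace SatProg

open Cmd

variable {N : List (Fin 5)}

/-- Mark the symbol of a bit as used. -/
def mark (b : Fin 5) : Fin 5 := if b = 1 ∨ b = 4 then 4 else 3

/-- The value of a marked or unmarked bit. -/
def value (b : Fin 5) : Fin 5 := if b = 1 ∨ b = 4 then 1 else 0

/-- Walk along the assignment as indicated by the unary index of a variable. -/
def walkBody : Cmd 8 5 := pop 2 fun _ => pop 3 fun o => match o with
  | some 1 => (pop 1 fun o => match o with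
    | some b => push 4 b
    | none => skip) ;; push 2 0
  | _ => skip

/-- Look up the value of a variable. -/
def lookup : Cmd 8 5 :=
  push 2 0 ;; loop 2 walkBody ;; (pop 1 fun o => match o with
    | some b => push 1 (mark b) ;; push 5 (value b)
    | none => push 6 0 ;; push 5 0) ;; transfer 4 1

/-- Process a token, from the last to the first one. -/
def evalBody : Cmd 8 5 := pop 3 fun o => match o with
  | some 0 => lookup
  | some 1 => pop 5 fun v => push 5 (if v = some 1 then 0 else 1)
  | some 3 => pop 5 fun v => pop 5 fun w => push 5 (if v = some 1 ∧ w = some 1 then 1 else 0)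
  | some 4 => pop 5 fun v => pop 5 fun w => push 5 (if v = some 1 ∨ w = some 1 then 1 else 0)
  | _ => skip

/-- The assignment `a` with the variables in `U` marked as used. -/
def marked (a : List Bool) (U : Finset ℕ) : List (Fin 5) :=
  a.mapIdx fun i b => if i ∈ U then cond b 4 3 else bsym b

theorem marked_empty (a : List Bool) : marked a ∅ = a.map bsym := by
  apply List.ext_getElem <;> simp [marked]

theorem length_marked (a : List Bool) (U : Finset ℕ) : (marked a U).length = a.length := by
  simp [marked]

/-- A list recording the occurrences of variables without a value. -/
def missing (n : ℕ) : Formula → List (Fin 5)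
  | .var i => if i < n then [] else [0]
  | .neg φ => missing n φ
  | .and φ ψ => missing n φ ++ missing n ψ
  | .or φ ψ => missing n φ ++ missing n ψ

theorem missing_eq_nil {n : ℕ} {φ : Formula} : missing n φ = [] ↔ φ.vars ⊆ Finset.range n := by
  induction φ with
  | var i => simp [missing, Formula.vars]
  | neg φ ih => simpa [missing, Formula.vars] using ih
  | and φ ψ ih1 ih2 => simp [missing, Formula.vars, ih1, ih2, Finset.union_subset_iff]
  | or φ ψ ih1 ih2 => simp [missing, Formula.vars, ih1, ih2, Finset.union_subset_iff]

theorem length_missing (n : ℕ) (φ : Formula) : (missing n φ).length ≤ φ.enc.length := by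
  induction φ with
  | var i => by_cases h : i < n <;> simp [missing, Formula.enc, unary, h]
  | neg φ ih => simp [missing, Formula.enc]; omega
  | and φ ψ ih1 ih2 => simp [missing, Formula.enc]; omega
  | or φ ψ ih1 ih2 => simp [missing, Formula.enc]; omega

/-- The unary index is consumed entirely even if the assignment is shorter; stack 1 is then left
empty, which is how `lookup` notices a variable without a value. -/
theorem run_walk (i : ℕ) (l R B V F : List (Fin 5)) :
    Run (loop 2 walkBody) (stacks8 [] l [0] (List.replicate i 1 ++ 2 :: R) B V F N)
      (stacks8 [] (l.drop i) [] R ((l.take i).reverse ++ B) V F N) (6 * i + 5) := by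
  induction i generalizing l B with
  | zero =>
    refine (Run.loop_cons (t := 3) (by simp) ?_ (Run.loop_nil (by simp))).mono (by omega)
    simp [walkBody]
  | succ i ih =>
    rcases l with _ | ⟨b, l⟩
    · have := ih [] B
      simp only [List.drop_nil, List.take_nil] at this ⊢
      refine (Run.loop_cons (t := 5) (by simp) ?_ this).mono (by omega)
      simp [walkBody, List.replicate_succ]
    · have := ih l (b :: B)
      simp only [List.take_succ_cons, List.drop_succ_cons, List.reverse_cons, List.append_assoc,
        List.singleton_append]
      refine (Run.loop_cons (t := 5) (by simp) ?_ this).mono (by omega)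
      simp [walkBody, List.replicate_succ]

/-- A variable beyond the assignment leaves a trace on stack 6 and counts as `false`, in agreement
with the default value of `getD`; so the value stack is correct in any case. -/
theorem run_lookup (i : ℕ) (a : List Bool) (U : Finset ℕ) (R V F : List (Fin 5)) :
    Run lookup (stacks8 [] (marked a U) [] (List.replicate i 1 ++ 2 :: R) [] V F N)
      (stacks8 [] (marked a (insert i U)) [] R [] (bsym (a.getD i false) :: V)
        (missing a.length (.var i) ++ F) N) (9 * i + 12) := by
  have h1 := run_walk (N := N) i (marked a U) R [] V F
  rw [List.append_nil] at h1
  rcases Nat.lt_or_ge i a.length with hi | hi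
  · have hi' : i < (marked a U).length := by rwa [length_marked]
    rw [List.drop_eq_getElem_cons hi'] at h1
    have h2 := run_transfer (j := 4) (k := 1) (by decide) (stacks8 [] (mark (marked a U)[i] ::
      (marked a U).drop (i + 1)) [] R ((marked a U).take i).reverse
        (value (marked a U)[i] :: V) F N)
    simp only [stacks8_4, stacks8_1, stacks8_update1, stacks8_update4, List.reverse_reverse]
      at h2
    have h3 : (marked a U).set i (mark (marked a U)[i]) = marked a (insert i U) := by
      apply List.ext_getElem
      · simp [marked]
      · intro j h4 h5
        rw [List.getElem_set]
        by_cases hj : i = j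
        · subst hj
          simp only [if_true, marked, List.getElem_mapIdx, Finset.mem_insert, true_or]
          by_cases hU : i ∈ U <;> cases a[i] <;> simp [mark, hU, bsym]
        · have hj' : j ≠ i := fun h => hj h.symm
          simp [marked, hj, hj']
    have h4 : value (marked a U)[i] = bsym (a.getD i false) := by
      simp only [marked, List.getElem_mapIdx, List.getD_eq_getElem _ _ hi]
      by_cases hU : i ∈ U <;> cases a[i] <;> simp [value, hU, bsym]
    have h5 : missing a.length (.var i) = [] := by simp [missing, hi]
    rw [List.set_eq_take_append_cons_drop, if_pos hi'] at h3
    rw [h3, h4] at h2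
    rw [h5, List.nil_append]
    refine (run_push_seq (t := 9 * i + 11)).2 ?_
    simp only [stacks8_2, stacks8_update2]
    refine (h1.seq (Run.seq (t := 3) ?_ h2)).mono ?_
    · refine (run_pop (t := 2)).2 ?_
      simp only [stacks8_1, stacks8_update1, run_push_seq, run_push, stacks8_5, stacks8_update5, h4]
    · simp; omega
  · have hi' : (marked a U).length ≤ i := by rwa [length_marked]
    rw [List.drop_eq_nil_of_le hi', List.take_of_length_le hi'] at h1
    have h2 := run_transfer (j := 4) (k := 1) (by decide) (stacks8 [] [] [] R
      (marked a U).reverse (0 :: V) (0 :: F) N)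
    simp only [stacks8_4, stacks8_1, stacks8_update1, stacks8_update4, List.reverse_reverse,
      List.append_nil] at h2
    have h3 : marked a (insert i U) = marked a U := by
      apply List.ext_getElem
      · simp [marked]
      · intro j h4 h5
        have : j < a.length := by rwa [length_marked] at h4
        have : j ≠ i := by omega
        simp [marked, this]
    have h4 : a.getD i false = false := List.getD_eq_default _ _ hi
    have h5 : missing a.length (.var i) = [0] := by simp [missing, hi]
    rw [h5, h3, h4]
    refine (run_push_seq (t := 9 * i + 11)).2 ?_
    simp only [stacks8_2, stacks8_update2]
    refine (h1.seq (Run.seq (t := 3) ?_ h2)).mono ?_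
    · simp
    · rw [length_marked] at hi'
      simp [length_marked]; omega

/-- Read from the last token, Polish notation is evaluated with a stack of values. The statement is
in continuation form: a run that goes on after the value of `φ` has been found is extended to the
left by the tokens of `φ`. Thus the single loop over all tokens is never cut into pieces. The tokens
of `ψ` are above those of `φ`, so `ψ` is evaluated first. -/
theorem run_eval (φ : Formula) (a : List Bool) (U : Finset ℕ) (R V F : List (Fin 5))
    {S' : Stacks 8 5} {t : ℕ}
    (h : Run (loop 3 evalBody) (stacks8 [] (marked a (φ.vars ∪ U)) [] R []
      (bsym (φ.eval fun i => a.getD i false) :: V) (missing a.length φ ++ F) N) S' t) :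
    Run (loop 3 evalBody) (stacks8 [] (marked a U) [] (tokens φ ++ R) [] V F N) S'
      (t + 9 * φ.enc.length) := by
  induction φ generalizing U R V F t with
  | var i =>
    have h1 := run_lookup (N := N) i a U R V F
    refine (Run.loop_cons (t := 9 * i + 13) (by simp [tokens]) ?_ h).mono ?_
    · simpa [evalBody, tokens, Formula.vars, Formula.eval, ← Finset.insert_eq,
        -List.getD_eq_getElem?_getD] using h1
    · simp [Formula.enc, unary]; omega
  | neg φ ih =>
    simp only [tokens, List.append_assoc, List.singleton_append]
    refine (ih U (1 :: R) V F (t := t + 4) ?_).mono (by simp [Formula.enc]; omega)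
    refine (Run.loop_cons (t := 3) (by simp) ?_ h).mono (by omega)
    cases hv : φ.eval fun i => a.getD i false <;>
      simp [evalBody, bsym, Formula.eval, Formula.vars, missing, hv, -List.getD_eq_getElem?_getD]
  | and φ ψ ih1 ih2 =>
    simp only [tokens, List.append_assoc, List.singleton_append]
    refine (ih2 U (tokens φ ++ 3 :: R) V F (t := t + 5 + 9 * φ.enc.length) ?_).mono
      (by simp [Formula.enc]; omega)
    refine ih1 _ (3 :: R) _ _ (t := t + 5) ?_
    refine (Run.loop_cons (t := 4) (by simp) ?_ h).mono (by omega)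
    cases hv : φ.eval fun i => a.getD i false <;> cases hw : ψ.eval fun i => a.getD i false <;>
      simp [evalBody, bsym, Formula.eval, Formula.vars, missing, hv, hw, Finset.union_assoc,
        -List.getD_eq_getElem?_getD]
  | or φ ψ ih1 ih2 =>
    simp only [tokens, List.append_assoc, List.singleton_append]
    refine (ih2 U (tokens φ ++ 4 :: R) V F (t := t + 5 + 9 * φ.enc.length) ?_).mono
      (by simp [Formula.enc]; omega)
    refine ih1 _ (4 :: R) _ _ (t := t + 5) ?_
    refine (Run.loop_cons (t := 4) (by simp) ?_ h).mono (by omega)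
    cases hv : φ.eval fun i => a.getD i false <;> cases hw : ψ.eval fun i => a.getD i false <;>
      simp [evalBody, bsym, Formula.eval, Formula.vars, missing, hv, hw, Finset.union_assoc,
        -List.getD_eq_getElem?_getD]

/-- Check that the formula is true and that all variables have been used. -/
def check : Cmd 8 5 :=
  (pop 5 fun o => if o = some 1 then skip else push 6 0) ;;
    loop 1 (pop 1 fun o => if o = some 0 ∨ o = some 1 then push 6 0 else skip)

theorem run_check_loop (l F : List (Fin 5)) :
    ∃ F' : List (Fin 5), F'.length ≤ F.length + l.length ∧
      (F' = [] ↔ F = [] ∧ ∀ b ∈ l, b ≠ 0 ∧ b ≠ 1) ∧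
      Run (loop 1 (pop 1 fun o => if o = some 0 ∨ o = some 1 then push 6 0 else skip))
        (stacks8 [] l [] [] [] [] F N) (stacks8 [] [] [] [] [] [] F' N) (3 * l.length + 1) := by
  induction l generalizing F with
  | nil => exact ⟨F, by simp, by simp, Run.loop_nil (by simp)⟩
  | cons b l ih =>
    by_cases hb : b = 0 ∨ b = 1
    · obtain ⟨F', h1, h2, h3⟩ := ih (0 :: F)
      refine ⟨F', by simp at h1 ⊢; omega, ?_, (Run.loop_cons (t := 2) (by simp) ?_ h3).mono
        (by simp; omega)⟩
      · rw [h2]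
        exact ⟨fun h => by simp at h, fun h => absurd (h.2 b (by simp)) (by tauto)⟩
      · simp [hb]
    · obtain ⟨F', h1, h2, h3⟩ := ih F
      refine ⟨F', by simp at h1 ⊢; omega, ?_, (Run.loop_cons (t := 2) (by simp) ?_ h3).mono
        (by simp; omega)⟩
      · rw [h2]; push Not at hb; simp [hb]
      · simp [hb]

theorem marked_all_used {a : List Bool} {U : Finset ℕ} :
    (∀ b ∈ marked a U, b ≠ 0 ∧ b ≠ 1) ↔ Finset.range a.length ⊆ U := by
  constructor
  · intro h i hi
    rw [Finset.mem_range] at hi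
    have := h ((marked a U)[i]'(by rwa [length_marked])) (List.getElem_mem _)
    by_contra hU
    simp only [marked, List.getElem_mapIdx, hU, if_false] at this
    cases hb : a[i] <;> simp [hb, bsym] at this
  · intro h b hb
    obtain ⟨i, hi, rfl⟩ := List.getElem_of_mem hb
    rw [length_marked] at hi
    have hU := h (Finset.mem_range.2 hi)
    simp only [marked, List.getElem_mapIdx, hU, if_true]
    cases a[i] <;> simp

/-- The failure stack stays empty iff three things hold: the value is true, no variable lies beyond
`a`, and every bit of `a` has been marked. The last two say that the variables are exactly the first
`a.length` ones. -/
theorem run_eval_check (φ : Formula) (a : List Bool) :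
    ∃ F' : List (Fin 5), F'.length ≤ φ.enc.length + 1 + a.length ∧
      (F' = [] ↔ φ.SatisfiedBy a) ∧
      Run (loop 3 evalBody ;; check) (stacks8 [] (a.map bsym) [] (tokens φ) [] [] [] N)
        (stacks8 [] [] [] [] [] [] F' N) (9 * φ.enc.length + 3 * a.length + 4) := by
  obtain ⟨v, hv⟩ : ∃ v, v = φ.eval fun i => a.getD i false := ⟨_, rfl⟩
  obtain ⟨F', h1, h2, h3⟩ := run_check_loop (N := N) (marked a φ.vars)
    (cond v [] [0] ++ missing a.length φ)
  refine ⟨F', ?_, ?_, ?_⟩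
  · have := length_missing a.length φ
    rw [length_marked] at h1
    cases v <;> simp at h1 <;> omega
  · rw [h2, marked_all_used, List.append_eq_nil_iff, missing_eq_nil, Formula.SatisfiedBy, ← hv]
    cases v
    · simp
    · simp only [cond_true, true_and, and_true]
      exact ⟨fun h => Finset.Subset.antisymm h.1 h.2, fun h => by simp [h]⟩
  · have h4 := run_eval (N := N) φ a ∅ [] [] []
      (Run.loop_nil (k := 3) (c := evalBody) (by simp))
    rw [marked_empty, List.append_nil, Finset.union_empty, List.append_nil] at h4
    rw [length_marked] at h3
    refine (h4.seq (Run.seq (t := 2) ?_ h3)).mono (by omega)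
    rw [← hv]
    cases v <;> simp [bsym]

end SatProg

/-- Unrolls one iteration while carrying along the code that follows the loop, as needed when the
final step uses what the loop leaves behind. -/
theorem Cmd.Run.loop_seq {K s : ℕ} {k : Fin K} {c d : Cmd K s} {S S' S'' : Stacks K s} {t t' : ℕ}
    (hk : S k ≠ []) (h : c.Run S S' t) (h' : (Cmd.seq (.loop k c) d).Run S' S'' t') :
    (Cmd.seq (.loop k c) d).Run S S'' (t + t' + 1) := by
  obtain ⟨S1, t1, t2, h1, h2, h3⟩ := h'.inv
  exact ((Cmd.Run.loop_cons hk h h2).seq h3).mono (by omega)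

/-! ### Powers of three in binary, and the output of the weight -/

namespace SatProg

open Cmd

variable {N : List (Fin 5)}

/-- The digits of `3 * n + c`, given those of `n`. -/
def mulAdd (c : ℕ) : List Bool → List Bool
  | [] => c.bits
  | b :: l => decide ((3 * b.toNat + c) % 2 = 1) :: mulAdd ((3 * b.toNat + c) / 2) l

/-- Schoolbook multiplication: for a carry `c ≤ 2` the next carry `(3 * b + c) / 2` is again at most
`2`. -/
theorem mulAdd_bits (n c : ℕ) (hc : c ≤ 2) : mulAdd c n.bits = (3 * n + c).bits := by
  induction n using Nat.binaryRec' generalizing c with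
  | zero => simp [mulAdd]
  | bit b n hn ih =>
    rw [Nat.bits_append_bit _ _ hn, mulAdd, ih _ (by cases b <;> simp <;> omega)]
    have e : 3 * Nat.bit b n + c =
        Nat.bit (decide ((3 * b.toNat + c) % 2 = 1)) (3 * n + (3 * b.toNat + c) / 2) := by
      rw [Nat.bit_val, Nat.bit_val]
      rcases Nat.mod_two_eq_zero_or_one (3 * b.toNat + c) with h | h <;> simp [h] <;> omega
    rw [e, Nat.bits_append_bit]
    -- `Nat.bits` has no leading zeros. The upper part could vanish only for `n = 0`, but then `b`
    -- is `true` and the carry is positive.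
    intro h
    have h0 : n = 0 := by omega
    have := hn h0
    subst this
    simp at h
    omega

/-- The number denoted by an optional symbol. -/
def num : Option (Fin 5) → ℕ
  | some a => a
  | none => 0

/-- A step of the multiplication by `3`, with the carry on stack 2. -/
def mulBody : Cmd 8 5 := pop 5 fun d => pop 2 fun c =>
  push 4 (if (3 * num d + num c) % 2 = 1 then 1 else 0) ;;
    push 2 (Fin.ofNat 5 ((3 * num d + num c) / 2))

/-- Multiply the number on stack 5 by `3`. -/
def mul : Cmd 8 5 :=
  push 2 0 ;; (loop 5 mulBody ;; pop 2 fun c => match c with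
    | some 1 => push 4 1
    | some 2 => push 4 0 ;; push 4 1
    | _ => skip) ;; transfer 4 5

theorem run_mul_loop (l : List Bool) (c : ℕ) (hc : c ≤ 2) (Q : List (Fin 5)) :
    Run (loop 5 mulBody ;; pop 2 fun c => match c with
      | some 1 => push 4 1
      | some 2 => push 4 0 ;; push 4 1
      | _ => skip)
      (stacks8 [] [] [Fin.ofNat 5 c] [] Q (l.map bsym) [] N)
      (stacks8 [] [] [] [] (((mulAdd c l).map bsym).reverse ++ Q) [] [] N) (5 * l.length + 5) := by
  induction l generalizing c Q with
  | nil =>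
    refine Run.mono (Run.seq (t' := 4) (Run.loop_nil
      (S := stacks8 [] [] [Fin.ofNat 5 c] [] Q [] [] N) (stacks8_5 ..)) ?_) (by simp)
    interval_cases c
    · simp [mulAdd]
    · simp [mulAdd, bsym]
      exact (run_push (t := 2)).2 (by simp)
    · have h2 : Nat.bits 2 = [false, true] := by simp [Nat.bits, Nat.binaryRec]
      simp [mulAdd, bsym, h2]
  | cons b l ih =>
    have hc' : (3 * b.toNat + c) / 2 ≤ 2 := by cases b <;> simp <;> omega
    have := ih _ hc' (bsym (decide ((3 * b.toNat + c) % 2 = 1)) :: Q)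
    simp only [mulAdd, List.map_cons, List.reverse_cons, List.append_assoc, List.singleton_append]
    refine Run.mono (Run.loop_seq (t := 4) (by simp) ?_ this) (by simp; omega)
    interval_cases c <;> cases b <;> simp [mulBody, bsym, num]

theorem run_mul (n : ℕ) :
    Run mul (stacks8 [] [] [] [] [] (n.bits.map bsym) [] N)
      (stacks8 [] [] [] [] [] ((3 * n).bits.map bsym) [] N)
      (5 * n.bits.length + 3 * (3 * n).bits.length + 7) := by
  have h1 := run_mul_loop (N := N) n.bits 0 (by omega) []
  rw [mulAdd_bits _ _ (by omega), add_zero, List.append_nil] at h1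
  have h2 := run_transfer (j := 4) (k := 5) (by decide)
    (stacks8 [] [] [] [] ((3 * n).bits.map bsym).reverse [] [] N)
  simp only [stacks8_4, stacks8_5, stacks8_update5, stacks8_update4, List.reverse_reverse,
    List.append_nil, List.length_reverse, List.length_map] at h2
  refine Run.mono ((run_push_seq (t := 5 * n.bits.length + 3 * (3 * n).bits.length + 6)).2 ?_) le_rfl
  simp only [stacks8_2, stacks8_update2]
  exact (h1.seq h2).mono (by omega)

theorem length_bits_le {n B : ℕ} (h : n < 2 ^ B) : n.bits.length ≤ B := by
  rw [Nat.size_eq_bits_len]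
  exact Nat.size_le.2 h

/-- The intermediate products do not exceed the final one, so `B` bounds the number of digits in
every multiplication. -/
theorem run_power (k n B : ℕ) (hB : 3 ^ k * n < 2 ^ B) :
    Run (loop 7 (pop 7 fun _ => mul)) (stacks8 [] [] [] [] [] (n.bits.map bsym) []
      (List.replicate k 0)) (stacks8 [] [] [] [] [] ((3 ^ k * n).bits.map bsym) [] [])
      (k * (8 * B + 9) + 1) := by
  induction k generalizing n with
  | zero => simpa using Run.loop_nil (k := 7) (c := pop 7 fun _ => mul) (by simp)
  | succ k ih =>
    have e : 3 ^ (k + 1) * n = 3 ^ k * (3 * n) := by ring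
    rw [e] at hB ⊢
    have h0 : 3 * n ≤ 3 ^ k * (3 * n) := Nat.le_mul_of_pos_left _ (by positivity)
    have h1 := length_bits_le (n := 3 * n) (B := B) (by omega)
    have h2 := length_bits_le (n := n) (B := B) (by omega)
    refine (Run.loop_cons (t := 8 * B + 8) (by simp) ?_ (ih _ hB)).mono (by ring_nf; omega)
    refine (run_pop (t := 8 * B + 7)).2 ?_
    simp only [stacks8_7, List.replicate_succ, stacks8_update7]
    exact (run_mul n).mono (by omega)

/-- Output the weight of a string of positive weight. -/
def accept : Cmd 8 5 :=
  push 5 1 ;; push 5 1 ;; loop 7 (pop 7 fun _ => mul) ;; push 0 1 ;; push 0 2 ;; transfer 5 0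

theorem run_accept (n : ℕ) :
    Run accept (stacks8 [] [] [] [] [] [] [] (List.replicate n 0))
      (Stacks.single (1 :: 2 :: (3 ^ (n + 1)).bits.map bsym).reverse)
      (n * (16 * n + 25) + 6 * n + 12) := by
  -- The computation starts from `3`, with digits `1, 1`, and multiplies once for each symbol of the
  -- input; `3 < 4` bounds the number of digits.
  have hB : 3 ^ n * 3 < 2 ^ (2 * n + 2) := by
    have : (3 : ℕ) ^ (n + 1) < 4 ^ (n + 1) := Nat.pow_lt_pow_left (by omega) (by omega)
    rw [show 2 * n + 2 = 2 * (n + 1) by ring, pow_mul]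
    rw [pow_succ] at this
    exact_mod_cast this
  have h1 := run_power n 3 _ hB
  rw [← pow_succ] at h1
  have hl := length_bits_le hB
  rw [← pow_succ] at hl
  have h3 : (3 : ℕ).bits.map bsym = [1, 1] := by
    simp [Nat.bits, Nat.binaryRec, bsym]
  rw [h3] at h1
  have h2 := run_transfer (j := 5) (k := 0) (by decide)
    (stacks8 [2, 1] [] [] [] [] ((3 ^ (n + 1)).bits.map bsym) [] [])
  simp only [stacks8_0, stacks8_5, stacks8_update0, stacks8_update5, List.length_map] at h2
  have h4 : Run (push 0 1 ;; push 0 2 ;; transfer 5 0)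
      (stacks8 [] [] [] [] [] ((3 ^ (n + 1)).bits.map bsym) [] [])
      (Stacks.single (1 :: 2 :: (3 ^ (n + 1)).bits.map bsym).reverse) (6 * n + 9) := by
    refine (run_push_seq (t := 6 * n + 8)).2 ((run_push_seq (t := 6 * n + 7)).2 ?_)
    simp only [stacks8_0, stacks8_update0]
    have e : (Stacks.single (1 :: 2 :: (3 ^ (n + 1)).bits.map bsym).reverse : Stacks (7 + 1) 5) =
        stacks8 (((3 ^ (n + 1)).bits.map bsym).reverse ++ [2, 1]) [] [] [] [] [] [] [] := by
      rw [stacks8_single]; simp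
    rw [e]
    exact h2.mono (by omega)
  refine Run.mono (t := n * (8 * (2 * n + 2) + 9) + 1 + (6 * n + 9) + 1 + 1)
    ((run_push_seq).2 ((run_push_seq).2 ?_)) (by ring_nf; omega)
  simp only [stacks8_5, stacks8_update5]
  exact h1.seq h4

/-- Output the weight `0`. -/
def reject : Cmd 8 5 := clear 1 ;; clear 3 ;; clear 6 ;; clear 7 ;; push 0 2 ;; push 0 1

/-- The output is the fraction `0 / 1`; as `Nat.bits 0` is empty, it begins with the separator. -/
theorem run_reject (X R F N : List (Fin 5)) :
    Run reject (stacks8 [] X [] R [] [] F N) (Stacks.single [2, 1].reverse)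
      (3 * (X.length + R.length + F.length + N.length) + 6) := by
  have h1 := run_clear 1 (stacks8 [] X [] R [] [] F N)
  have h2 := run_clear 3 (stacks8 [] [] [] R [] [] F N)
  have h3 := run_clear 6 (stacks8 [] [] [] [] [] [] F N)
  have h4 := run_clear 7 (stacks8 [] [] [] [] [] [] [] N)
  simp only [stacks8_1, stacks8_3, stacks8_6, stacks8_7, stacks8_update1, stacks8_update3,
    stacks8_update6, stacks8_update7] at h1 h2 h3 h4
  have h5 : Run (push 0 2 ;; push 0 1) (stacks8 [] [] [] [] [] [] [] [])
      (Stacks.single [2, 1].reverse) 2 := by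
    rw [show (Stacks.single [2, 1].reverse : Stacks (7 + 1) 5) =
      stacks8 [1, 2] [] [] [] [] [] [] [] by rw [stacks8_single]; rfl]
    simp
  exact (h1.seq (h2.seq (h3.seq (h4.seq h5)))).mono (by omega)

/-- Copy the input to stack 1 and count its length on stack 7. -/
def copyBody : Cmd 8 5 := pop 0 fun o => match o with
  | some a => push 1 a ;; push 7 0
  | none => skip

theorem run_copy (l X : List (Fin 5)) (n : ℕ) :
    Run (loop 0 copyBody) (stacks8 l X [] [] [] [] [] (List.replicate n 0))
      (stacks8 [] (l.reverse ++ X) [] [] [] [] [] (List.replicate (n + l.length) 0))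
      (4 * l.length + 1) := by
  induction l generalizing X n with
  | nil => exact Run.loop_nil (by simp)
  | cons a l ih =>
    have := ih (a :: X) (n + 1)
    simp only [List.reverse_cons, List.append_assoc, List.singleton_append]
    rw [show n + (a :: l).length = n + 1 + l.length by simp; omega]
    refine Run.mono (Run.loop_cons (t := 3) (by simp) ?_ this) (by simp; omega)
    simp [copyBody, List.replicate_succ]

/-- The program computing `satWeight`. -/
def main : Cmd 8 5 :=
  loop 0 copyBody ;; push 2 0 ;; loop 2 parseBody ;; pop 6 fun o =>
    if o = none then (loop 3 evalBody ;; check) ;; pop 6 fun o => if o = none then accept else reject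
    else reject

open Classical in
theorem run_main (x : List Bool) :
    Run main (Stacks.single (x.map bsym).reverse)
      (Stacks.single (if x ∈ satStrings then 1 :: 2 :: (3 ^ (x.length + 1)).bits.map bsym
        else [2, 1]).reverse) (100 * (x.length + 1) ^ 2) := by
  rw [stacks8_single (x.map bsym).reverse]
  have h1 := run_copy (x.map bsym).reverse [] 0
  simp only [List.reverse_reverse, List.append_nil, List.replicate_zero, zero_add,
    List.length_reverse, List.length_map] at h1
  suffices h : ∀ r, r = 80 * (x.length + 1) ^ 2 → Run (loop 2 parseBody ;; pop 6 fun o =>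
      if o = none then (loop 3 evalBody ;; check) ;; pop 6 fun o => if o = none then accept else reject
      else reject) (stacks8 [] (x.map bsym) [0] [] [] [] [] (List.replicate x.length 0))
      (Stacks.single (if x ∈ satStrings then 1 :: 2 :: (3 ^ (x.length + 1)).bits.map bsym
        else [2, 1]).reverse) r by
    refine Run.mono (Run.seq h1 ((run_push_seq (t := 80 * (x.length + 1) ^ 2)).2 ?_)) (by nlinarith)
    simpa using h _ rfl
  rintro r rfl
  rcases run_parse (N := List.replicate x.length 0) x.length 1 x [] le_rfl with
    ⟨φs, u, h2, h3, h4⟩ | ⟨h2, X', R', h3, h4, h5⟩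
  · obtain ⟨φ, rfl⟩ := List.length_eq_one_iff.1 h2
    rw [encs_cons, encs_nil, List.append_nil] at h3
    obtain ⟨F', h5, h6, h7⟩ := run_eval_check (N := List.replicate x.length 0) φ u
    -- By prefix-freeness the decomposition found by the parser is the only one.
    have h8 : x ∈ satStrings ↔ φ.SatisfiedBy u := by
      constructor
      · rintro ⟨ψ, a, h9, h10⟩
        obtain ⟨rfl, rfl⟩ := Formula.enc_append_inj φ ψ u a (by rw [← h3, h10])
        exact h9
      · intro h; exact ⟨φ, u, h, h3⟩
    have hl : x.length = φ.enc.length + u.length := by rw [h3]; simp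
    simp only [tokensOn, List.append_nil] at h4
    refine Run.mono (Run.seq h4 ((run_pop (t := 9 * φ.enc.length + 3 * u.length + 4 +
      (x.length * (16 * x.length + 25) + 6 * x.length + 12 + 1))).2 ?_)) ?_
    · simp only [stacks8_6, if_true]
      refine Run.seq h7 (run_pop.2 ?_)
      rcases F' with _ | ⟨b, F'⟩
      · simp only [stacks8_6, if_true, if_pos (h8.2 (h6.1 rfl))]
        exact run_accept _
      · have : x ∉ satStrings := fun h => absurd (h6.2 (h8.1 h)) (by simp)
        simp only [stacks8_6, stacks8_update6, if_neg this, reduceCtorEq, if_false]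
        refine (run_reject _ _ _ _).mono ?_
        simp at h5 ⊢
        nlinarith
    · nlinarith
  · have : x ∉ satStrings := by
      rintro ⟨φ, a, -, h⟩
      exact h2 ⟨[φ], a, rfl, by simpa [encs_cons, encs_nil] using h⟩
    refine Run.mono (Run.seq h5 ((run_pop (t := 9 * x.length + 9)).2 ?_)) (by nlinarith)
    simp only [stacks8_6, stacks8_update6, if_neg this, reduceCtorEq, if_false]
    refine (run_reject _ _ _ _).mono ?_
    simp at h4 ⊢
    omega

theorem bitSym_eq (b : Bool) : bitSym b = (bsym b : ℕ) + 1 := by cases b <;> rfl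

theorem word_eq (x : List Bool) : word x = (x.map bsym).map fun a : Fin 5 => (a : ℕ) + 1 := by
  simp [word, bitSym_eq]

end SatProg

open Classical in
theorem satWeight_efficientlyComputable : satWeight.EfficientlyComputable := by
  let p : Polynomial ℕ := 100 * (.X + 1) ^ 2
  -- Eight tracks with six digits each require `6 ^ 8` tape symbols; the polynomial is that of
  -- `Cmd.Run.toProg` with `H` the input length plus `p`.
  refine ⟨SatProg.main.toProg.toTM (6 ^ 8), p * (4 * (.X + p) + 15), fun x => ?_⟩
  have h1 := (SatProg.run_main x).toProg.2 (x.length + 100 * (x.length + 1) ^ 2) fun k => by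
    by_cases hk : k = 0 <;> simp [Stacks.single, hk]
  have h2 := Stacks.tape_single (K := 7) (x.map SatProg.bsym)
  have h3 := Stacks.tape_single (K := 7) (if x ∈ satStrings then
    1 :: 2 :: (3 ^ (x.length + 1)).bits.map SatProg.bsym else [2, 1])
  rw [← SatProg.word_eq] at h2
  have h4 : ∀ w, w = List.map (fun a : Fin 5 => (a : ℕ) + 1) (if x ∈ satStrings then
      1 :: 2 :: (3 ^ (x.length + 1)).bits.map SatProg.bsym else [2, 1]) →
      (SatProg.main.toProg.toTM (6 ^ 8)).Outputs (word x) w _ :=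
    fun w hw => Prog.Run.outputs (by rw [← h2, hw, ← h3]; exact h1)
  have e : (p * (4 * (.X + p) + 15)).eval x.length = 100 * (x.length + 1) ^ 2 *
      (4 * (x.length + 100 * (x.length + 1) ^ 2) + 5 + 10) := by
    simp [p]
  rw [e]
  by_cases hx : x ∈ satStrings
  · refine ⟨1, 3 ^ (x.length + 1), by positivity, by simp [satWeight, hx], h4 _ ?_⟩
    simp only [hx, if_true, fracWord, List.map_cons, SatProg.word_eq]
    simp [SatProg.bsym, sepSym]
  · refine ⟨0, 1, by simp, by simp [satWeight, hx], h4 _ ?_⟩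
    simp [hx, fracWord, word, bitSym, sepSym]

/-! ### The weights of prefixes -/

/-- Grouped by length, the strings contribute the geometric series `(1/3) * (2/3) ^ n`. -/
theorem tsum_third_pow_lt_top : ∑' x : List Bool, ((1 / 3 : ℝ≥0∞) ^ (x.length + 1)) < ∞ := by
  rw [← (Equiv.sigmaFiberEquiv (List.length (α := Bool))).tsum_eq, ENNReal.tsum_sigma']
  have h : ∀ n : ℕ, ∑' x : {x : List Bool // x.length = n},
      (1 / 3 : ℝ≥0∞) ^ ((Equiv.sigmaFiberEquiv (List.length (α := Bool)) ⟨n, x⟩).length + 1) =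
      (1 / 3) * (2 / 3) ^ n := by
    intro n
    have h1 : ∀ x : {x : List Bool // x.length = n},
        (Equiv.sigmaFiberEquiv (List.length (α := Bool)) ⟨n, x⟩).length = n := fun x => x.2
    simp only [h1]
    let _ : Fintype {x : List Bool // x.length = n} := inferInstanceAs (Fintype (List.Vector Bool n))
    have : Fintype.card {x : List Bool // x.length = n} = 2 ^ n :=
      (card_vector (α := Bool) n).trans (by rw [Fintype.card_bool])
    rw [tsum_fintype, Finset.sum_const, Finset.card_univ, this, nsmul_eq_mul, pow_succ,
      div_eq_mul_inv 2, mul_pow, div_eq_mul_inv 1, one_mul]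
    push_cast
    ring
  simp only [h]
  rw [ENNReal.tsum_mul_left, ENNReal.tsum_geometric]
  apply ENNReal.mul_lt_top
  · exact ENNReal.div_lt_top (by simp) (by simp)
  · rw [ENNReal.inv_lt_top, tsub_pos_iff_lt]
    rw [ENNReal.div_lt_iff (by simp) (by simp)]
    norm_num

theorem satWeight_of_mem {x : List Bool} (h : x ∈ satStrings) :
    satWeight x = (1 / 3 : ℝ≥0) ^ (x.length + 1) := by
  simp [satWeight, h]

theorem satWeight_of_notMem {x : List Bool} (h : x ∉ satStrings) : satWeight x = 0 := by
  simp [satWeight, h]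

theorem satWeight_normalizable : satWeight.Normalizable := by
  constructor
  · have h : Formula.enc (.var 0) ++ [true] ∈ satStrings :=
      ⟨.var 0, [true], ⟨by simp [Formula.vars], by simp [Formula.eval]⟩, rfl⟩
    refine lt_of_lt_of_le ?_ (ENNReal.le_tsum (Formula.enc (.var 0) ++ [true]))
    rw [satWeight_of_mem h]
    positivity
  · refine lt_of_le_of_lt (ENNReal.tsum_le_tsum fun x => ?_) tsum_third_pow_lt_top
    by_cases h : x ∈ satStrings
    · rw [satWeight_of_mem h, ENNReal.coe_pow, ENNReal.coe_div (by simp), ENNReal.coe_one,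
        ENNReal.coe_ofNat]
    · rw [satWeight_of_notMem h]; simp

/-! ### Conditional probabilities as quotients of counts -/

/-- The satisfying assignments that begin with `v`. -/
def Formula.satsFrom (φ : Formula) (v : List Bool) : Set (List Bool) :=
  {a | φ.SatisfiedBy a ∧ v <+: a}

theorem Formula.SatisfiedBy.length_eq {φ : Formula} {a : List Bool} (h : φ.SatisfiedBy a) :
    a.length = φ.vars.card := by
  rw [h.1, Finset.card_range]

theorem Formula.finite_satsFrom (φ : Formula) (v : List Bool) : (φ.satsFrom v).Finite :=
  (List.finite_length_eq Bool φ.vars.card).subset fun _ h => h.1.length_eq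

/-- By prefix-freeness, the strings of positive weight extending `enc φ ++ v` are the `enc φ ++ a`
with `a` a satisfying assignment extending `v`. They all have the same length, hence the same
weight, which later cancels in the quotient. -/
theorem prefixWeight_enc_append (φ : Formula) (v : List Bool) :
    satWeight.prefixWeight (φ.enc ++ v) =
      (φ.satsFrom v).ncard * ((1 / 3 : ℝ≥0) ^ (φ.enc.length + φ.vars.card + 1) : ℝ≥0) := by
  let f : φ.satsFrom v → {x : List Bool // φ.enc ++ v <+: x} := fun a =>
    ⟨φ.enc ++ a.1, (List.prefix_append_right_inj _).2 a.2.2⟩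
  have hf : Function.Injective f := fun a b h => by
    have := congrArg Subtype.val h
    exact Subtype.ext (List.append_cancel_left this)
  have hs : Function.support (fun x : {x : List Bool // φ.enc ++ v <+: x} =>
      (satWeight x.1 : ℝ≥0∞)) ⊆ Set.range f := by
    rintro ⟨x, w, rfl⟩ hx
    have hx' : φ.enc ++ v ++ w ∈ satStrings := by
      by_contra h
      exact hx (show ((satWeight (φ.enc ++ v ++ w) : ℝ≥0) : ℝ≥0∞) = 0 by
        rw [satWeight_of_notMem h]; rfl)
    obtain ⟨ψ, a, h1, h2⟩ := hx'
    rw [List.append_assoc] at h2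
    obtain ⟨rfl, rfl⟩ := Formula.enc_append_inj _ _ _ _ h2
    exact ⟨⟨v ++ w, h1, List.prefix_append _ _⟩, Subtype.ext (by simp [f])⟩
  have hfin := (φ.finite_satsFrom v).to_subtype
  have := Fintype.ofFinite (φ.satsFrom v)
  rw [WeightedLanguage.prefixWeight, ← hf.tsum_eq hs]
  have h : ∀ a : φ.satsFrom v, (satWeight (f a).1 : ℝ≥0∞) =
      ((1 / 3 : ℝ≥0) ^ (φ.enc.length + φ.vars.card + 1) : ℝ≥0) := fun a => by
    rw [satWeight_of_mem ⟨φ, a.1, a.2.1, rfl⟩]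
    simp [a.2.1.length_eq]
  simp only [h]
  rw [tsum_fintype, Finset.sum_const, Finset.card_univ, nsmul_eq_mul, Set.ncard_eq_toFinset_card',
    Set.toFinset_card]

theorem localProb_enc (φ : Formula) (b : Bool) :
    satWeight.localProb φ.enc (some b) = (φ.satsFrom [b]).ncard / (φ.satsFrom []).ncard := by
  have h1 := prefixWeight_enc_append φ [b]
  have h2 := prefixWeight_enc_append φ []
  rw [List.append_nil] at h2
  simp only [WeightedLanguage.localProb, h1, h2]
  rw [ENNReal.mul_div_mul_right _ _ (by simp) (by simp)]
  simp

/-- The conditional probabilities after a satisfiable formula are rational; they tell whether the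
assignments beginning with a given bit are all unsatisfying. -/
theorem localProb_enc_spec {φ : Formula} {a : List Bool} (h : φ.SatisfiedBy a) (b : Bool) :
    0 < satWeight.prefixWeight φ.enc ∧
    satWeight.localProb φ.enc (some b) ∈ Set.range ((↑) : ℚ → ℝ) ∧
    (satWeight.localProb φ.enc (some b) = 0 ↔ φ.satsFrom [b] = ∅) := by
  have hne : (φ.satsFrom []).ncard ≠ 0 := by
    rw [Ne, Set.ncard_eq_zero (φ.finite_satsFrom _)]
    exact Set.Nonempty.ne_empty ⟨a, h, List.nil_prefix⟩
  refine ⟨?_, ?_, ?_⟩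
  · have h2 := prefixWeight_enc_append φ []
    rw [List.append_nil] at h2
    rw [h2]
    have := Nat.pos_of_ne_zero hne
    positivity
  · rw [localProb_enc]
    exact ⟨(φ.satsFrom [b]).ncard / (φ.satsFrom []).ncard, by push_cast; rfl⟩
  · rw [localProb_enc, div_eq_zero_iff]
    simp only [Nat.cast_eq_zero, hne, or_false]
    exact Set.ncard_eq_zero (φ.finite_satsFrom _)

/-! ### Expressing predicates by formulas of bounded length -/

theorem Formula.eval_congr {φ : Formula} {f g : ℕ → Bool} (h : ∀ i ∈ φ.vars, f i = g i) :
    φ.eval f = φ.eval g := by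
  induction φ with
  | var i => exact h i (by simp [Formula.vars])
  | neg φ ih => simp only [Formula.eval, ih h]
  | and φ ψ ih1 ih2 =>
    simp only [Formula.vars, Finset.mem_union] at h
    simp only [Formula.eval, ih1 fun i hi => h i (.inl hi), ih2 fun i hi => h i (.inr hi)]
  | or φ ψ ih1 ih2 =>
    simp only [Formula.vars, Finset.mem_union] at h
    simp only [Formula.eval, ih1 fun i hi => h i (.inl hi), ih2 fun i hi => h i (.inr hi)]

/-- There is a formula of length at most `B` in the variables below `N` that expresses `p`; the
variable `0` is left free for other purposes. -/
def Expressible (N B : ℕ) (p : (ℕ → Bool) → Prop) : Prop :=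
  ∃ φ : Formula, (∀ ν, φ.eval ν = true ↔ p fun k => ν (k + 1)) ∧ (∀ i ∈ φ.vars, i < N) ∧
    φ.enc.length ≤ B

namespace Expressible

variable {N B B' : ℕ} {p q : (ℕ → Bool) → Prop}

theorem mono (h : Expressible N B p) (hB : B ≤ B') : Expressible N B' p := by
  obtain ⟨φ, h1, h2, h3⟩ := h
  exact ⟨φ, h1, h2, h3.trans hB⟩

theorem lit {k : ℕ} (h : k + 1 < N) : Expressible N (N + 3) fun μ => μ k = true :=
  ⟨.var (k + 1), fun ν => by simp [Formula.eval], by simpa [Formula.vars] using h,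
    by simp [Formula.enc, unary]; omega⟩

theorem not (h : Expressible N B p) : Expressible N (B + 2) fun μ => ¬ p μ := by
  obtain ⟨φ, h1, h2, h3⟩ := h
  exact ⟨.neg φ, fun ν => by simp [Formula.eval, ← h1], h2, by simp [Formula.enc]; omega⟩

theorem and (h : Expressible N B p) (h' : Expressible N B' q) :
    Expressible N (B + B' + 2) fun μ => p μ ∧ q μ := by
  obtain ⟨φ, h1, h2, h3⟩ := h
  obtain ⟨ψ, h4, h5, h6⟩ := h'
  refine ⟨.and φ ψ, fun ν => by simp [Formula.eval, ← h1, ← h4], fun i hi => ?_, by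
    simp [Formula.enc]; omega⟩
  rcases Finset.mem_union.1 hi with hi | hi
  exacts [h2 i hi, h5 i hi]

theorem or (h : Expressible N B p) (h' : Expressible N B' q) :
    Expressible N (B + B' + 2) fun μ => p μ ∨ q μ := by
  obtain ⟨φ, h1, h2, h3⟩ := h
  obtain ⟨ψ, h4, h5, h6⟩ := h'
  refine ⟨.or φ ψ, fun ν => by simp [Formula.eval, ← h1, ← h4], fun i hi => ?_, by
    simp [Formula.enc]; omega⟩
  rcases Finset.mem_union.1 hi with hi | hi
  exacts [h2 i hi, h5 i hi]

theorem iff (h : Expressible N B p) (h' : Expressible N B' q) :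
    Expressible N (2 * (B + B') + 10) fun μ => p μ ↔ q μ := by
  obtain ⟨φ, h1, h2⟩ := ((h.and h').or (h.not.and h'.not)).mono (B' := 2 * (B + B') + 10) (by omega)
  exact ⟨φ, fun ν => by rw [h1]; tauto, h2⟩

theorem imp (h : Expressible N B p) (h' : Expressible N B' q) :
    Expressible N (B + B' + 4) fun μ => p μ → q μ := by
  obtain ⟨φ, h1, h2⟩ := (h.not.or h').mono (B' := B + B' + 4) (by omega)
  exact ⟨φ, fun ν => by rw [h1]; tauto, h2⟩

/-- The predicates do not see the variable `0`, so it is available for a tautology or a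
contradiction. -/
theorem const (h : 0 < N) (c : Prop) : Expressible N 10 fun _ => c := by
  by_cases hc : c
  · refine ⟨.or (.var 0) (.neg (.var 0)), fun ν => by simp [Formula.eval, hc], ?_, ?_⟩
    · simpa [Formula.vars] using h
    · simp [Formula.enc, unary]
  · refine ⟨.and (.var 0) (.neg (.var 0)), fun ν => by simp [Formula.eval, hc], ?_, ?_⟩
    · simpa [Formula.vars] using h
    · simp [Formula.enc, unary]

theorem all {p : ℕ → (ℕ → Bool) → Prop} (hN : 0 < N) (k : ℕ) (h : ∀ i < k, Expressible N B (p i)) :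
    Expressible N (k * (B + 2) + 10) fun μ => ∀ i < k, p i μ := by
  induction k with
  | zero =>
    obtain ⟨φ, h1, h2, h3⟩ := const hN True
    exact ⟨φ, fun ν => by simp [h1], h2, by omega⟩
  | succ k ih =>
    obtain ⟨φ, h1, h2⟩ := ((ih fun i hi => h i (by omega)).and (h k (by omega))).mono
      (B' := (k + 1) * (B + 2) + 10) (by rw [Nat.succ_mul]; omega)
    exact ⟨φ, fun ν => (h1 ν).trans Nat.forall_lt_succ_right.symm, h2⟩

theorem any {p : ℕ → (ℕ → Bool) → Prop} (hN : 0 < N) (k : ℕ) (h : ∀ i < k, Expressible N B (p i)) :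
    Expressible N (k * (B + 2) + 10) fun μ => ∃ i < k, p i μ := by
  induction k with
  | zero =>
    obtain ⟨φ, h1, h2, h3⟩ := const hN False
    exact ⟨φ, fun ν => by simp [h1], h2, by omega⟩
  | succ k ih =>
    obtain ⟨φ, h1, h2⟩ := ((ih fun i hi => h i (by omega)).or (h k (by omega))).mono
      (B' := (k + 1) * (B + 2) + 10) (by rw [Nat.succ_mul]; omega)
    exact ⟨φ, fun ν => (h1 ν).trans Nat.exists_lt_succ_right.symm, h2⟩

end Expressible

/-! ### The tableau of a computation -/

namespace TM

variable (M : TM)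

/-- A step of `M`; halting configurations are left unchanged. -/
def next (c : Turing.TM0.Cfg ℕ ℕ) : Turing.TM0.Cfg ℕ ℕ :=
  (Turing.TM0.step M.toMachine c).getD c

/-- The state following `q` on reading `a`. -/
def nextState (q a : ℕ) : ℕ := ((M.toMachine q a).map Prod.fst).getD q

/-- The action in state `q` on reading `a`. -/
def nextAct (q a : ℕ) : Option (Turing.TM0.Stmt ℕ) := (M.toMachine q a).map Prod.snd

theorem next_q (c : Turing.TM0.Cfg ℕ ℕ) : (M.next c).q = M.nextState c.q c.Tape.head := by
  obtain ⟨q, T⟩ := c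
  rcases h : M.toMachine q T.head with _ | ⟨q', a⟩
  · simp [next, nextState, Turing.TM0.step, h]
  · simp [next, nextState, TM.step_eq h, h]

theorem next_tape (c : Turing.TM0.Cfg ℕ ℕ) :
    (M.next c).Tape = (M.nextAct c.q c.Tape.head).elim c.Tape (tapeApply c.Tape) := by
  obtain ⟨q, T⟩ := c
  rcases h : M.toMachine q T.head with _ | ⟨q', a⟩
  · simp [next, nextAct, Turing.TM0.step, h]
  · simp [next, nextAct, TM.step_eq h, h]

theorem Steps.iterate_next {M : TM} {c c' : Turing.TM0.Cfg ℕ ℕ} {n : ℕ} (h : M.Steps c n c') :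
    M.next^[n] c = c' := by
  induction n generalizing c with
  | zero => simpa [TM.Steps] using h
  | succ n ih =>
    obtain ⟨d, h1, h2⟩ := h.succ_inv
    rw [Function.iterate_succ_apply, next, h1]
    exact ih h2

/-- Halting configurations are fixed by `next`, so the output can be read at any prescribed later
time. -/
theorem Outputs.iterate_next {M : TM} {w v : List ℕ} {t t' : ℕ} (h : M.Outputs w v t)
    (ht : t ≤ t') : (M.next^[t'] (Turing.TM0.init w)).Tape = Turing.Tape.mk₁ v := by
  obtain ⟨n, hn, q, h1, h2⟩ := TM.outputs_iff.1 h
  obtain ⟨k, rfl⟩ := Nat.exists_eq_add_of_le (hn.trans ht)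
  rw [Nat.add_comm, Function.iterate_add_apply, h1.iterate_next, Function.iterate_fixed]
  simp [next, Turing.TM0.step, h2]

/-- All states and written symbols are below `D`, as well as the symbols used for input words. -/
def BoundedBy (D : ℕ) : Prop :=
  4 ≤ D ∧ ∀ r ∈ M, r.next < D ∧ ∀ a, r.act = .write a → a < D

theorem exists_boundedBy : ∃ D, M.BoundedBy D := by
  induction M with
  | nil => exact ⟨4, le_rfl, by simp⟩
  | cons r M ih =>
    obtain ⟨D, h1, h2⟩ := ih
    obtain ⟨b, hb⟩ : ∃ b, ∀ a, r.act = .write a → a < b := by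
      rcases r.act with d | b
      · exact ⟨0, by simp⟩
      · exact ⟨b + 1, fun a h => by cases h; omega⟩
    refine ⟨D + r.next + b + 1, by omega, fun s hs => ?_⟩
    rcases List.mem_cons.1 hs with rfl | hs
    · exact ⟨by omega, fun a ha => by have := hb a ha; omega⟩
    · exact ⟨by have := (h2 s hs).1; omega, fun a ha => by have := (h2 s hs).2 a ha; omega⟩

end TM

/-- The state and the symbols of a configuration are below `D`. -/
def CfgBounded (D : ℕ) (c : Turing.TM0.Cfg ℕ ℕ) : Prop := c.q < D ∧ ∀ j, c.Tape.nth j < D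

theorem CfgBounded.next {M : TM} {D : ℕ} {c : Turing.TM0.Cfg ℕ ℕ} (hM : M.BoundedBy D)
    (h : CfgBounded D c) : CfgBounded D (M.next c) := by
  rw [CfgBounded, M.next_q, M.next_tape, TM.nextState, TM.nextAct]
  rcases h1 : M.toMachine c.q c.Tape.head with _ | ⟨q', a⟩
  · exact h
  · obtain ⟨r, hr, -, -, h2, h3⟩ := TM.toMachine_mem h1
    have h4 := hM.2 r hr
    refine ⟨by have := h4.1; rw [h2] at this; simpa using this, fun j => ?_⟩
    rcases a with (_ | _) | b
    · simpa [tapeApply, Turing.Tape.move_left_nth] using h.2 _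
    · simpa [tapeApply, Turing.Tape.move_right_nth] using h.2 _
    · simp only [Option.map_some, Option.elim_some, tapeApply, Turing.Tape.write_nth]
      split_ifs
      · exact h4.2 b h3
      · exact h.2 j

namespace Tableau

/-- The variable for `at time i, the machine is in state q`. -/
def stateVar (i q : ℕ) : ℕ := Nat.pair 0 (Nat.pair i q)

/-- The variable for `at time i, the symbol at position p is s`; the head is at a fixed position. -/
def cellVar (i p s : ℕ) : ℕ := Nat.pair 1 (Nat.pair i (Nat.pair p s))

/-- Variables are written in unary, so their numbers have to be polynomially bounded. A pairing
doubles the exponent; the three nested ones of `cellVar` lead to `W ^ 8`. -/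
theorem pair_lt_pow {a b W k : ℕ} (ha : a < W ^ k) (hb : b < W ^ k) : Nat.pair a b < W ^ (2 * k) := by
  refine (Nat.pair_lt_max_add_one_sq a b).trans_le ?_
  rw [mul_comm, pow_mul]
  exact Nat.pow_le_pow_left (by omega) 2

theorem stateVar_lt {i q W : ℕ} (hi : i < W) (hq : q < W) : stateVar i q < W ^ 8 := by
  have h2 : Nat.pair i q < W ^ (2 * 1) := pair_lt_pow (by simpa) (by simpa)
  have h0 : 0 < W := by omega
  have h4 : stateVar i q < W ^ (2 * (2 * 1)) := pair_lt_pow (Nat.pow_pos h0) h2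
  exact h4.trans_le (Nat.pow_le_pow_right h0 (by omega))

theorem cellVar_lt {i p s W : ℕ} (hW : 1 < W) (hi : i < W) (hp : p < W) (hs : s < W) :
    cellVar i p s < W ^ 8 := by
  have h2 : Nat.pair p s < W ^ (2 * 1) := pair_lt_pow (by simpa) (by simpa)
  have h4 : Nat.pair i (Nat.pair p s) < W ^ (2 * (2 * 1)) :=
    pair_lt_pow (hi.trans_le (Nat.le_self_pow (by omega) W)) h2
  exact pair_lt_pow (hW.trans_le (Nat.le_self_pow (by omega) W)) h4

variable (M : TM) (D t : ℕ)

/-- The contents, at the next time, of the cell at position `p + 1`, after a given action. -/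
def Source (μ : ℕ → Bool) (i p s : ℕ) : Option (Turing.TM0.Stmt ℕ) → Prop
  | none => μ (cellVar i (p + 1) s) = true
  | some (.move .left) => μ (cellVar i p s) = true
  | some (.move .right) => μ (cellVar i (p + 2) s) = true
  | some (.write b) => if p + 1 = t then s = b else μ (cellVar i (p + 1) s) = true

/-- The step at time `i`, from the state `q` and reading `a`, is correctly described. -/
def Step (μ : ℕ → Bool) (i q a : ℕ) : Prop :=
  (∀ q' < D, (μ (stateVar (i + 1) q') = true ↔ M.nextState q a = q')) ∧
  ∀ p < 2 * t, ∀ s < D, (μ (cellVar (i + 1) (p + 1) s) = true ↔ Source t μ i p s (M.nextAct q a))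

/-- All steps are correctly described. -/
def Steps (μ : ℕ → Bool) : Prop :=
  ∀ i < t, ∀ q < D, ∀ a < D, μ (stateVar i q) = true → μ (cellVar i t a) = true → Step M D t μ i q a

/-- The configuration at time `i` is correctly described, at the positions which matter. -/
def Row (μ : ℕ → Bool) (i : ℕ) (c : Turing.TM0.Cfg ℕ ℕ) : Prop :=
  (∀ q < D, (μ (stateVar i q) = true ↔ c.q = q)) ∧
  ∀ p, i ≤ p → p + i ≤ 2 * t → ∀ s < D, (μ (cellVar i p s) = true ↔ c.Tape.nth (p - t) = s)

variable {M D t}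

theorem source_iff {μ : ℕ → Bool} {i p s : ℕ} {T : Turing.Tape ℕ}
    {a : Option (Turing.TM0.Stmt ℕ)}
    (h : ∀ p', p ≤ p' → p' ≤ p + 2 → (μ (cellVar i p' s) = true ↔ T.nth (p' - t) = s)) :
    Source t μ i p s a ↔ (a.elim T (tapeApply T)).nth ((p + 1 : ℕ) - t) = s := by
  rcases a with _ | (_ | _) | b
  · exact h _ (by omega) (by omega)
  · refine (h _ le_rfl (by omega)).trans ?_
    simp only [Option.elim_some, tapeApply, Turing.Tape.move_left_nth]
    rw [show ((p + 1 : ℕ) : ℤ) - t - 1 = p - t by push_cast; ring]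
  · refine (h _ (by omega) le_rfl).trans ?_
    simp only [Option.elim_some, tapeApply, Turing.Tape.move_right_nth]
    rw [show ((p + 1 : ℕ) : ℤ) - t + 1 = (p + 2 : ℕ) - t by push_cast; ring]
  · simp only [Source, Option.elim_some, tapeApply, Turing.Tape.write_nth]
    -- The tape moves instead of the head, which stays at position `t`; only there does a write have
    -- an effect.
    by_cases hp : p + 1 = t
    · rw [if_pos hp, if_pos (by omega)]
      exact eq_comm
    · rw [if_neg hp, if_neg (by omega)]
      exact h _ (by omega) (by omega)

/-- The next content of a cell depends on the cell and its two neighbours, so the window of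
positions known to be correct loses one cell on each side per step. It starts as `[0, 2 * t]`, and
at time `t` the scanned position `t` is what remains. No condition at the borders is needed. -/
theorem Row.succ {μ : ℕ → Bool} {i : ℕ} {c : Turing.TM0.Cfg ℕ ℕ} (hi : i < t)
    (hS : Steps M D t μ) (hc : CfgBounded D c) (h : Row D t μ i c) :
    Row D t μ (i + 1) (M.next c) := by
  have h0 : c.Tape.nth ((t : ℤ) - t) = c.Tape.head := by rw [sub_self, Turing.Tape.nth_zero]
  have hhead : c.Tape.head < D := h0 ▸ hc.2 _
  obtain ⟨h1, h2⟩ := hS i hi c.q hc.1 c.Tape.head hhead ((h.1 _ hc.1).2 rfl)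
    ((h.2 t (by omega) (by omega) _ hhead).2 h0)
  refine ⟨fun q hq => by rw [M.next_q]; exact h1 q hq, fun p hp hp' s hs => ?_⟩
  obtain ⟨p, rfl⟩ : ∃ k, p = k + 1 := ⟨p - 1, by omega⟩
  rw [h2 p (by omega) s hs, M.next_tape]
  exact source_iff fun p' h3 h4 => h.2 p' (by omega) (by omega) s hs

theorem Row.iterate {μ : ℕ → Bool} {c : Turing.TM0.Cfg ℕ ℕ} (hM : M.BoundedBy D)
    (hS : Steps M D t μ) (hc : CfgBounded D c) (h : Row D t μ 0 c) {i : ℕ} (hi : i ≤ t) :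
    Row D t μ i (M.next^[i] c) ∧ CfgBounded D (M.next^[i] c) := by
  induction i with
  | zero => exact ⟨h, hc⟩
  | succ i ih =>
    obtain ⟨h1, h2⟩ := ih (by omega)
    rw [Function.iterate_succ_apply']
    exact ⟨h1.succ (by omega) hS h2, h2.next hM⟩

variable (M t) in
/-- The assignment describing a computation. -/
def assignment (c : Turing.TM0.Cfg ℕ ℕ) (k : ℕ) : Bool :=
  let x := k.unpair
  let y := x.2.unpair
  if x.1 = 0 then decide ((M.next^[y.1] c).q = y.2)
  else decide ((M.next^[y.1] c).Tape.nth ((y.2.unpair.1 : ℤ) - t) = y.2.unpair.2)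

theorem assignment_stateVar (c : Turing.TM0.Cfg ℕ ℕ) (i q : ℕ) :
    assignment M t c (stateVar i q) = true ↔ (M.next^[i] c).q = q := by
  simp [assignment, stateVar]

theorem assignment_cellVar (c : Turing.TM0.Cfg ℕ ℕ) (i p s : ℕ) :
    assignment M t c (cellVar i p s) = true ↔ (M.next^[i] c).Tape.nth (p - t) = s := by
  simp [assignment, cellVar]

theorem steps_assignment (c : Turing.TM0.Cfg ℕ ℕ) : Steps M D t (assignment M t c) := by
  intro i _ q _ a _ h1 h2
  rw [assignment_stateVar] at h1
  rw [assignment_cellVar, sub_self, Turing.Tape.nth_zero] at h2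
  subst h1 h2
  refine ⟨fun q' _ => ?_, fun p _ s _ => ?_⟩
  · rw [assignment_stateVar, Function.iterate_succ_apply', M.next_q]
  · rw [assignment_cellVar, Function.iterate_succ_apply', M.next_tape]
    exact (source_iff fun p' _ _ => assignment_cellVar c i p' s).symm

end Tableau

/-! ### Accepting tableaux -/

namespace Tableau

section Accepting

variable (M : TM) (D t n k : ℕ)

/-- At the beginning, the symbol at position `p` is `b`. -/
def InitCell (μ : ℕ → Bool) (p b : ℕ) : Prop := ∀ s < D, (μ (cellVar 0 p s) = true ↔ b = s)

/-- At the beginning, there is a bit at position `p`. -/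
def BitCell (μ : ℕ → Bool) (p : ℕ) : Prop := InitCell D μ p (bitSym (μ (cellVar 0 p 2)))

/-- At the beginning, the symbol at position `t + j` is that of an input consisting of `n` bits, a
separator and `k` bits. -/
def InputCell (μ : ℕ → Bool) (j : ℕ) : Prop :=
  if j = n then InitCell D μ (t + j) sepSym
  else if j < n + 1 + k then BitCell D μ (t + j) else InitCell D μ (t + j) 0

/-- The computation on some input consisting of `n` bits, a separator and at most `k` bits is
correctly described, and its result is `1`. -/
def Accepting (μ : ℕ → Bool) : Prop :=
  Steps M D t μ ∧ μ (cellVar t t 2) = true ∧ (∀ q < D, (μ (stateVar 0 q) = true ↔ 0 = q)) ∧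
    (∀ p < t, InitCell D μ p 0) ∧ ∃ l < k + 1, ∀ j < t + 1, InputCell D t n l μ j

end Accepting

variable {M : TM} {D t : ℕ}

/-- The bit `false` is a placeholder for the separator, aligning the positions of bits with those of
tape symbols; it is never consulted. -/
theorem input_getD (x c : List Bool) (j : ℕ) :
    (word x ++ sepSym :: word c).getD j 0 = if j = x.length then sepSym
      else if j < x.length + 1 + c.length then bitSym ((x ++ false :: c).getD j false) else 0 := by
  rw [List.getD_eq_getElem?_getD, List.getD_eq_getElem?_getD]
  rcases lt_trichotomy j x.length with h | rfl | h
  · rw [List.getElem?_append_left (by simpa [word] using h), List.getElem?_append_left h,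
      if_neg (by omega), if_pos (by omega)]
    simp [word, h]
  · rw [List.getElem?_append_right (by simp [word])]
    simp [word]
  · obtain ⟨i, rfl⟩ : ∃ i, j = x.length + 1 + i := ⟨j - x.length - 1, by omega⟩
    rw [List.getElem?_append_right (by simp [word]; omega), List.getElem?_append_right (by omega),
      if_neg (by omega), show (word x).length = x.length by simp [word],
      show x.length + 1 + i - x.length = i + 1 by omega]
    by_cases hi : i < c.length
    · simp [word, hi]
    · rw [if_neg (by omega)]
      simp [word, hi]

theorem init_nth (w : List ℕ) (i : ℕ) :
    (Turing.TM0.init w : Turing.TM0.Cfg ℕ ℕ).Tape.nth ((t + i : ℕ) - t) = w.getD i 0 := by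
  have := wordTape_rep w ((t + i : ℕ) - t)
  simp only [Turing.TM0.init]
  rw [this]
  simp [wordTape]

theorem init_nth_of_lt (w : List ℕ) {p : ℕ} (hp : p < t) :
    (Turing.TM0.init w : Turing.TM0.Cfg ℕ ℕ).Tape.nth (p - t) = 0 := by
  have := wordTape_rep w (p - t)
  simp only [Turing.TM0.init]
  rw [this]
  simp only [wordTape, zero_add]
  rw [if_neg (by omega)]

theorem init_bounded (hD : 4 ≤ D) (x c : List Bool) :
    CfgBounded D (Turing.TM0.init (word x ++ sepSym :: word c)) := by
  refine ⟨show 0 < D by omega, fun j => ?_⟩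
  have := wordTape_rep (word x ++ sepSym :: word c) j
  simp only [Turing.TM0.init]
  rw [this]
  simp only [wordTape, zero_add, input_getD]
  have h3 : sepSym = 3 := rfl
  have hb : ∀ b, bitSym b < 3 := by decide
  have := hb ((x ++ false :: c).getD j.toNat false)
  split_ifs <;> omega

/-- The answer to a question is read off from the symbol scanned at the end. -/
theorem answers_iff {w : List ℕ} {p : Prop} (h : M.Answers w p t) :
    (M.next^[t] (Turing.TM0.init w)).Tape.nth ((t : ℤ) - t) = 2 ↔ p := by
  rw [sub_self, Turing.Tape.nth_zero]
  by_cases hp : p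
  · rw [(h.1 hp).iterate_next le_rfl]
    exact iff_of_true rfl hp
  · rw [(h.2 hp).iterate_next le_rfl]
    exact iff_of_false (by decide) hp

/-- The Cook–Levin argument. An accepting tableau has a certificate in its initial row, and by
`Row.iterate` it agrees with the true computation at the scanned cell at time `t`. Conversely the
true computation is a tableau. -/
theorem exists_accepting_iff {n k : ℕ} {x : List Bool} {R : List Bool → Prop}
    (hM : M.BoundedBy D) (hx : x.length = n)
    (hR : ∀ c, c.length ≤ k → M.Answers (word x ++ sepSym :: word c) (R c) t) :
    (∃ μ, Accepting M D t n k μ ∧ ∀ j < n, μ (cellVar 0 (t + j) 2) = x.getD j false) ↔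
      ∃ c, c.length ≤ k ∧ R c := by
  subst hx
  constructor
  · rintro ⟨μ, ⟨h1, h2, h3, h4, l, hl, h5⟩, h6⟩
    -- Certificate bits at positions above `2 * t` are not constrained by the tableau, but they lie
    -- outside the window of `Row`.
    set c : List Bool := (List.range l).map fun i => μ (cellVar 0 (t + (x.length + 1 + i)) 2) with hc
    have hcl : c.length = l := by simp [hc]
    refine ⟨c, by omega, ?_⟩
    have hrow : Row D t μ 0 (Turing.TM0.init (word x ++ sepSym :: word c)) := by
      refine ⟨h3, fun p _ hp s hs => ?_⟩
      rcases Nat.lt_or_ge p t with hpt | hpt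
      · rw [init_nth_of_lt _ hpt]
        exact h4 p hpt s hs
      · obtain ⟨j, rfl⟩ := Nat.exists_eq_add_of_le hpt
        rw [init_nth, input_getD, hcl]
        have h7 := h5 j (by omega)
        unfold InputCell at h7
        split_ifs at h7 ⊢ with h8 h9
        · exact h7 s hs
        · rw [h7 s hs]
          suffices H : μ (cellVar 0 (t + j) 2) = (x ++ false :: c).getD j false by rw [H]
          rcases Nat.lt_or_ge j x.length with h10 | h10
          · rw [h6 j h10, List.getD_append _ _ _ _ h10]
          · obtain ⟨i, rfl⟩ : ∃ i, j = x.length + 1 + i := ⟨j - x.length - 1, by omega⟩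
            rw [List.getD_append_right _ _ _ _ (by omega),
              show x.length + 1 + i - x.length = i + 1 by omega]
            simp [hc, List.getD, show i < l by omega]
        · exact h7 s hs
    obtain ⟨h7, -⟩ := hrow.iterate hM h1 (init_bounded hM.1 x c) le_rfl
    have h8 := (h7.2 t le_rfl (by omega) 2 (by have := hM.1; omega)).1 h2
    exact (answers_iff (hR c (by omega))).1 h8
  · rintro ⟨c, hc, hRc⟩
    refine ⟨assignment M t (Turing.TM0.init (word x ++ sepSym :: word c)),
      ⟨steps_assignment _, ?_, ?_, ?_, c.length, by omega, ?_⟩, ?_⟩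
    · rw [assignment_cellVar]
      exact (answers_iff (hR c hc)).2 hRc
    · intro q _
      rw [assignment_stateVar]
      rfl
    · intro p hp s _
      rw [assignment_cellVar, Function.iterate_zero_apply, init_nth_of_lt _ hp]
    · intro j _
      have h1 : ∀ s, assignment M t (Turing.TM0.init (word x ++ sepSym :: word c))
          (cellVar 0 (t + j) s) = true ↔ (word x ++ sepSym :: word c).getD j 0 = s := fun s => by
        rw [assignment_cellVar, Function.iterate_zero_apply, init_nth]
      unfold InputCell
      rw [input_getD] at h1
      split_ifs at h1 ⊢ with h2 h3
      · exact fun s _ => h1 s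
      · intro s _
        rw [h1]
        have h4 := h1 2
        rcases hb : (x ++ false :: c).getD j false with _ | _
        · rw [hb] at h4
          have : assignment M t (Turing.TM0.init (word x ++ sepSym :: word c))
            (cellVar 0 (t + j) 2) = false := by
              rw [Bool.eq_false_iff, Ne, h4]; decide
          rw [this]
        · rw [hb] at h4
          rw [h4.2 rfl]
      · exact fun s _ => h1 s
    · intro j hj
      rw [Bool.eq_iff_iff, assignment_cellVar, Function.iterate_zero_apply, init_nth, input_getD,
        if_neg (by omega), if_pos (by omega), List.getD_append _ _ _ _ hj]
      cases x.getD j false <;> decide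

end Tableau

/-! ### Accepting tableaux are expressible -/

theorem Expressible.congr {N B : ℕ} {p q : (ℕ → Bool) → Prop} (h : Expressible N B p)
    (hpq : ∀ μ, p μ ↔ q μ) : Expressible N B q := by
  rwa [show q = p from funext fun μ => propext (hpq μ).symm]

namespace Tableau

variable {D t N W : ℕ}

theorem expressible_stateVar {i q : ℕ} (hN : N = W ^ 8 + 2) (hi : i < W) (hq : q < W) :
    Expressible N (N + 3) fun μ => μ (stateVar i q) = true :=
  .lit (by have := stateVar_lt hi hq; omega)

theorem expressible_cellVar {i p s : ℕ} (hN : N = W ^ 8 + 2) (hW : 1 < W) (hi : i < W) (hp : p < W)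
    (hs : s < W) : Expressible N (N + 3) fun μ => μ (cellVar i p s) = true :=
  .lit (by have := cellVar_lt hW hi hp hs; omega)

theorem expressible_initCell {p b : ℕ} (hN : N = W ^ 8 + 2) (hW : 1 < W) (hp : p < W) (hD : D ≤ W) :
    Expressible N (D * (6 * N + 100) + 10) fun μ => InitCell D μ p b :=
  .all (by omega) D fun s hs => ((expressible_cellVar hN hW (by omega) hp (by omega)).iff
    (.const (by omega) (b = s))).mono (by omega)

theorem expressible_bitCell {p : ℕ} (hN : N = W ^ 8 + 2) (hW : 2 < W) (hp : p < W) (hD : D ≤ W) :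
    Expressible N (D * (6 * N + 100) + 10) fun μ => BitCell D μ p := by
  have h2 := expressible_cellVar (i := 0) (s := 2) hN (by omega) (by omega) hp hW
  refine .all (by omega) D fun s hs => ((expressible_cellVar hN (by omega) (by omega) hp
    (by omega)).iff (((h2.and (.const (by omega) (2 = s))).or
      (h2.not.and (.const (by omega) (1 = s)))).congr (q := fun μ => bitSym (μ (cellVar 0 p 2)) = s)
      fun μ => ?_)).mono (by omega)
  cases μ (cellVar 0 p 2) <;> simp [bitSym]

theorem expressible_inputCell {j n k : ℕ} (hN : N = W ^ 8 + 2) (hW : 2 < W) (hp : t + j < W)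
    (hD : D ≤ W) : Expressible N (D * (6 * N + 100) + 10) fun μ => InputCell D t n k μ j := by
  unfold InputCell
  split_ifs
  · exact expressible_initCell hN (by omega) hp hD
  · exact expressible_bitCell hN hW hp hD
  · exact expressible_initCell hN (by omega) hp hD

theorem expressible_source {i p s : ℕ} {a : Option (Turing.TM0.Stmt ℕ)} (hN : N = W ^ 8 + 2)
    (hW : 8 ≤ W) (hi : i < W) (hp : p + 2 < W) (hs : s < W) :
    Expressible N (N + 3) fun μ => Source t μ i p s a := by
  have h8 : 8 ≤ W ^ 8 := hW.trans (Nat.le_self_pow (by omega) W)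
  rcases a with _ | (_ | _) | b <;> simp only [Source]
  · exact expressible_cellVar hN (by omega) hi (by omega) hs
  · exact expressible_cellVar hN (by omega) hi (by omega) hs
  · exact expressible_cellVar hN (by omega) hi (by omega) hs
  · split_ifs
    · exact (Expressible.const (by omega) _).mono (by omega)
    · exact expressible_cellVar hN (by omega) hi (by omega) hs

/-- A bound for the length of a formula expressing the correctness of all steps. -/
def stepsBound (D t N : ℕ) : ℕ :=
  t * (D * (D * (D * (2 * N + 40) + 2 * t * (D * (4 * N + 30) + 12) + 2 * N + 40) + 12) + 12) + 10

theorem expressible_steps (M : TM) (hN : N = W ^ 8 + 2) (hW : 8 ≤ W) (hD : D ≤ W)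
    (ht : 2 * t + 2 < W) : Expressible N (stepsBound D t N) fun μ => Steps M D t μ := by
  have h0 : 0 < N := by omega
  refine .all h0 t fun i hi => ((Expressible.all h0 D fun q hq => ((Expressible.all h0 D
    fun a ha => ?_).mono le_rfl))).mono le_rfl
  refine ((expressible_stateVar hN (by omega) (by omega)).imp
    ((expressible_cellVar hN (by omega) (by omega) (by omega) (by omega)).imp
    ((Expressible.all h0 D (B := 2 * N + 38) fun q' hq' => ?_).and
    (.all h0 (2 * t) fun p hp => .all h0 D (B := 4 * N + 28) fun s hs => ?_)))).mono ?_
  · exact ((expressible_stateVar hN (by omega) (by omega)).iff (.const h0 _)).mono (by omega)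
  · exact ((expressible_cellVar hN (by omega) (by omega) (by omega) (by omega)).iff
      (expressible_source hN hW (by omega) (by omega) (by omega))).mono (by omega)
  · simp only [Nat.add_assoc, Nat.reduceAdd]
    omega

/-- A bound for the length of a formula expressing that a tableau is accepting. -/
def acceptingBound (D t k N : ℕ) : ℕ :=
  stepsBound D t N + (k + 1) * ((t + 1) * (D * (6 * N + 100) + 12) + 12) +
    t * (D * (6 * N + 100) + 12) + D * (6 * N + 100) + N + 100

theorem expressible_accepting (M : TM) {n k : ℕ} (hN : N = W ^ 8 + 2) (hW : 8 ≤ W) (hD : D ≤ W)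
    (ht : 2 * t + 2 < W) : Expressible N (acceptingBound D t k N) fun μ => Accepting M D t n k μ := by
  have h0 : 0 < N := by omega
  refine ((expressible_steps M hN hW hD ht).and
    ((expressible_cellVar hN (by omega) (by omega) (by omega) (by omega)).and
    ((Expressible.all h0 D (B := 6 * N + 98) fun q hq => ?_).and
    ((Expressible.all h0 t fun p hp => expressible_initCell hN (by omega) (by omega) hD).and
    (.any h0 (k + 1) fun l hl => .all h0 (t + 1) fun j hj =>
      expressible_inputCell hN (by omega) (by omega) hD))))).mono ?_
  · exact ((expressible_stateVar hN (by omega) (by omega)).iff (.const h0 _)).mono (by omega)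
  · unfold acceptingBound
    simp only [Nat.add_assoc, Nat.reduceAdd]
    omega

end Tableau

/-! ### The length of outputs and of descriptions of machines -/

/-- A write makes at most one more cell nonblank, and a move merely translates the nonblank cells,
positions being relative to the head. -/
theorem TM.Steps.exists_support {M : TM} {c c' : Turing.TM0.Cfg ℕ ℕ} {n : ℕ} (h : M.Steps c n c')
    {F : Finset ℤ} (hF : ∀ j ∉ F, c.Tape.nth j = 0) :
    ∃ F' : Finset ℤ, F'.card ≤ F.card + n ∧ ∀ j ∉ F', c'.Tape.nth j = 0 := by
  induction n generalizing c F with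
  | zero =>
    simp only [TM.Steps, Function.iterate_zero, id_eq, Option.some.injEq] at h
    exact ⟨F, by simp, h ▸ hF⟩
  | succ n ih =>
    obtain ⟨d, h1, h2⟩ := h.succ_inv
    obtain ⟨a, -, h3⟩ := TM.step_eq_some h1
    obtain ⟨F1, h4, h5⟩ : ∃ F1 : Finset ℤ, F1.card ≤ F.card + 1 ∧ ∀ j ∉ F1, d.Tape.nth j = 0 := by
      rw [h3]
      rcases a with (_ | _) | b
      · refine ⟨F.image (· + 1), Finset.card_image_le.trans (by omega), fun j hj => ?_⟩
        rw [tapeApply, Turing.Tape.move_left_nth]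
        exact hF _ fun h => hj (Finset.mem_image.2 ⟨_, h, by omega⟩)
      · refine ⟨F.image (· - 1), Finset.card_image_le.trans (by omega), fun j hj => ?_⟩
        rw [tapeApply, Turing.Tape.move_right_nth]
        exact hF _ fun h => hj (Finset.mem_image.2 ⟨_, h, by omega⟩)
      · refine ⟨insert 0 F, Finset.card_insert_le _ _, fun j hj => ?_⟩
        rw [Finset.mem_insert, not_or] at hj
        rw [tapeApply, Turing.Tape.write_nth, if_neg hj.1]
        exact hF j hj.2
    obtain ⟨F', h6, h7⟩ := ih h2 h5
    exact ⟨F', by omega, h7⟩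

/-- Used twice for the local model: it bounds the description that is built from the parameters, and
the fraction that is printed. -/
theorem TM.Outputs.length_le {M : TM} {w v : List ℕ} {t : ℕ} (h : M.Outputs w v t) (hv : 0 ∉ v) :
    v.length ≤ w.length + t := by
  obtain ⟨n, hn, q, h1, -⟩ := TM.outputs_iff.1 h
  have hmk : ∀ (u : List ℕ) (j : ℕ), (Turing.Tape.mk₁ u).nth j = u.getD j 0 := fun u j => by
    rw [wordTape_rep u j]; simp [wordTape]
  obtain ⟨F, h2, h3⟩ := h1.exists_support (F := (Finset.range w.length).image Nat.cast)
    fun j hj => by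
      rw [show (Turing.TM0.init w : Turing.TM0.Cfg ℕ ℕ).Tape = Turing.Tape.mk₁ w from rfl,
        wordTape_rep w j]
      simp only [wordTape, zero_add]
      split_ifs with h0
      · lift j to ℕ using h0
        have : w.length ≤ j := not_lt.1 fun h => hj (Finset.mem_image.2 ⟨j, by simpa, rfl⟩)
        simp [this]
      · rfl
  have h4 : (Finset.range v.length).image (Nat.cast : ℕ → ℤ) ⊆ F := by
    intro j hj
    obtain ⟨i, hi, rfl⟩ := Finset.mem_image.1 hj
    rw [Finset.mem_range] at hi
    by_contra hF
    have h5 := h3 _ hF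
    simp only [hmk, List.getD_eq_getElem _ _ hi] at h5
    exact hv (h5 ▸ List.getElem_mem hi)
  have h5 := Finset.card_le_card h4
  rw [Finset.card_image_of_injective _ Nat.cast_injective, Finset.card_range] at h5
  rw [Finset.card_image_of_injective _ Nat.cast_injective, Finset.card_range] at h2
  omega

theorem zero_notMem_word (x : List Bool) : 0 ∉ word x := by
  simp [word, bitSym]

theorem zero_notMem_fracWord (a b : ℕ) : 0 ∉ fracWord a b := by
  simp [fracWord, zero_notMem_word, sepSym]

theorem length_unary (n : ℕ) : (unary n).length = n + 1 := by simp [unary]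

/-- The length of the description of a machine, without the final zero. -/
def TM.codeSum (M : TM) : ℕ := (M.map fun r => r.code.length + 1).sum

theorem TM.length_code (M : TM) : M.code.length = M.codeSum + 1 := by
  induction M with
  | nil => rfl
  | cons r M ih =>
    simp only [TM.code, List.length_cons, List.length_append, ih, TM.codeSum, List.map_cons,
      List.sum_cons]
    omega

theorem TM.codeSum_append (A B : TM) : (A ++ B : TM).codeSum = A.codeSum + B.codeSum := by
  simp [TM.codeSum]

theorem TM.codeSum_le {A : TM} {C : ℕ} (h : ∀ r ∈ A, r.code.length + 1 ≤ C) :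
    A.codeSum ≤ A.length * C := by
  have := List.sum_le_card_nsmul (A.map fun r => r.code.length + 1) C (by simpa using h)
  simpa [TM.codeSum] using this

/-- A description contains both states of each instruction in unary; hence `stateBound`, being
defined by a sum, can be compared term by term. -/
theorem TM.stateBound_le (q : TM) : q.stateBound ≤ q.code.length := by
  rw [TM.length_code, TM.stateBound, TM.codeSum]
  refine Nat.succ_le_succ (List.sum_le_sum fun r _ => ?_)
  simp only [Quadruple.code, List.length_append, length_unary]
  omega

/-- The unary codes of the two states of an instruction grow by `e` each, and an instruction already
contributes at least one. -/
theorem TM.codeSum_shift_le (e : ℕ) (q : TM) : (TM.shift e q).codeSum ≤ q.codeSum * (2 * e + 1) := by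
  induction q with
  | nil => simp [TM.shift, TM.codeSum]
  | cons r q ih =>
    simp only [TM.shift, TM.codeSum, List.map_cons, List.sum_cons, Quadruple.code,
      List.length_append, length_unary] at ih ⊢
    nlinarith

theorem codeSum_instrs_le {m s Y : ℕ} {g : ℕ → ℕ × Turing.TM0.Stmt ℕ} (hs : s ≤ Y)
    (hg : ∀ a < m, (g a).1 ≤ Y ∧ ∀ b, (g a).2 = .write b → b < m) :
    (instrs m s g).codeSum ≤ m * (2 * Y + 2 * m + 6) := by
  have : (instrs m s g).length = m := by simp [instrs]
  refine (TM.codeSum_le (C := 2 * Y + 2 * m + 6) fun r hr => ?_).trans_eq (by rw [this])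
  simp only [instrs, List.mem_map, List.mem_range] at hr
  obtain ⟨a, ha, rfl⟩ := hr
  obtain ⟨h1, h2⟩ := hg a ha
  have h3 : (actCode (g a).2).length ≤ m + 2 := by
    rcases h : (g a).2 with (_ | _) | b
    · simp [actCode]
    · simp [actCode]
    · have := h2 b h
      simp [actCode, length_unary]; omega
  simp only [Quadruple.code, List.length_append, length_unary]
  omega

theorem codeSum_instrsFrom_le {m e B Y : ℕ} {g : ℕ → ℕ × Turing.TM0.Stmt ℕ} (hs : e + B ≤ Y)
    (hg : ∀ a < m, (g a).1 ≤ Y ∧ ∀ b, (g a).2 = .write b → b < m) :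
    (instrsFrom m e B g).codeSum ≤ B * (m * (2 * Y + 2 * m + 6)) := by
  induction B with
  | zero => simp [instrsFrom, TM.codeSum]
  | succ B ih =>
    have : instrsFrom m e (B + 1) g = instrsFrom m e B g ++ instrs m (e + B) g := by
      simp [instrsFrom, List.range_succ]
    rw [this, TM.codeSum_append, Nat.succ_mul]
    exact Nat.add_le_add (ih (by omega)) (codeSum_instrs_le (by omega) hg)

/-! ### Description lengths of compiled programs -/

namespace Prog

/-- A measure for the length of the description of a compiled program. -/
def weight : Prog → ℕ
  | .act _ => 1
  | .seq p q => p.weight + q.weight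
  | .ite _ p q => 1 + p.weight + q.weight
  | .loop _ p => 1 + p.weight
  -- One half pays for the shifted table, the other for the instructions leaving the call.
  | .call q => 2 * q.code.length

theorem size_le_weight (p : Prog) : p.size ≤ p.weight := by
  induction p with
  | call q => have := q.stateBound_le; simp only [size, weight]; omega
  | _ => simp only [size, weight]; omega

/-- The program itself only writes symbols below `m`. -/
def WritesBelow (m : ℕ) : Prog → Prop
  | .act g => ∀ a < m, ∀ b, g a = .write b → b < m
  | .seq p q => p.WritesBelow m ∧ q.WritesBelow m
  | .ite _ p q => p.WritesBelow m ∧ q.WritesBelow m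
  | .loop _ p => p.WritesBelow m
  | .call _ => True

theorem codeSum_compile_le {m Y : ℕ} {p : Prog} (hp : p.WritesBelow m) {e x : ℕ}
    (he : e + p.size ≤ Y) (hx : x ≤ Y) :
    (p.compile m e x).codeSum ≤ p.weight * ((m + 1) * (2 * Y + 2 * m + 6)) := by
  have hZ : m * (2 * Y + 2 * m + 6) ≤ (m + 1) * (2 * Y + 2 * m + 6) :=
    Nat.mul_le_mul_right _ (by omega)
  have hW : ∀ {f : ℕ → ℕ}, (∀ a, f a ≤ Y) →
      ∀ a < m, f a ≤ Y ∧ ∀ b, Turing.TM0.Stmt.write a = .write b → b < m := by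
    intro f hf a ha
    refine ⟨hf a, fun b hb => ?_⟩
    cases hb
    exact ha
  induction p generalizing e x with
  | act g =>
    simp only [size] at he
    simp only [compile, weight, one_mul]
    exact (codeSum_instrs_le (by omega) fun a ha => ⟨hx, hp a ha⟩).trans hZ
  | seq p q ihp ihq =>
    simp only [size] at he
    simp only [compile, weight, TM.codeSum_append, Nat.add_mul (weight p)]
    exact Nat.add_le_add (ihp hp.1 (by omega) (by omega)) (ihq hp.2 (by omega) hx)
  | ite S p q ihp ihq =>
    simp only [size] at he
    simp only [compile, weight, TM.codeSum_append, Nat.add_mul _ (weight q), Nat.add_mul 1 (weight p),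
      one_mul, ← Nat.add_assoc]
    refine Nat.add_le_add (Nat.add_le_add ((codeSum_instrs_le (by omega) (hW fun a => ?_)).trans hZ)
      (ihp hp.1 (by omega) hx)) (ihq hp.2 (by omega) hx)
    cases S a <;> simp only [cond_true, cond_false] <;> omega
  | loop S p ihp =>
    simp only [size] at he
    simp only [compile, weight, TM.codeSum_append, Nat.add_mul 1 (weight p), one_mul]
    refine Nat.add_le_add ((codeSum_instrs_le (by omega) (hW fun a => ?_)).trans hZ)
      (ihp hp (by omega) (by omega))
    cases S a <;> simp only [cond_true, cond_false] <;> omega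
  | call q =>
    simp only [size] at he
    simp only [compile, weight, TM.codeSum_append]
    rw [Nat.two_mul q.code.length, Nat.add_mul]
    refine Nat.add_le_add ((TM.codeSum_shift_le e q).trans (Nat.mul_le_mul ?_ ?_))
      ((codeSum_instrsFrom_le he (hW fun _ => hx)).trans (Nat.mul_le_mul q.stateBound_le hZ))
    · rw [TM.length_code]; omega
    · nlinarith

theorem length_code_toTM_le {m : ℕ} {p : Prog} (hp : p.WritesBelow m) :
    (p.toTM m).code.length ≤ p.weight * ((m + 1) * (2 * p.weight + 2 * m + 6)) + 1 := by
  rw [TM.length_code]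
  exact Nat.succ_le_succ (codeSum_compile_le hp (by simpa using p.size_le_weight) p.size_le_weight)

theorem writesBelow_switch {m : ℕ} {key : ℕ → ℕ} {f : ℕ → Prog} (hf : ∀ v, (f v).WritesBelow m)
    (n : ℕ) : (switch key f n).WritesBelow m := by
  induction n with
  | zero => exact hf 0
  | succ n ih => exact ⟨hf _, ih⟩

theorem writesBelow_skip (m : ℕ) : skip.WritesBelow m := fun a ha b hb => by cases hb; exact ha

end Prog

theorem Cmd.writesBelow_toProg {K s : ℕ} (c : Cmd K s) : c.toProg.WritesBelow ((s + 1) ^ K) := by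
  have hwalk : ∀ k : Fin K, (Prog.walk s k).WritesBelow ((s + 1) ^ K) := fun k =>
    fun a _ b h => by cases h
  have hhome : Prog.home.WritesBelow ((s + 1) ^ K) :=
    ⟨fun a _ b h => by (cases h), fun a _ b h => by (cases h), fun a _ b h => by (cases h)⟩
  have hset : ∀ (k : Fin K) (v : Fin (s + 1)),
      (Prog.act fun c => .write (setTrack k v c)).WritesBelow ((s + 1) ^ K) := fun k v a _ b h => by
    cases h
    exact colSym_lt _
  induction c with
  | skip => exact Prog.writesBelow_skip _
  | push k a => exact ⟨hwalk k, hset k _, hhome⟩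
  | pop k f ih =>
    refine ⟨⟨hwalk k, fun a _ b h => by (cases h), Prog.writesBelow_switch (fun v => ?_) s⟩, ih none⟩
    refine And.intro (hset k 0) (And.intro hhome ?_)
    split_ifs
    exacts [ih _, Prog.writesBelow_skip _]
  | seq c d ihc ihd => exact ⟨ihc, ihd⟩
  | loop k c ih => exact ih

/-! ### Formulas asking for an accepting tableau -/

namespace Formula

/-- The variable `i` has the value `b`. -/
def lit (i : ℕ) (b : Bool) : Formula := cond b (.var i) (.neg (.var i))

theorem eval_lit (i : ℕ) (b : Bool) (ν : ℕ → Bool) : (lit i b).eval ν = true ↔ ν i = b := by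
  cases b <;> simp [lit, eval]

theorem vars_lit (i : ℕ) (b : Bool) : (lit i b).vars = {i} := by
  cases b <;> rfl

theorem length_enc_lit (i : ℕ) (b : Bool) : (lit i b).enc.length ≤ i + 5 := by
  cases b <;> simp [lit, enc, unary]

/-- A true formula mentioning the first `k` variables. -/
def mentionAll : ℕ → Formula
  | 0 => .or (.var 0) (.neg (.var 0))
  | k + 1 => .and (mentionAll k) (.or (.var k) (.neg (.var k)))

theorem eval_mentionAll (k : ℕ) (ν : ℕ → Bool) : (mentionAll k).eval ν = true := by
  induction k with
  | zero => simp [mentionAll, eval]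
  | succ k ih => simp [mentionAll, eval, ih]

theorem vars_mentionAll (k : ℕ) : (mentionAll k).vars = insert 0 (Finset.range k) := by
  induction k with
  | zero => rfl
  | succ k ih =>
    ext i
    simp only [mentionAll, vars, ih, Finset.mem_union, Finset.mem_insert, Finset.mem_range,
      Finset.mem_singleton]
    omega

theorem length_enc_mentionAll {k N : ℕ} (hk : k ≤ N) :
    (mentionAll k).enc.length ≤ k * (2 * N + 12) + 10 := by
  induction k with
  | zero => simp [mentionAll, enc, unary]
  | succ k ih =>
    have := ih (by omega)
    simp only [mentionAll, enc, List.length_append, List.length_cons, List.length_nil, length_unary]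
    rw [Nat.add_mul]
    omega

/-- The code preceding `ρ` in the code of `fixVars w ρ j x`. -/
def fixCode (w : ℕ → ℕ) : ℕ → List Bool → List Bool
  | _, [] => []
  | j, b :: x => [true, false] ++ (lit (w j + 1) b).enc ++ fixCode w (j + 1) x

/-- The formula `ρ` with the values of the variables `w j + 1, w (j + 1) + 1, …` prescribed. -/
def fixVars (w : ℕ → ℕ) (ρ : Formula) : ℕ → List Bool → Formula
  | _, [] => ρ
  | j, b :: x => .and (lit (w j + 1) b) (fixVars w ρ (j + 1) x)

variable {w : ℕ → ℕ} {ρ : Formula}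

theorem enc_fixVars (j : ℕ) (x : List Bool) :
    (fixVars w ρ j x).enc = fixCode w j x ++ ρ.enc := by
  induction x generalizing j with
  | nil => rfl
  | cons b x ih => simp [fixVars, fixCode, enc, ih]

theorem length_fixCode_le {N : ℕ} (j : ℕ) (x : List Bool) (hw : ∀ i < x.length, w (j + i) + 1 < N) :
    (fixCode w j x).length ≤ x.length * (N + 8) := by
  induction x generalizing j with
  | nil => simp [fixCode]
  | cons b x ih =>
    have h1 := ih (j + 1) fun i hi => by
      rw [show j + 1 + i = j + (i + 1) by omega]; exact hw _ (by simpa using hi)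
    have h2 := length_enc_lit (w j + 1) b
    have h3 : w j + 1 < N := hw 0 (by simp)
    simp only [fixCode, List.length_append, List.length_cons, List.length_nil]
    rw [Nat.add_mul x.length]
    omega

theorem eval_fixVars (j : ℕ) (x : List Bool) (ν : ℕ → Bool) : (fixVars w ρ j x).eval ν = true ↔
    (∀ i < x.length, ν (w (j + i) + 1) = x.getD i false) ∧ ρ.eval ν = true := by
  induction x generalizing j with
  | nil => simp [fixVars]
  | cons b x ih =>
    simp only [fixVars, eval, Bool.and_eq_true, eval_lit, ih, List.length_cons, ← and_assoc]
    refine and_congr_left fun _ => ⟨fun ⟨h1, h2⟩ i hi => ?_, fun h => ⟨by simpa using h 0 (by omega),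
      fun i hi => ?_⟩⟩
    · rcases i with _ | i
      · simpa using h1
      · have := h2 i (by omega)
        rw [show j + (i + 1) = j + 1 + i by omega]
        simpa using this
    · have := h (i + 1) (by omega)
      rw [show j + (i + 1) = j + 1 + i by omega] at this
      simpa using this

theorem mem_vars_fixVars {j i : ℕ} {x : List Bool} : i ∈ (fixVars w ρ j x).vars ↔
    (∃ l < x.length, i = w (j + l) + 1) ∨ i ∈ ρ.vars := by
  induction x generalizing j with
  | nil => simp [fixVars]
  | cons b x ih =>
    simp only [fixVars, vars, vars_lit, Finset.mem_union, Finset.mem_singleton, ih, ← or_assoc,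
      List.length_cons]
    refine or_congr_left ⟨?_, ?_⟩
    · rintro (h | ⟨l, hl, h⟩)
      · exact ⟨0, by omega, h⟩
      · exact ⟨l + 1, by omega, by rw [h, show j + (l + 1) = j + 1 + l by omega]⟩
    · rintro ⟨_ | l, hl, h⟩
      · exact .inl h
      · exact .inr ⟨l, by omega, by rw [h, show j + (l + 1) = j + 1 + l by omega]⟩

/-- The formula which is true if `A_1` is, or else if `ρ` is and some variables have the
prescribed values; it mentions the first `N` variables. -/
def query (w : ℕ → ℕ) (ρ : Formula) (N : ℕ) (x : List Bool) : Formula :=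
  .or (.var 0) (fixVars w (.and ρ (mentionAll N)) 0 x)

theorem length_enc_query_le {N : ℕ} {x : List Bool} (hw : ∀ j < x.length, w j + 1 < N) :
    (query w ρ N x).enc.length ≤
      x.length * (N + 8) + (Formula.and ρ (mentionAll N)).enc.length + 5 := by
  have := length_fixCode_le (N := N) 0 x (by simpa using hw)
  simp only [query, enc, List.length_append, List.length_cons, List.length_nil, length_unary] at this ⊢
  rw [enc_fixVars]
  simp only [enc, List.length_append, List.length_cons, List.length_nil] at this ⊢
  omega

theorem vars_query {N : ℕ} {x : List Bool} (hN : 0 < N) (hw : ∀ j < x.length, w j + 1 < N)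
    (hρ : ∀ i ∈ ρ.vars, i < N) : (query w ρ N x).vars = Finset.range N := by
  ext i
  simp only [query, vars, Finset.mem_union, Finset.mem_singleton, mem_vars_fixVars, vars_mentionAll,
    Finset.mem_insert, Finset.mem_range]
  constructor
  · rintro (rfl | ⟨l, hl, rfl⟩ | h | rfl | h)
    exacts [hN, by simpa using hw l hl, hρ i h, hN, h]
  · exact fun h => .inr (.inr (.inr (.inr h)))

/-- The disjunct `A_1` makes the query satisfiable for every input, so the local model is always
bound to answer exactly. -/
theorem query_satisfiedBy {N : ℕ} {x : List Bool} (hN : 0 < N) (hw : ∀ j < x.length, w j + 1 < N)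
    (hρ : ∀ i ∈ ρ.vars, i < N) : (query w ρ N x).SatisfiedBy (List.replicate N true) := by
  refine ⟨by rw [vars_query hN hw hρ, List.length_replicate], ?_⟩
  simp [query, eval, hN]

/-- With `A_1` false the second disjunct has to hold. The conjunct `mentionAll N` only makes the set
of variables an initial segment, as `SatisfiedBy` requires. -/
theorem satsFrom_query {N : ℕ} {x : List Bool} {p : (ℕ → Bool) → Prop} (hN : 0 < N)
    (hw : ∀ j < x.length, w j + 1 < N) (hρ : ∀ i ∈ ρ.vars, i < N)
    (hp : ∀ ν, ρ.eval ν = true ↔ p fun k => ν (k + 1)) :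
    (query w ρ N x).satsFrom [false] = ∅ ↔
      ¬ ∃ μ, p μ ∧ ∀ j < x.length, μ (w j) = x.getD j false := by
  have hv := vars_query hN hw hρ
  rw [← Set.not_nonempty_iff_eq_empty, not_iff_not]
  constructor
  · rintro ⟨a, ⟨-, h1⟩, u, rfl⟩
    simp only [query, eval, Bool.or_eq_true, eval_fixVars, Bool.and_eq_true, hp] at h1
    rcases h1 with h1 | ⟨h1, h2, -⟩
    · simp at h1
    · exact ⟨_, h2, fun j hj => by simpa using h1 j hj⟩
  · rintro ⟨μ, h1, h2⟩
    -- Variable `0` is set to false and `μ` is shifted by one, as in `Expressible`.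
    let ν : ℕ → Bool := fun i => i.casesOn false μ
    refine ⟨(List.range N).map ν, ⟨by simp [hv], ?_⟩, ?_⟩
    · rw [eval_congr (g := ν) fun i hi => by
        rw [hv, Finset.mem_range] at hi
        simp [List.getD, hi]]
      simp only [query, eval, Bool.or_eq_true, eval_fixVars, Bool.and_eq_true, hp, eval_mentionAll,
        and_true]
      exact .inr ⟨fun i hi => by simpa [ν] using h2 i hi, h1⟩
    · obtain ⟨k, rfl⟩ : ∃ k, N = k + 1 := ⟨N - 1, by omega⟩
      rw [List.range_succ_eq_map]
      exact ⟨_, rfl⟩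

end Formula

/-! ### Programs for queries and answers -/

namespace SatProg

open Cmd

/-- Append a word to the output. -/
def pushWord : List Bool → Cmd 8 5
  | [] => skip
  | b :: u => push 0 (bsym b) ;; pushWord u

theorem run_pushWord (u : List Bool) (X Y : List (Fin 5)) :
    Run (pushWord u) (stacks8 X Y [] [] [] [] [] [])
      (stacks8 ((u.map bsym).reverse ++ X) Y [] [] [] [] [] []) (u.length + 1) := by
  induction u generalizing X with
  | nil => exact Run.skip
  | cons b u ih =>
    refine (run_push_seq (t := u.length + 1)).2 ?_
    simpa using ih (bsym b :: X)

/-- Read `k` bits and append the code prescribing the values of some variables accordingly. -/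
def fixCmd (w : ℕ → ℕ) : ℕ → ℕ → Cmd 8 5
  | _, 0 => skip
  | j, k + 1 => pop 1 (fun o =>
      pushWord ([true, false] ++ (Formula.lit (w j + 1) (decide (o = some 1))).enc)) ;;
    fixCmd w (j + 1) k

theorem run_fixCmd {w : ℕ → ℕ} {N : ℕ} (j : ℕ) (x : List Bool) (X : List (Fin 5))
    (hw : ∀ i < x.length, w (j + i) + 1 < N) :
    Run (fixCmd w j x.length) (stacks8 X (x.map bsym) [] [] [] [] [] [])
      (stacks8 (((Formula.fixCode w j x).map bsym).reverse ++ X) [] [] [] [] [] [] [])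
      (x.length * (N + 10) + 1) := by
  induction x generalizing j X with
  | nil => exact Run.skip.mono (by simp)
  | cons b x ih =>
    have h1 := ih (j + 1) (((([true, false] ++ (Formula.lit (w j + 1) b).enc).map bsym).reverse ++ X))
      fun i hi => by
        rw [show j + 1 + i = j + (i + 1) by omega]; exact hw _ (by simpa using hi)
    have h2 := run_pushWord ([true, false] ++ (Formula.lit (w j + 1) b).enc) X (x.map bsym)
    have hb : decide (some (bsym b) = some 1) = b := by cases b <;> rfl
    have h3 := Formula.length_enc_lit (w j + 1) b
    have h4 : w j + 1 < N := hw 0 (by simp)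
    replace h2 := h2.mono (t' := N + 8) (by simp; omega)
    have h5 : Run (pop 1 fun o =>
        pushWord ([true, false] ++ (Formula.lit (w j + 1) (decide (o = some 1))).enc))
        (stacks8 X ((b :: x).map bsym) [] [] [] [] [] []) _ (N + 8 + 1) :=
      Run.pop_cons (a := bsym b) (l := x.map bsym) (t := N + 8) rfl (by
        rw [hb, stacks8_update1]
        exact h2)
    have h6 := h5.seq h1
    simp only [Formula.fixCode, List.map_append, List.reverse_append, List.append_assoc] at h6 ⊢
    refine h6.mono ?_
    simp only [List.length_cons]
    rw [Nat.add_mul x.length]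
    omega

/-- Given an input of length `n`, output the corresponding query. -/
def queryCmd (w : ℕ → ℕ) (n : ℕ) (u : List Bool) : Cmd 8 5 :=
  -- The word `11` opens the disjunction and `000` is the code of `A_1`.
  transfer 0 1 ;; pushWord [true, true, false, false, false] ;; fixCmd w 0 n ;; pushWord u

theorem run_queryCmd {w : ℕ → ℕ} {N : ℕ} {x : List Bool} {ρ : Formula}
    (hw : ∀ i < x.length, w i + 1 < N) :
    Run (queryCmd w x.length ((Formula.and ρ (Formula.mentionAll N)).enc ++ [false]))
      (Stacks.single (x.map bsym).reverse)
      (Stacks.single (((Formula.query w ρ N x).enc ++ [false]).map bsym).reverse)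
      (x.length * (N + 13) + (Formula.and ρ (Formula.mentionAll N)).enc.length + 10) := by
  have h1 := run_transfer (j := 0) (k := 1) (by decide) (stacks8 (x.map bsym).reverse [] [] [] [] [] [] [])
  simp only [stacks8_0, stacks8_1, stacks8_update1, stacks8_update0, List.reverse_reverse,
    List.append_nil] at h1
  have h2 := run_pushWord [true, true, false, false, false] [] (x.map bsym)
  have h3 := run_fixCmd (w := w) (N := N) 0 x
    (([true, true, false, false, false].map bsym).reverse ++ []) (by simpa using hw)
  have h4 := run_pushWord ((Formula.and ρ (Formula.mentionAll N)).enc ++ [false])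
    (((Formula.fixCode w 0 x).map bsym).reverse ++
      (([true, true, false, false, false].map bsym).reverse ++ [])) []
  have h5 := h1.seq (h2.seq (h3.seq h4))
  have e : (Formula.query w ρ N x).enc ++ [false] = [true, true, false, false, false] ++
      (Formula.fixCode w 0 x ++ ((Formula.and ρ (Formula.mentionAll N)).enc ++ [false])) := by
    simp [Formula.query, Formula.enc, Formula.enc_fixVars, unary]
  rw [stacks8_single (x.map bsym).reverse, stacks8_single, e]
  simp only [List.map_append, List.reverse_append, List.append_assoc, List.append_nil] at h5 ⊢
  refine h5.mono ?_
  simp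
  rw [Nat.mul_add _ N, Nat.mul_add _ N]
  omega

/-- Given a fraction, decide whether it is nonzero. -/
def answerCmd : Cmd 8 5 :=
  transfer 0 1 ;; pop 1 fun o => clear 1 ;; push 0 (if o = some 2 then 0 else 1)

theorem run_answerCmd (l : List (Fin 5)) : Run answerCmd (Stacks.single l.reverse)
    (Stacks.single [if l.head? = some 2 then 0 else 1]) (6 * l.length + 10) := by
  have h1 := run_transfer (j := 0) (k := 1) (by decide) (stacks8 l.reverse [] [] [] [] [] [] [])
  simp only [stacks8_0, stacks8_1, stacks8_update1, stacks8_update0, List.reverse_reverse,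
    List.append_nil] at h1
  rw [stacks8_single, stacks8_single]
  have h2 : ∀ (r : List (Fin 5)) (b : Fin 5), Run (clear 1 ;; push 0 b)
      (stacks8 [] r [] [] [] [] [] []) (stacks8 [b] [] [] [] [] [] [] []) (3 * r.length + 2) := by
    intro r b
    have h3 := run_clear 1 (stacks8 [] r [] [] [] [] [] [])
    simp only [stacks8_1, stacks8_update1] at h3
    refine h3.seq (t' := 1) ((run_push (t := 0)).2 ?_)
    simp
  refine (h1.seq ((run_pop (t := 3 * l.length + 2)).2 ?_)).mono (by simp; omega)
  rcases l with _ | ⟨a, l⟩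
  · exact h2 _ _
  · simp only [stacks8_1, stacks8_update1, List.head?_cons]
    exact (h2 _ _).mono (by simp)

end SatProg

/-! ### The machine deciding inputs of a fixed length -/

namespace SatProg

open Cmd

theorem weight_skip {K s : ℕ} : (skip : Cmd K s).toProg.weight = 1 := rfl

theorem weight_push {K s : ℕ} (k : Fin K) (a : Fin s) : (push k a).toProg.weight = 7 := rfl

theorem weight_seq {K s : ℕ} (c d : Cmd K s) :
    (c ;; d).toProg.weight = c.toProg.weight + d.toProg.weight := rfl

theorem weight_switch_le {key : ℕ → ℕ} {f : ℕ → Prog} {B : ℕ} (hf : ∀ v, (f v).weight ≤ B) (n : ℕ) :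
    (Prog.switch key f n).weight ≤ (n + 1) * (B + 1) := by
  induction n with
  | zero => have := hf 0; simp only [Prog.switch]; omega
  | succ n ih =>
    have := hf (n + 1)
    simp only [Prog.switch, Prog.weight]
    rw [Nat.add_mul (n + 1)]
    omega

theorem weight_pop_le {K s : ℕ} {k : Fin K} {f : Option (Fin s) → Cmd K s} {B : ℕ} (hB : 1 ≤ B)
    (hf : ∀ o, (f o).toProg.weight ≤ B) : (pop k f).toProg.weight ≤ (s + 2) * (B + 6) := by
  have h := weight_switch_le (key := track s k) (f := fun v =>
    .seq (.act fun c => .write (setTrack k (0 : Fin (s + 1)) c)) (.seq .home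
      (if h : 0 < v ∧ v ≤ s then (f (some ⟨v - 1, by omega⟩)).toProg else .skip))) (B := B + 5)
    (fun v => by
      simp only [Prog.weight, Prog.home]
      split_ifs
      · have := hf (some ⟨v - 1, by omega⟩); omega
      · simp only [Prog.skip, Prog.weight]; omega) s
  have h1 := hf none
  simp only [Cmd.toProg, Prog.weight, Prog.walk]
  rw [Nat.add_mul s 2]
  rw [Nat.add_mul] at h
  simp only [Nat.add_assoc, Nat.reduceAdd] at h
  omega

theorem weight_pushWord (u : List Bool) : (pushWord u).toProg.weight = 7 * u.length + 1 := by
  induction u with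
  | nil => rfl
  | cons b u ih =>
    rw [pushWord, weight_seq, weight_push, ih, List.length_cons]
    omega

theorem weight_fixCmd_le {w : ℕ → ℕ} {N : ℕ} (j n : ℕ) (hw : ∀ i < n, w (j + i) + 1 < N) :
    (fixCmd w j n).toProg.weight ≤ n * (49 * N + 500) + 1 := by
  induction n generalizing j with
  | zero => simp [fixCmd, weight_skip]
  | succ n ih =>
    have h1 := ih (j + 1) fun i hi => by
      rw [show j + 1 + i = j + (i + 1) by omega]; exact hw _ (by omega)
    have h2 := weight_pop_le (k := (1 : Fin 8)) (B := 7 * (N + 8) + 1) (f := fun o =>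
      pushWord ([true, false] ++ (Formula.lit (w j + 1) (decide (o = some 1))).enc)) (by omega)
      fun o => by
        have h3 := Formula.length_enc_lit (w j + 1) (decide (o = some 1))
        have h4 : w j + 1 < N := hw 0 (by omega)
        rw [weight_pushWord, List.length_append]
        simp only [List.length_cons, List.length_nil]
        omega
    rw [fixCmd, weight_seq, Nat.add_mul]
    omega

/-- Ask a query, run the machine `q` on it, and decide whether the result is nonzero. -/
def decider (w : ℕ → ℕ) (n : ℕ) (u : List Bool) (q : TM) : Prog :=
  .seq (queryCmd w n u).toProg (.seq (.call q) answerCmd.toProg)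

theorem weight_decider_le : ∃ A, ∀ {w : ℕ → ℕ} {N n : ℕ} {u : List Bool} {q : TM},
    (∀ i < n, w i + 1 < N) →
    (decider w n u q).weight ≤ A + n * (49 * N + 500) + 7 * u.length + 2 * q.code.length := by
  refine ⟨(transfer 0 1 : Cmd 8 5).toProg.weight + 38 + answerCmd.toProg.weight,
    fun {w N n u q} hw => ?_⟩
  have h := weight_fixCmd_le (w := w) (N := N) 0 n (by simpa using hw)
  simp only [decider, queryCmd, Prog.weight, weight_seq, weight_pushWord, List.length_cons,
    List.length_nil]
  omega

theorem writesBelow_decider (w : ℕ → ℕ) (n : ℕ) (u : List Bool) (q : TM) :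
    (decider w n u q).WritesBelow ((5 + 1) ^ 8) :=
  ⟨Cmd.writesBelow_toProg _, trivial, Cmd.writesBelow_toProg _⟩

/-- A fraction, as a word over the alphabet of stack programs. -/
def fracSyms (a b : ℕ) : List (Fin 5) := a.bits.map bsym ++ 2 :: b.bits.map bsym

theorem fracWord_eq (a b : ℕ) :
    fracWord a b = (fracSyms a b).map fun c : Fin 5 => (c : ℕ) + 1 := by
  rw [fracWord, word_eq, word_eq, fracSyms, List.map_append, List.map_cons]
  rfl

/-- Since `0` has no binary digits, a fraction vanishes iff its word starts with the separator; no
arithmetic is needed to test it. -/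
theorem head?_fracSyms (a b : ℕ) : (fracSyms a b).head? = some 2 ↔ a = 0 := by
  rcases Nat.eq_zero_or_pos a with rfl | ha
  · simp [fracSyms]
  · have : a.bits ≠ [] := fun h => by
      have := congrArg List.length h
      rw [Nat.size_eq_bits_len, List.length_nil, Nat.size_eq_zero] at this
      omega
    obtain ⟨b', l, h⟩ := List.exists_cons_of_ne_nil this
    have hb : bsym b' ≠ 2 := by cases b' <;> decide
    simp [fracSyms, h, hb, ha.ne']

/-- The three stages fit together because a tape holding only stack `0` is an ordinary word, so
input and output of `q` are stack contents. The bit `0` after the query asks for its conditional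
probability. -/
theorem decider_outputs {w : ℕ → ℕ} {N m T a b : ℕ} {x : List Bool} {ρ : Formula} {q : TM}
    (hw : ∀ i < x.length, w i + 1 < N)
    (hm : x.length * (N + 13) + (Formula.and ρ (Formula.mentionAll N)).enc.length + 10 ≤ m)
    (hq : q.Outputs (word ((Formula.query w ρ N x).enc ++ [false])) (fracWord a b) T) :
    ((decider w x.length ((Formula.and ρ (Formula.mentionAll N)).enc ++ [false]) q).toTM
      ((5 + 1) ^ 8)).Outputs (word x) (word [decide (a ≠ 0)])
      (m * (8 * m + 15) + (T + 1) + (6 * (m + T) + 10) * (28 * (m + T) + 55)) := by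
  have hs : ∀ (l : List (Fin 5)) (k : Fin (7 + 1)),
      (Stacks.single l.reverse k : List (Fin 5)).length ≤ l.length := fun l k => by
    by_cases hk : k = 0 <;> simp [Stacks.single, hk]
  -- The input height and the number of operations are both at most `m`, whence the height bound `2
  -- * m`.
  have h1 := ((run_queryCmd (ρ := ρ) hw).mono hm).toProg.2 (2 * m) fun k => by
    have h2 := hs (x.map bsym) k
    have h3 : x.length ≤ x.length * (N + 13) := Nat.le_mul_of_pos_right _ (by omega)
    rw [List.length_map] at h2
    omega
  have hlen : (fracSyms a b).length ≤ m + T := by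
    have h2 := hq.length_le (zero_notMem_fracWord a b)
    have h3 := Formula.length_enc_query_le (ρ := ρ) hw
    rw [fracWord_eq, List.length_map] at h2
    simp only [word, List.length_map, List.length_append, List.length_singleton] at h2
    rw [Nat.mul_add] at h3 hm
    omega
  have h4 := ((run_answerCmd (fracSyms a b)).mono (t' := 6 * (m + T) + 10) (by omega)).toProg.2
    (7 * (m + T) + 10) fun k => by have := hs (fracSyms a b) k; omega
  have e1 := Stacks.tape_single (K := 7) (x.map bsym)
  have e2 := Stacks.tape_single (K := 7) (((Formula.query w ρ N x).enc ++ [false]).map bsym)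
  have e3 := Stacks.tape_single (K := 7) (fracSyms a b)
  have e4 := Stacks.tape_single (K := 7) ([decide (a ≠ 0)].map bsym)
  have e5 : [if (fracSyms a b).head? = some 2 then 0 else (1 : Fin 5)] =
      ([decide (a ≠ 0)].map bsym).reverse := by
    simp only [head?_fracSyms]
    by_cases ha : a = 0 <;> simp [ha, bsym]
  rw [← word_eq] at e1 e2 e4
  rw [← fracWord_eq] at e3
  rw [e1, e2] at h1
  rw [e5, e3, e4] at h4
  obtain ⟨n, hn, s, h5, h6⟩ := TM.outputs_iff.1 hq
  have h7 : Prog.Run ((5 + 1) ^ 8) (.call q) _ _ (n + 1) :=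
    -- The symbol scanned when `q` halts is admissible, since the output is a tape of stacks.
    .call (wordTape_rep _) (wordTape_rep (fracWord a b)) h5 h6 (e3 ▸ Stacks.head_lt _ _)
  exact Prog.Run.outputs ((h1.seq (h7.seq h4)).mono (by
    rw [show 4 * (2 * m) + 5 + 10 = 8 * m + 15 by omega,
      show 4 * (7 * (m + T) + 10) + 5 + 10 = 28 * (m + T) + 55 by omega]
    omega))

end SatProg

/-! ### Polynomially bounded functions -/

/-- `f` is bounded by a polynomial. -/
def PolyBounded (f : ℕ → ℕ) : Prop := ∃ P : Polynomial ℕ, ∀ n, f n ≤ P.eval n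

theorem eval_mono (P : Polynomial ℕ) : Monotone fun n => P.eval n := by
  intro a b h
  simp only [Polynomial.eval_eq_sum_range]
  exact Finset.sum_le_sum fun i _ => Nat.mul_le_mul_left _ (Nat.pow_le_pow_left h i)

namespace PolyBounded

variable {f g : ℕ → ℕ}

theorem const (c : ℕ) : PolyBounded fun _ => c := ⟨.C c, fun n => by simp⟩

theorem id : PolyBounded fun n => n := ⟨.X, fun n => by simp⟩

theorem add (hf : PolyBounded f) (hg : PolyBounded g) : PolyBounded fun n => f n + g n := by
  obtain ⟨P, hP⟩ := hf
  obtain ⟨Q, hQ⟩ := hg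
  exact ⟨P + Q, fun n => by rw [Polynomial.eval_add]; exact Nat.add_le_add (hP n) (hQ n)⟩

theorem mul (hf : PolyBounded f) (hg : PolyBounded g) : PolyBounded fun n => f n * g n := by
  obtain ⟨P, hP⟩ := hf
  obtain ⟨Q, hQ⟩ := hg
  exact ⟨P * Q, fun n => by rw [Polynomial.eval_mul]; exact Nat.mul_le_mul (hP n) (hQ n)⟩

theorem pow (hf : PolyBounded f) (k : ℕ) : PolyBounded fun n => f n ^ k := by
  obtain ⟨P, hP⟩ := hf
  exact ⟨P ^ k, fun n => by rw [Polynomial.eval_pow]; exact Nat.pow_le_pow_left (hP n) k⟩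

theorem eval (P : Polynomial ℕ) (hf : PolyBounded f) : PolyBounded fun n => P.eval (f n) := by
  obtain ⟨Q, hQ⟩ := hf
  exact ⟨P.comp Q, fun n => by rw [Polynomial.eval_comp]; exact eval_mono P (hQ n)⟩

end PolyBounded

theorem Tableau.polyBounded_acceptingBound (D : ℕ) {t k N : ℕ → ℕ} (ht : PolyBounded t)
    (hk : PolyBounded k) (hN : PolyBounded N) :
    PolyBounded fun n => acceptingBound D (t n) (k n) (N n) := by
  unfold acceptingBound stepsBound
  have hc := PolyBounded.const
  repeat' first
    | exact ht
    | exact hk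
    | exact hN
    | exact hc _
    | apply PolyBounded.add
    | apply PolyBounded.mul

/-- The advice is the description of the deciding machine itself. The empty table halts at once and
thus outputs its advice unchanged. -/
theorem mem_PPoly_of {L : Language Bool} {f : ℕ → ℕ} (hf : PolyBounded f)
    (h : ∀ n, ∃ M : TM, M.code.length ≤ f n ∧
      ∀ x : List Bool, x.length = n → M.Answers (word x) (x ∈ L) (f n)) : L ∈ PPoly := by
  obtain ⟨P, hP⟩ := hf
  choose M h1 h2 using h
  refine ⟨[], fun n => (M n).code, P, fun n => ⟨(h1 n).trans (hP n), M n, ?_, fun x hx => ?_⟩⟩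
  · exact TM.outputs_iff.2 ⟨0, by omega, 0, TM.Steps.refl _ _, rfl⟩
  · exact ⟨fun hL => ((h2 n x hx).1 hL).mono (hP n), fun hL => ((h2 n x hx).2 hL).mono (hP n)⟩

/-- Languages in NP reduce to the local conditional probabilities of `satWeight`. -/
theorem mem_PPoly_of_locallyNormalized {M : TM} {θ : ℕ → List Bool}
    (h : satWeight.EfficientlyLocallyNormalizedBy M θ) {L : Language Bool} (hL : L ∈ NP) :
    L ∈ PPoly := by
  obtain ⟨-, P0, h⟩ := h
  obtain ⟨R, V, T, P, hV, hL⟩ := hL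
  obtain ⟨D, hD⟩ := V.exists_boundedBy
  obtain ⟨A, hA⟩ := SatProg.weight_decider_le
  let k : ℕ → ℕ := fun n => P.eval n
  let t : ℕ → ℕ := fun n => T.eval (n + k n)
  let W : ℕ → ℕ := fun n => 2 * t n + D + n + 8
  let N : ℕ → ℕ := fun n => W n ^ 8 + 2
  let B : ℕ → ℕ := fun n =>
    2 + (Tableau.acceptingBound D (t n) (k n) (N n) + (N n * (2 * N n + 12) + 10))
  let m : ℕ → ℕ := fun n => n * (N n + 13) + B n + 10
  let τ : ℕ → ℕ := fun n => P0.eval (m n)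
  let ω : ℕ → ℕ := fun n => A + n * (49 * N n + 500) + 7 * (B n + 1) + 2 * (2 * τ n)
  -- The first part bounds the length of the decider's description, `ω n` being a bound for its
  -- weight; the second part bounds its running time. Here `m n` bounds the length of queries and `τ
  -- n` the time of the local model on them.
  let f : ℕ → ℕ := fun n => ω n * (((5 + 1) ^ 8 + 1) * (2 * ω n + 2 * (5 + 1) ^ 8 + 6)) + 1 +
    (m n * (8 * m n + 15) + (τ n + 1) + (6 * (m n + τ n) + 10) * (28 * (m n + τ n) + 55))
  have hc := PolyBounded.const
  have hk : PolyBounded k := .eval P .id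
  have ht : PolyBounded t := .eval T (.add .id hk)
  have hW : PolyBounded W := (((hc 2).mul ht).add (hc D)).add .id |>.add (hc 8)
  have hN : PolyBounded N := (hW.pow 8).add (hc 2)
  have hB : PolyBounded B := (hc 2).add ((Tableau.polyBounded_acceptingBound D ht hk hN).add
    ((hN.mul (((hc 2).mul hN).add (hc 12))).add (hc 10)))
  have hm : PolyBounded m := ((PolyBounded.id.mul (hN.add (hc 13))).add hB).add (hc 10)
  have hτ : PolyBounded τ := .eval P0 hm
  have hω : PolyBounded ω := (((hc A).add (.mul .id (((hc 49).mul hN).add (hc 500)))).add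
    ((hc 7).mul (hB.add (hc 1)))).add ((hc 2).mul ((hc 2).mul hτ))
  have hf : PolyBounded f := by
    have hmτ := hm.add hτ
    exact (((hω.mul ((hc _).mul ((((hc 2).mul hω).add (hc _)).add (hc 6)))).add (hc 1))).add
      (((hm.mul (((hc 8).mul hm).add (hc 15))).add (hτ.add (hc 1))).add
        ((((hc 6).mul hmτ).add (hc 10)).mul (((hc 28).mul hmτ).add (hc 55))))
  refine mem_PPoly_of hf fun n => ?_
  obtain ⟨ρ, hρ1, hρ2, hρ3⟩ := Tableau.expressible_accepting V (D := D) (t := t n) (n := n) (k := k n)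
    (N := N n) (W := W n) rfl (by simp only [W]; omega) (by simp only [W]; omega)
    (by simp only [W]; omega)
  obtain ⟨hθ, q, hq, hq'⟩ := h (m n)
  -- The variable telling whether the `j`-th input symbol is the bit `1`; prescribing its value
  -- fixes that bit in the tableau.
  let w : ℕ → ℕ := fun j => Tableau.cellVar 0 (t n + j) 2
  have hw : ∀ j < n, w j + 1 < N n := fun j hj => by
    have := Tableau.cellVar_lt (i := 0) (p := t n + j) (s := 2) (W := W n) (by simp only [W]; omega)
      (by simp only [W]; omega) (by simp only [W]; omega) (by simp only [W]; omega)
    simp only [N, w]; omega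
  have hN0 : 0 < N n := by simp only [N]; omega
  have hu : (Formula.and ρ (Formula.mentionAll (N n))).enc.length ≤ B n := by
    have := Formula.length_enc_mentionAll (le_refl (N n))
    simp only [Formula.enc, List.length_append, List.length_cons, List.length_nil, B]
    omega
  -- The parameters have length at most `τ n`, and the building machine takes at most `τ n` steps.
  have hqc : q.code.length ≤ 2 * τ n := by
    have := TM.Outputs.length_le hq (zero_notMem_word _)
    simp only [word, List.length_map] at this
    simp only [τ]; omega
  refine ⟨(SatProg.decider w n ((Formula.and ρ (Formula.mentionAll (N n))).enc ++ [false]) q).toTM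
    ((5 + 1) ^ 8), ?_, ?_⟩
  · have h1 := hA (q := q) (u := (Formula.and ρ (Formula.mentionAll (N n))).enc ++ [false]) hw
    have h2 : (SatProg.decider w n ((Formula.and ρ (Formula.mentionAll (N n))).enc ++ [false])
        q).weight ≤ ω n := by
      simp only [List.length_append, List.length_singleton] at h1
      simp only [ω]; omega
    refine (Prog.length_code_toTM_le (SatProg.writesBelow_decider _ _ _ _)).trans ?_
    refine le_trans ?_ (Nat.le_add_right _ _)
    gcongr
  · rintro x rfl
    set φ := Formula.query w ρ (N x.length) x
    obtain ⟨h1, h2, h3⟩ := localProb_enc_spec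
      (Formula.query_satisfiedBy (ρ := ρ) (x := x) hN0 hw hρ2) false
    have hφ : φ.enc.length ≤ m x.length := by
      have : φ.enc.length ≤ _ := Formula.length_enc_query_le hw
      rw [Nat.mul_add] at this
      simp only [m, Nat.mul_add]
      omega
    obtain ⟨a, b, hb, hab, hout⟩ := (hq' φ.enc (some false) hφ).2 h1 h2
    have h4 := (SatProg.decider_outputs (m := m x.length) hw (by simp only [m]; omega) hout).mono
      (t' := f x.length) (Nat.le_add_left _ _)
    have h5 : x ∈ L ↔ a ≠ 0 := by
      have e1 := Formula.satsFrom_query (x := x) hN0 hw hρ2 hρ1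
      have e2 := Tableau.exists_accepting_iff (k := k x.length) (R := R x) hD (rfl : x.length = _)
        (t := t x.length) fun c hc => by
          have e4 : T.eval (x.length + c.length) ≤ t x.length :=
            eval_mono T (Nat.add_le_add_left hc _)
          exact ⟨fun h => ((hV x c).1 h).mono e4, fun h => ((hV x c).2 h).mono e4⟩
      have e3 : a = 0 ↔ φ.satsFrom [false] = ∅ := by
        rw [← h3, ← hab]
        simp [hb]
      rw [hL, ← e2, Ne, e3, e1, not_not]
    exact ⟨fun hx => by simpa [h5.1 hx] using h4,
      fun hx => by simpa [not_not.1 (fun h => hx (h5.2 h))] using h4⟩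

end SeqModel

theorem theorem1 :
    SeqModel.satWeight.EfficientlyComputable ∧
    SeqModel.satWeight.Normalizable ∧
    (¬ SeqModel.NP ⊆ SeqModel.PPoly →
      ¬ ∃ (M : SeqModel.TM) (θ : ℕ → List Bool),
        SeqModel.satWeight.EfficientlyLocallyNormalizedBy M θ) := by
  refine ⟨SeqModel.satWeight_efficientlyComputable, SeqModel.satWeight_normalizable, ?_⟩
  rintro hNP ⟨M, θ, h⟩
  exact hNP fun L hL => SeqModel.mem_PPoly_of_locallyNormalized h hL
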